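/- Let $n\ge 1$ and let $(M,g_M)$, $(N,g_N)$ be oriented smooth Riemannian manifolds of dimension $n$ (Hausdorff, second countable, without boundary). Let $p\in M$, $q\in N$, $\varepsilon>0$, and let $\varphi:B(p,2\varepsilon)\to\{|y|<2\varepsilon\}\subset\mathbb R^n$ and $\psi:B'(q,2\varepsilon)\to\{|y|<2\varepsilon\}$ be exponential charts, i.e. $\varphi^{-1}=\exp_p\circ A$ and $\psi^{-1}=\exp_q\circ A'$ with linear isometries $A:\mathbb R^n\to T_pM$, $A':\mathbb R^n\to T_qN$; assume that $\varphi$ preserves and $\psi$ reverses the orientation. Put $i_1=\varphi/\varepsilon$, $i_2=\psi/\varepsilon$. Let $$M\sharp N=\big((M\setminus B(p,\varepsilon))\sqcup(N\setminus B'(q,\varepsilon))\big)/\sim$$ with the quotient topology, where $x\sim y$ if $|i_1(x)|=1$ and $i_1(x)=i_2(y)$; let $\pi$ be the projection, $O$ the union of the annuli $B(p,2\varepsilon)\setminus B(p,\varepsilon)$ and $B'(q,2\varepsilon)\setminus B'(q,\varepsilon)$, and let $\Phi$ be defined on $\pi(O)$ by $\Phi([x])=i_1(x)$ on the first annulus and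 $\Phi([x])=i_2(x)/|i_2(x)|^2$ on the second one. Then: 1. $M\sharp N$ is Hausdorff and second countable (and compact if $M$ and $N$ are), and it has a smooth manifold structure for which the inclusions of $M\setminus\bar B(p,\varepsilon)$ and $N\setminus\bar B'(q,\varepsilon)$ are diffeomorphisms onto open subsets and $\Phi$ is a smooth chart from the open set $\pi(O)$ onto $\{1/2<|y|<2\}$. 2. $M\sharp N$ is orientable: the charts of oriented atlases of $M$ and $N$ (restricted to these open subsets), together with $\Phi$, form an oriented atlas. 3. There are smooth functions $\chi_1,\chi_0,\chi_2\ge 0$ on $M\sharp N$ with $\chi_1+\chi_0+\chi_2=1$ and with closed supports contained respectively in the image of $M\setminus\bar B(p,\varepsilon)$, in $\pi(O)$, and in the image of $N\setminus\bar B'(q,\varepsilon)$. For all such functions, with $\delta$ the Euclidean metric, $$g=\chi_1g_M+\chi_0\,\Phi^*\delta+\chi_2g_N$$ is a smooth Riemannian metric on $M\sharp N$; it coincides with $g_M$ on $M\setminus B(p,2\varepsilon)$ and with $g_N$ on $N\setminus B'(q,2\varepsilon)$. If $g_M$, $g_N$ are locally conformally flat and the charts $\varphi$, $\psi$ are conformal,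 then $g$ is locally conformally flat. 4. If $g_M$ and $g_N$ are locally conformally flat (each point lies in a chart in which the metric is a positive function times the Euclidean metric), then $M\sharp N$ has a locally conformally flat Riemannian metric, which can be chosen to coincide with $g_M$ on $M\setminus B(p,2\varepsilon)$ and with $g_N$ on $N\setminus B'(q,2\varepsilon)$. 5. Suppose that $\mathcal A$, $\mathcal B$ are smooth atlases of $M$, $N$ which consist of charts conformal for $g_M$, $g_N$ and whose changes of charts are locally Möbius transformations (compositions of isometries of $\mathbb R^n$ and inversions in spheres). Then $M\sharp N$ has a smooth atlas $\mathcal C$ whose changes of charts are locally Möbius transformations, and a Riemannian metric $g$ for which the charts of $\mathcal C$ are conformal, such that $g$ coincides with $g_M$ on $M\setminus B(p,2\varepsilon)$ and with $g_N$ on $N\setminus B'(q,2\varepsilon)$, and such that the changes of charts between $\mathcal C$ and the charts of $\mathcal A$ (of $\mathcal B$) whose domain does not meet $B(p,2\varepsilon)$ ($B'(q,2\varepsilon)$) are locally Möbius. If moreover the changes of charts between $\mathcal A$ and $\varphi$ and between $\mathcal B$ and $\psi$ are locally Möbius, then the charts of $\mathcal A$ and $\mathcal B$ (restricted to $M\setminus\bar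 B(p,\varepsilon)$, $N\setminus\bar B'(q,\varepsilon)$) together with $\Phi$ form such an atlas of $M\sharp N$ with locally Möbius changes of charts. -/

import Mathlib

open scoped Manifold ContDiff Topology

namespace ConnectedSum

/-- The model space `ℝⁿ` with its Euclidean norm. -/
abbrev E (n : ℕ) : Type := EuclideanSpace ℝ (Fin n)

/-- A smooth Riemannian metric on a smooth `n`-manifold. -/
abbrev RMetric (n : ℕ) (M : Type*) [TopologicalSpace M] [ChartedSpace (E n) M]
    [IsManifold 𝓘(ℝ, E n) ∞ M] :=
  Bundle.ContMDiffRiemannianMetric 𝓘(ℝ, E n) ∞ (E n)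
    (fun x : M => TangentSpace 𝓘(ℝ, E n) x)

/-- The charts of the smooth structure of `M`. -/
abbrev smoothCharts (n : ℕ) (M : Type*) [TopologicalSpace M] [ChartedSpace (E n) M] :
    Set (OpenPartialHomeomorph M (E n)) :=
  IsManifold.maximalAtlas 𝓘(ℝ, E n) ∞ M

section Riemannian

variable {n : ℕ} {M : Type*} [TopologicalSpace M] [ChartedSpace (E n) M]
  [IsManifold 𝓘(ℝ, E n) ∞ M]

/-- The metric read in the chart `e`: the inner product of `a` and `b` at the point of
coordinates `y` (meaningful for `y ∈ e.target`). -/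
noncomputable def coordMetric (g : RMetric n M) (e : OpenPartialHomeomorph M (E n))
    (y a b : E n) : ℝ :=
  g.inner (e.symm y) (mfderiv 𝓘(ℝ, E n) 𝓘(ℝ, E n) e.symm y a)
    (mfderiv 𝓘(ℝ, E n) 𝓘(ℝ, E n) e.symm y b)

/-- The Christoffel symbol of the first kind of `g` in the chart `e`:
`(∂_u g(v,w) + ∂_v g(u,w) - ∂_w g(u,v)) / 2`, that is `g(∇_u v, w)` for constant `u`, `v`, `w`. -/
noncomputable def christoffel (g : RMetric n M) (e : OpenPartialHomeomorph M (E n))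
    (y u v w : E n) : ℝ :=
  (lineDeriv ℝ (fun z => coordMetric g e z v w) y u
    + lineDeriv ℝ (fun z => coordMetric g e z u w) y v
    - lineDeriv ℝ (fun z => coordMetric g e z u v) y w) / 2

/-- `γ` is a geodesic of `g` on the open set of times `s`: it is smooth there and satisfies
`c'' + Γ(c', c') = 0` (with the index lowered by `g`) in every chart, `c` being `γ` in that
chart. -/
def IsGeodesicOn (g : RMetric n M) (γ : ℝ → M) (s : Set ℝ) : Prop :=
  IsOpen s ∧ ContMDiffOn 𝓘(ℝ, ℝ) 𝓘(ℝ, E n) ∞ γ s ∧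
    ∀ t ∈ s, ∀ e ∈ smoothCharts n M, γ t ∈ e.source → ∀ w : E n,
      coordMetric g e (e (γ t)) (deriv (deriv (fun τ => e (γ τ))) t) w
        + christoffel g e (e (γ t)) (deriv (fun τ => e (γ τ)) t)
            (deriv (fun τ => e (γ τ)) t) w = 0

/-- `φ` is an exponential chart of `g` at `p` on the geodesic ball `B(p, r)`: its inverse is
`exp_p ∘ A` on the ball of radius `r` of `ℝⁿ`, where `A : ℝⁿ → T_pM` is a linear isometry
(namely the differential of the inverse of `φ` at `0`), i.e. `t ↦ φ⁻¹(t v)` is the geodesic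
from `p` of initial velocity `A v`. -/
structure IsExpChart (g : RMetric n M) (p : M) (r : ℝ)
    (φ : OpenPartialHomeomorph M (E n)) : Prop where
  mem_smoothCharts : φ ∈ smoothCharts n M
  mem_source : p ∈ φ.source
  map_center : φ p = 0
  target_eq : φ.target = Metric.ball 0 r
  isometry_zero : ∀ a b : E n, coordMetric g φ 0 a b = inner ℝ a b
  geodesic : ∀ v : E n,
    IsGeodesicOn g (fun t : ℝ => φ.symm (t • v)) {t : ℝ | t • v ∈ Metric.ball (0 : E n) r}

/-- The chart `e` is conformal: in it, the metric is a positive multiple of the Euclidean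
metric at each point. -/
def IsConformalChart (g : RMetric n M) (e : OpenPartialHomeomorph M (E n)) : Prop :=
  e ∈ smoothCharts n M ∧
    ∀ y ∈ e.target, ∃ c : ℝ, 0 < c ∧ ∀ a b : E n, coordMetric g e y a b = c * inner ℝ a b

/-- The metric is locally conformally flat. -/
def IsLocallyConformallyFlat (g : RMetric n M) : Prop :=
  ∀ x : M, ∃ e, IsConformalChart g e ∧ x ∈ e.source

end Riemannian

section Mobius

/-- The inversion of `ℝⁿ ∪ {∞}` in the sphere of centre `c` and radius `R`. -/
noncomputable def inversionExt {n : ℕ} (c : E n) (R : ℝ) (z : OnePoint (E n)) :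
    OnePoint (E n) :=
  open Classical in
  z.elim (c : OnePoint (E n))
    (fun x => if x = c then OnePoint.infty else (EuclideanGeometry.inversion c R x : E n))

/-- The Möbius transformations of `ℝⁿ ∪ {∞}`: the compositions of isometries of `ℝⁿ` and
of inversions in spheres. -/
inductive IsMobius {n : ℕ} : (OnePoint (E n) → OnePoint (E n)) → Prop
  | isometry (f : E n ≃ᵢ E n) : IsMobius (OnePoint.map f)
  | inversion (c : E n) (R : ℝ) (hR : 0 < R) : IsMobius (inversionExt c R)
  | comp {f g : OnePoint (E n) → OnePoint (E n)} :
      IsMobius f → IsMobius g → IsMobius (f ∘ g)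

/-- The change of charts from `e` to `e'` is, near each point, a Möbius transformation. -/
def MobiusCompatible {n : ℕ} {M : Type*} [TopologicalSpace M]
    (e e' : OpenPartialHomeomorph M (E n)) : Prop :=
  ∀ y ∈ (e.symm ≫ₕ e').source, ∃ m : OnePoint (E n) → OnePoint (E n), IsMobius m ∧
    ∀ᶠ z : E n in 𝓝 y, m (z : OnePoint (E n)) = (((e.symm ≫ₕ e') z : E n) : OnePoint (E n))

/-- An atlas of the smooth manifold `M` whose changes of charts are Möbius transformations. -/
structure IsMobiusAtlas {n : ℕ} {M : Type*} [TopologicalSpace M] [ChartedSpace (E n) M]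
    (A : Set (OpenPartialHomeomorph M (E n))) : Prop where
  subset : A ⊆ smoothCharts n M
  cover : ∀ x : M, ∃ e ∈ A, x ∈ e.source
  compatible : ∀ e ∈ A, ∀ e' ∈ A, MobiusCompatible e e'

end Mobius

section Orientation

/-- An oriented atlas of the smooth manifold `M`: the changes of charts have positive
Jacobian determinant. -/
structure IsOrientedAtlas {n : ℕ} {M : Type*} [TopologicalSpace M] [ChartedSpace (E n) M]
    (A : Set (OpenPartialHomeomorph M (E n))) : Prop where
  subset : A ⊆ smoothCharts n M
  cover : ∀ x : M, ∃ e ∈ A, x ∈ e.source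
  jacobian_pos : ∀ e ∈ A, ∀ e' ∈ A, ∀ y ∈ (e.symm ≫ₕ e').source,
    0 < (fderiv ℝ (e.symm ≫ₕ e') y).det

/-- The chart `φ` preserves the orientation defined by the oriented atlas `A`. -/
def PreservesOrientation {n : ℕ} {M : Type*} [TopologicalSpace M]
    (A : Set (OpenPartialHomeomorph M (E n))) (φ : OpenPartialHomeomorph M (E n)) : Prop :=
  ∀ e ∈ A, ∀ y ∈ (e.symm ≫ₕ φ).source, 0 < (fderiv ℝ (e.symm ≫ₕ φ) y).det

/-- The chart `φ` reverses the orientation defined by the oriented atlas `A`. -/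
def ReversesOrientation {n : ℕ} {M : Type*} [TopologicalSpace M]
    (A : Set (OpenPartialHomeomorph M (E n))) (φ : OpenPartialHomeomorph M (E n)) : Prop :=
  ∀ e ∈ A, ∀ y ∈ (e.symm ≫ₕ φ).source, (fderiv ℝ (e.symm ≫ₕ φ) y).det < 0

end Orientation

section Sum

variable {n : ℕ} {M N : Type*} [TopologicalSpace M] [TopologicalSpace N]

/-- The open ball `B(p, r)`, for a chart `φ` centred at `p`. -/
def chartBall (φ : OpenPartialHomeomorph M (E n)) (r : ℝ) : Set M :=
  {x | x ∈ φ.source ∧ ‖φ x‖ < r}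

/-- The closed ball of radius `r` about `p`, for a chart `φ` centred at `p`. -/
def chartClosedBall (φ : OpenPartialHomeomorph M (E n)) (r : ℝ) : Set M :=
  {x | x ∈ φ.source ∧ ‖φ x‖ ≤ r}

/-- The disjoint union of `M \ B(p, ε)` and `N \ B(q, ε)`. -/
abbrev PreSum (φ : OpenPartialHomeomorph M (E n)) (ψ : OpenPartialHomeomorph N (E n))
    (ε : ℝ) :=
  {x : M // x ∉ chartBall φ ε} ⊕ {y : N // y ∉ chartBall ψ ε}

/-- A point of the sphere of radius `ε` about `p` is identified with the point of the sphere of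
radius `ε` about `q` that has the same coordinates. -/
def GlueRel (φ : OpenPartialHomeomorph M (E n)) (ψ : OpenPartialHomeomorph N (E n))
    (ε : ℝ) (a b : PreSum φ ψ ε) : Prop :=
  ∃ x y, a = Sum.inl x ∧ b = Sum.inr y ∧ x.1 ∈ φ.source ∧ y.1 ∈ ψ.source ∧
    ‖φ x.1‖ = ε ∧ φ x.1 = ψ y.1

/-- The connected sum `M ♯ N`, as the quotient topological space of the disjoint union by the
equivalence relation generated by the identification of the two boundary spheres. -/
def ConnSum (φ : OpenPartialHomeomorph M (E n)) (ψ : OpenPartialHomeomorph N (E n))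
    (ε : ℝ) :=
  Quot (GlueRel φ ψ ε)

instance (φ : OpenPartialHomeomorph M (E n)) (ψ : OpenPartialHomeomorph N (E n))
    (ε : ℝ) : TopologicalSpace (ConnSum φ ψ ε) :=
  inferInstanceAs (TopologicalSpace (Quot (GlueRel φ ψ ε)))

/-- The projection to the quotient. -/
def proj (φ : OpenPartialHomeomorph M (E n)) (ψ : OpenPartialHomeomorph N (E n)) (ε : ℝ) :
    PreSum φ ψ ε → ConnSum φ ψ ε :=
  Quot.mk _

/-- The two half-open annuli `B(p, 2ε) \ B(p, ε)` and `B(q, 2ε) \ B(q, ε)`. -/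
def annuli (φ : OpenPartialHomeomorph M (E n)) (ψ : OpenPartialHomeomorph N (E n)) (ε : ℝ) :
    Set (PreSum φ ψ ε) :=
  {a | Sum.elim (fun x => x.1 ∈ chartBall φ (2 * ε)) (fun y => y.1 ∈ chartBall ψ (2 * ε)) a}

/-- The gluing map before passing to the quotient. With the rescaled charts `i₁ = φ / ε` and
`i₂ = ψ / ε` it is `i₁` on the first annulus and `i₂ / |i₂|²` on the second one. -/
noncomputable def preGlue (φ : OpenPartialHomeomorph M (E n))
    (ψ : OpenPartialHomeomorph N (E n)) (ε : ℝ) : PreSum φ ψ ε → E n :=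
  Sum.elim (fun x => ε⁻¹ • φ x.1)
    (fun y => (‖ε⁻¹ • ψ y.1‖ ^ 2)⁻¹ • (ε⁻¹ • ψ y.1))

/-- The gluing maps of a connected sum carrying a smooth structure: the two inclusions are
diffeomorphisms onto open subsets, and the gluing map is a smooth chart. -/
structure GluingMaps [ChartedSpace (E n) M] [ChartedSpace (E n) N]
    (φ : OpenPartialHomeomorph M (E n)) (ψ : OpenPartialHomeomorph N (E n)) (ε : ℝ)
    [ChartedSpace (E n) (ConnSum φ ψ ε)] where
  /-- the inclusion of the complement of the closed ball about `p` -/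
  inM : OpenPartialHomeomorph M (ConnSum φ ψ ε)
  inM_source : inM.source = (chartClosedBall φ ε)ᶜ
  inM_apply : ∀ x : {x : M // x ∉ chartBall φ ε}, x.1 ∈ inM.source →
    inM x.1 = proj φ ψ ε (Sum.inl x)
  inM_smooth : ContMDiffOn 𝓘(ℝ, E n) 𝓘(ℝ, E n) ∞ inM inM.source
  inM_symm_smooth : ContMDiffOn 𝓘(ℝ, E n) 𝓘(ℝ, E n) ∞ inM.symm inM.target
  /-- the inclusion of the complement of the closed ball about `q` -/
  inN : OpenPartialHomeomorph N (ConnSum φ ψ ε)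
  inN_source : inN.source = (chartClosedBall ψ ε)ᶜ
  inN_apply : ∀ y : {y : N // y ∉ chartBall ψ ε}, y.1 ∈ inN.source →
    inN y.1 = proj φ ψ ε (Sum.inr y)
  inN_smooth : ContMDiffOn 𝓘(ℝ, E n) 𝓘(ℝ, E n) ∞ inN inN.source
  inN_symm_smooth : ContMDiffOn 𝓘(ℝ, E n) 𝓘(ℝ, E n) ∞ inN.symm inN.target
  /-- the gluing chart `Φ` -/
  glue : OpenPartialHomeomorph (ConnSum φ ψ ε) (E n)
  glue_source : glue.source = proj φ ψ ε '' annuli φ ψ ε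
  glue_apply : ∀ a ∈ annuli φ ψ ε, glue (proj φ ψ ε a) = preGlue φ ψ ε a
  glue_target : glue.target = {y : E n | 1 / 2 < ‖y‖ ∧ ‖y‖ < 2}
  glue_mem : glue ∈ smoothCharts n (ConnSum φ ψ ε)

variable [ChartedSpace (E n) M] [ChartedSpace (E n) N]
  {φ : OpenPartialHomeomorph M (E n)} {ψ : OpenPartialHomeomorph N (E n)} {ε : ℝ}
  [ChartedSpace (E n) (ConnSum φ ψ ε)]

/-- The charts of `M ♯ N` obtained from those of `A` on `M`, those of `B` on `N`, and the
gluing chart. -/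
def gluedAtlas (j : GluingMaps φ ψ ε) (A : Set (OpenPartialHomeomorph M (E n)))
    (B : Set (OpenPartialHomeomorph N (E n))) :
    Set (OpenPartialHomeomorph (ConnSum φ ψ ε) (E n)) :=
  (fun e => j.inM.symm ≫ₕ e) '' A ∪ (fun e => j.inN.symm ≫ₕ e) '' B ∪ {j.glue}

/-- A smooth partition of unity made of a function `χ₁` living on the part of `M`, a function
`χ₀` living on the gluing region, and a function `χ₂` living on the part of `N`. -/
structure IsCutoff (j : GluingMaps φ ψ ε) (χ₁ χ₀ χ₂ : ConnSum φ ψ ε → ℝ) : Prop where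
  smooth₁ : ContMDiff 𝓘(ℝ, E n) 𝓘(ℝ, ℝ) ∞ χ₁
  smooth₀ : ContMDiff 𝓘(ℝ, E n) 𝓘(ℝ, ℝ) ∞ χ₀
  smooth₂ : ContMDiff 𝓘(ℝ, E n) 𝓘(ℝ, ℝ) ∞ χ₂
  nonneg : ∀ z, 0 ≤ χ₁ z ∧ 0 ≤ χ₀ z ∧ 0 ≤ χ₂ z
  sum_eq_one : ∀ z, χ₁ z + χ₀ z + χ₂ z = 1
  support₁ : tsupport χ₁ ⊆ j.inM.target
  support₀ : tsupport χ₀ ⊆ j.glue.source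
  support₂ : tsupport χ₂ ⊆ j.inN.target

variable [IsManifold 𝓘(ℝ, E n) ∞ M] [IsManifold 𝓘(ℝ, E n) ∞ N]
  [IsManifold 𝓘(ℝ, E n) ∞ (ConnSum φ ψ ε)]

/-- `g = χ₁ g_M + χ₀ Φ^*(δ) + χ₂ g_N`, where `δ` is the Euclidean metric, `Φ` the gluing chart,
and `g_M`, `g_N` are transported to `M ♯ N` by the inclusions. -/
def IsGluedMetric (gM : RMetric n M) (gN : RMetric n N) (j : GluingMaps φ ψ ε)
    (χ₁ χ₀ χ₂ : ConnSum φ ψ ε → ℝ) (g : RMetric n (ConnSum φ ψ ε)) : Prop :=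
  ∀ (z : ConnSum φ ψ ε) (v w : TangentSpace 𝓘(ℝ, E n) z),
    g.inner z v w =
      χ₁ z * gM.inner (j.inM.symm z) (mfderiv 𝓘(ℝ, E n) 𝓘(ℝ, E n) j.inM.symm z v)
          (mfderiv 𝓘(ℝ, E n) 𝓘(ℝ, E n) j.inM.symm z w)
      + χ₀ z * inner (E := E n) ℝ (mfderiv 𝓘(ℝ, E n) 𝓘(ℝ, E n) j.glue z v)
          (mfderiv 𝓘(ℝ, E n) 𝓘(ℝ, E n) j.glue z w)
      + χ₂ z * gN.inner (j.inN.symm z) (mfderiv 𝓘(ℝ, E n) 𝓘(ℝ, E n) j.inN.symm z v)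
          (mfderiv 𝓘(ℝ, E n) 𝓘(ℝ, E n) j.inN.symm z w)

/-- `g` coincides with `g_M` and `g_N` outside the domains `B(p, 2ε)` and `B(q, 2ε)` of the
charts used in the gluing. -/
def AgreesOutside (gM : RMetric n M) (gN : RMetric n N) (j : GluingMaps φ ψ ε)
    (g : RMetric n (ConnSum φ ψ ε)) : Prop :=
  (∀ x : M, x ∉ φ.source → ∀ v w : TangentSpace 𝓘(ℝ, E n) x,
    g.inner (j.inM x) (mfderiv 𝓘(ℝ, E n) 𝓘(ℝ, E n) j.inM x v)
      (mfderiv 𝓘(ℝ, E n) 𝓘(ℝ, E n) j.inM x w) = gM.inner x v w) ∧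
  (∀ y : N, y ∉ ψ.source → ∀ v w : TangentSpace 𝓘(ℝ, E n) y,
    g.inner (j.inN y) (mfderiv 𝓘(ℝ, E n) 𝓘(ℝ, E n) j.inN y v)
      (mfderiv 𝓘(ℝ, E n) 𝓘(ℝ, E n) j.inN y w) = gN.inner y v w)

end Sum

end ConnectedSum

/-!
The signed height `‖φ‖ - ε` on the side of `M`, `ε - ‖ψ‖` on the side of `N`, is a continuous
function on the connected sum: it separates the points of different heights, while those of one
height lie together in one of the open pieces `M ∖ B̄(p, ε)`, `N ∖ B̄(q, ε)` and the neck. Hence the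
quotient is Hausdorff. In the coordinate `Φ` the neck is an annulus: on the side of `M`, `Φ` is the
chart `φ / ε`, on the side of `N` it is the chart `ψ / ε` followed by the inversion in the unit
sphere. Any local relation between charts that these two readings satisfy on each side (smoothness,
positivity of the Jacobian, being Möbius) therefore holds on the whole connected sum; the inversion
reverses the orientation, which compensates for `ψ`. It is moreover conformal, so a convex
combination of `g_M`, `Φ^* δ` and `g_N` is conformally flat when `φ` and `ψ` are conformal.

In general `φ` is only conformal at its centre. There a chart conformal for the metric, composed
with a similarity, has the same differential as `φ`, so a diffeomorphism `F` supported in the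
domain of `φ` can be chosen such that on a smaller ball `φ` is a similarity applied to that
conformal chart composed with `F`. Pulling back the metric and the atlas by `F` reduces to the case
of conformal charts, at the price of a thinner neck.
-/

namespace ConnectedSum

/-! ### Fields of bilinear forms -/

section PositiveForms

variable {V : Type*} [NormedAddCommGroup V] [NormedSpace ℝ V]

theorem isCoercive_of_forall_pos [FiniteDimensional ℝ V] (B : V →L[ℝ] V →L[ℝ] ℝ)
    (hB : ∀ v, v ≠ 0 → 0 < B v v) : IsCoercive B := by
  rcases subsingleton_or_nontrivial V with _ | _
  · exact ⟨1, one_pos, fun v => by simp [Subsingleton.elim v 0]⟩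
  obtain ⟨u, hu, hmin⟩ := (isCompact_sphere (0 : V) 1).exists_isMinOn
    (NormedSpace.sphere_nonempty.2 zero_le_one)
    (show Continuous fun v => B v v by fun_prop).continuousOn
  refine ⟨B u u, hB u (ne_zero_of_mem_unit_sphere ⟨u, hu⟩), fun v => ?_⟩
  rcases eq_or_ne v 0 with rfl | hv
  · simp
  have hv' : ‖v‖ ≠ 0 := norm_ne_zero_iff.2 hv
  have hunit : ‖v‖⁻¹ • v ∈ Metric.sphere (0 : V) 1 := by simp [norm_smul, inv_mul_cancel₀ hv']
  calc B u u * ‖v‖ * ‖v‖ ≤ B (‖v‖⁻¹ • v) (‖v‖⁻¹ • v) * ‖v‖ * ‖v‖ := by gcongr; exact hmin hunit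
    _ = B v v := by simp only [map_smul, smul_apply, smul_eq_mul]; field_simp

theorem isVonNBounded_setOf_lt_one_of_isCoercive {B : V →L[ℝ] V →L[ℝ] ℝ} (hB : IsCoercive B) :
    Bornology.IsVonNBounded ℝ {v : V | B v v < 1} := by
  obtain ⟨c, hc, hle⟩ := hB
  refine NormedSpace.isVonNBounded_iff ℝ |>.2 <| isBounded_iff_forall_norm_le.2
    ⟨√c⁻¹, fun v (hv : B v v < 1) => Real.le_sqrt_of_sq_le ?_⟩
  rw [← one_div, le_div_iff₀ hc]
  linarith [hle v]

theorem contDiff_bilinearComp_self {W : Type*} [NormedAddCommGroup W] [NormedSpace ℝ W]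
    [FiniteDimensional ℝ W] : ContDiff ℝ ∞
    fun q : (V →L[ℝ] V →L[ℝ] ℝ) × (W →L[ℝ] V) => q.1.bilinearComp q.2 q.2 := by
  refine contDiff_clm_apply_iff.2 fun a => contDiff_clm_apply_iff.2 fun b => ?_
  simp only [ContinuousLinearMap.bilinearComp_apply]
  fun_prop

end PositiveForms

section Forms

variable {V : Type*} [NormedAddCommGroup V] [NormedSpace ℝ V]
  {X M : Type*} [TopologicalSpace X] [ChartedSpace V X] [TopologicalSpace M] [ChartedSpace V M]

/-- Fields of continuous bilinear forms on the tangent spaces of a manifold `X` modelled on `V`,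
all of which are definitionally equal to `V`. -/
abbrev FormField (V : Type*) [NormedAddCommGroup V] [NormedSpace ℝ V] (X : Type*) :=
  X → V →L[ℝ] V →L[ℝ] ℝ

/-- The derivative `mfderiv` of a map between manifolds modelled on `V`, as an endomorphism
of `V`. -/
noncomputable def tderiv (f : X → M) (x : X) : V →L[ℝ] V :=
  mfderiv 𝓘(ℝ, V) 𝓘(ℝ, V) f x

/-- The pullback `f^* G` of a field of bilinear forms. -/
noncomputable def pullbackForm (f : X → M) (G : FormField V M) : FormField V X := fun x =>
  (G (f x)).bilinearComp (tderiv f x) (tderiv f x)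

theorem pullbackForm_apply (f : X → M) (G : FormField V M) (x : X) (v w : V) :
    pullbackForm f G x v w = G (f x) (tderiv f x v) (tderiv f x w) := rfl

variable [IsManifold 𝓘(ℝ, V) ∞ X] [IsManifold 𝓘(ℝ, V) ∞ M]

/-- The inverse, at `x`, of the trivialization of the tangent bundle centred at `x₀`, as an
endomorphism of `V`. -/
noncomputable def trivSymm (x₀ x : X) : V →L[ℝ] V :=
  (trivializationAt V (TangentSpace 𝓘(ℝ, V)) x₀).symmL ℝ x

/-- A field of bilinear forms read in the trivialization of the tangent bundle centred at `x₀`. -/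
noncomputable def formInTrivialization (G : FormField V X) (x₀ x : X) : V →L[ℝ] V →L[ℝ] ℝ :=
  (G x).bilinearComp (trivSymm x₀ x) (trivSymm x₀ x)

/-- Smoothness at a point of a field of bilinear forms, as a section of the bundle of bilinear
forms (see `smoothFormAt_iff`). -/
def SmoothFormAt (G : FormField V X) (x₀ : X) : Prop :=
  ContMDiffAt 𝓘(ℝ, V) 𝓘(ℝ, V →L[ℝ] V →L[ℝ] ℝ) ∞ (formInTrivialization G x₀) x₀

theorem inCoordinates_eventuallyEq_formInTrivialization (G : FormField V X) (x₀ : X) :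
    (fun x => ContinuousLinearMap.inCoordinates V (fun x : X => TangentSpace 𝓘(ℝ, V) x)
      (V →L[ℝ] ℝ) (fun x : X => TangentSpace 𝓘(ℝ, V) x →L[ℝ] ℝ) x₀ x x₀ x (G x))
      =ᶠ[𝓝 x₀] formInTrivialization G x₀ := by
  filter_upwards [(chartAt V x₀).open_source.mem_nhds (mem_chart_source _ x₀)] with x hx
  have hx' : x ∈ (trivializationAt V (fun x : X => TangentSpace 𝓘(ℝ, V) x) x₀).baseSet := by
    simpa using hx
  ext a b
  have h := inCoordinates_apply_eq₂ (F₁ := V) (F₂ := V) (F₃ := ℝ)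
    (E₁ := fun x : X => TangentSpace 𝓘(ℝ, V) x) (E₂ := fun x : X => TangentSpace 𝓘(ℝ, V) x)
    (E₃ := fun _ : X => ℝ) (x₀ := x₀) (x := x) (ϕ := G x) (v := a) (w := b) hx' hx'
    (Set.mem_univ _)
  simp only [Bundle.Trivial.fiberBundle_trivializationAt',
    Bundle.Trivial.linearMapAt_trivialization, LinearMap.id_coe, id_eq,
    ← Bundle.Trivialization.symmL_apply (R := ℝ) _ hx'] at h
  exact h

theorem smoothFormAt_iff (G : FormField V X) (x₀ : X) :
    SmoothFormAt G x₀ ↔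
      ContMDiffAt 𝓘(ℝ, V) (𝓘(ℝ, V).prod 𝓘(ℝ, V →L[ℝ] V →L[ℝ] ℝ)) ∞
        (fun x => Bundle.TotalSpace.mk' (V →L[ℝ] V →L[ℝ] ℝ)
          (E := fun x : X => TangentSpace 𝓘(ℝ, V) x →L[ℝ] TangentSpace 𝓘(ℝ, V) x →L[ℝ] ℝ)
          x (G x)) x₀ := by
  have h := inCoordinates_eventuallyEq_formInTrivialization G x₀
  rw [contMDiffAt_hom_bundle]
  exact ⟨fun hG => ⟨contMDiffAt_id, hG.congr_of_eventuallyEq h⟩,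
    fun hG => hG.2.congr_of_eventuallyEq h.symm⟩

theorem SmoothFormAt.congr {G G' : FormField V X} {x₀ : X} (h : SmoothFormAt G x₀)
    (hG : G' =ᶠ[𝓝 x₀] G) : SmoothFormAt G' x₀ := by
  refine ContMDiffAt.congr_of_eventuallyEq h ?_
  filter_upwards [hG] with x hx
  rw [formInTrivialization, formInTrivialization, hx]

theorem SmoothFormAt.add {G G' : FormField V X} {x₀ : X} (h : SmoothFormAt G x₀)
    (h' : SmoothFormAt G' x₀) : SmoothFormAt (fun x => G x + G' x) x₀ :=
  (ContMDiffAt.add h h').congr_of_eventuallyEq <| .of_forall fun x => by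
    ext a b; simp [formInTrivialization]

theorem SmoothFormAt.smul {G : FormField V X} {χ : X → ℝ} {x₀ : X} (h : SmoothFormAt G x₀)
    (hχ : ContMDiffAt 𝓘(ℝ, V) 𝓘(ℝ, ℝ) ∞ χ x₀) : SmoothFormAt (fun x => χ x • G x) x₀ := by
  have hsmul : ContMDiffAt 𝓘(ℝ, V) 𝓘(ℝ, V →L[ℝ] V →L[ℝ] ℝ) ∞
      (fun x => χ x • formInTrivialization G x₀ x) x₀ := ContMDiffAt.smul hχ h
  exact hsmul.congr_of_eventuallyEq <| .of_forall fun x => by ext a b; simp [formInTrivialization]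

theorem smoothFormAt_zero (x₀ : X) : SmoothFormAt (fun _ : X => (0 : V →L[ℝ] V →L[ℝ] ℝ)) x₀ :=
  (contMDiffAt_const (c := 0)).congr_of_eventuallyEq <| .of_forall fun x => by
    ext a b; simp [formInTrivialization]

theorem SmoothFormAt.smul_of_tsupport_subset {G : FormField V X} {χ : X → ℝ} {U : Set X}
    (h : ∀ x ∈ U, SmoothFormAt G x) (hχ : ContMDiff 𝓘(ℝ, V) 𝓘(ℝ, ℝ) ∞ χ)
    (hs : tsupport χ ⊆ U) (x : X) : SmoothFormAt (fun x => χ x • G x) x := by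
  by_cases hx : x ∈ tsupport χ
  · exact (h x (hs hx)).smul hχ.contMDiffAt
  · refine (smoothFormAt_zero x).congr ?_
    filter_upwards [(isClosed_tsupport χ).isOpen_compl.mem_nhds hx] with y hy
    ext a b
    simp [image_eq_zero_of_notMem_tsupport hy]

theorem trivSymm_comp_inTangentCoordinates {f : X → M} {x₀ x : X}
    (hfx : f x ∈ (chartAt V (f x₀)).source) :
    trivSymm (f x₀) (f x) ∘L inTangentCoordinates 𝓘(ℝ, V) 𝓘(ℝ, V) id f
      (mfderiv 𝓘(ℝ, V) 𝓘(ℝ, V) f) x₀ x = tderiv f x ∘L trivSymm x₀ x := by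
  have hfx' : f x ∈ (trivializationAt V
      (fun x : M => TangentSpace 𝓘(ℝ, V) x) (f x₀)).baseSet := by simpa using hfx
  exact ContinuousLinearMap.ext fun a =>
    Bundle.Trivialization.symmL_continuousLinearMapAt _ hfx' _

theorem SmoothFormAt.pullbackForm [FiniteDimensional ℝ V] {f : X → M} {G : FormField V M} {x₀ : X}
    (hG : SmoothFormAt G (f x₀)) (hf : ContMDiffAt 𝓘(ℝ, V) 𝓘(ℝ, V) ∞ f x₀) :
    SmoothFormAt (pullbackForm f G) x₀ := by
  have hderiv := hf.mfderiv_const (m := ∞) (by simp)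
  have hform : ContMDiffAt 𝓘(ℝ, V) 𝓘(ℝ, V →L[ℝ] V →L[ℝ] ℝ) ∞
      (fun x => formInTrivialization G (f x₀) (f x)) x₀ :=
    ContMDiffAt.comp x₀ (g := formInTrivialization G (f x₀)) hG hf
  refine ContMDiffAt.congr_of_eventuallyEq (ContMDiffAt.comp x₀
    (contDiff_bilinearComp_self (V := V) (W := V)).contMDiff.contMDiffAt
    (hform.prodMk_space hderiv)) ?_
  filter_upwards [hf.continuousAt.preimage_mem_nhds
      ((chartAt V (f x₀)).open_source.mem_nhds (mem_chart_source _ (f x₀)))] with x hfx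
  have h := trivSymm_comp_inTangentCoordinates hfx
  ext a b
  exact congrArg₂ (fun u v => G (f x) u v) (DFunLike.congr_fun h a).symm
    (DFunLike.congr_fun h b).symm

theorem smoothFormAt_const (B : V →L[ℝ] V →L[ℝ] ℝ) (y : V) :
    SmoothFormAt (fun _ : V => B) y := by
  refine ContMDiffAt.congr_of_eventuallyEq (contMDiffAt_const (c := B)) (.of_forall fun x => ?_)
  have h : trivSymm y x = ContinuousLinearMap.id ℝ V := TangentBundle.symmL_model_space (𝕜 := ℝ) y x
  ext a b
  simp [formInTrivialization, h]

end Forms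

section MetricForm

variable {n : ℕ} {X : Type*} [TopologicalSpace X] [ChartedSpace (E n) X]
  [IsManifold 𝓘(ℝ, E n) ∞ X]

/-- The field of inner products of a Riemannian metric. -/
noncomputable def metricForm (g : RMetric n X) : FormField (E n) X := g.inner

theorem metricForm_symm (g : RMetric n X) (x : X) (v w : E n) :
    metricForm g x v w = metricForm g x w v := g.symm x v w

theorem metricForm_pos (g : RMetric n X) (x : X) {v : E n} (hv : v ≠ 0) :
    0 < metricForm g x v v := g.pos x v hv

theorem smoothFormAt_metricForm (g : RMetric n X) (x : X) : SmoothFormAt (metricForm g) x :=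
  (smoothFormAt_iff _ _).2 g.contMDiff.contMDiffAt

/-- The Riemannian metric defined by a smooth field of symmetric positive definite forms. -/
noncomputable def metricOfForm (G : FormField (E n) X) (hs : ∀ x v w, G x v w = G x w v)
    (hp : ∀ x v, v ≠ 0 → 0 < G x v v) (hG : ∀ x, SmoothFormAt G x) : RMetric n X where
  inner := G
  symm := hs
  pos := hp
  isVonNBounded x :=
    isVonNBounded_setOf_lt_one_of_isCoercive (V := E n) (isCoercive_of_forall_pos (G x) (hp x))
  contMDiff x := (smoothFormAt_iff G x).1 (hG x)

end MetricForm

/-! ### Partial diffeomorphisms, orientation and conformality -/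

theorem forall_mem_transition_source_iff {X Y Z : Type*} [TopologicalSpace X] [TopologicalSpace Y]
    [TopologicalSpace Z] {e : OpenPartialHomeomorph X Y} {e' : OpenPartialHomeomorph X Z}
    {P : Y → Prop} :
    (∀ y ∈ (e.symm ≫ₕ e').source, P y) ↔ ∀ x ∈ e.source, x ∈ e'.source → P (e x) := by
  refine ⟨fun h x hx hx' => h _ (by simp [e.map_source hx, e.left_inv hx, hx']), fun h y hy => ?_⟩
  have hP := h _ (e.map_target hy.1) hy.2
  rwa [e.right_inv hy.1] at hP

section PartialDiffeo

variable {V : Type*} [NormedAddCommGroup V] [NormedSpace ℝ V]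
  {X M Y : Type*} [TopologicalSpace X] [ChartedSpace V X]
  [TopologicalSpace M] [ChartedSpace V M] [TopologicalSpace Y] [ChartedSpace V Y]

variable (V) in
/-- The partial homeomorphism `f` is a smooth diffeomorphism between its source and its target. -/
structure IsPartialDiffeo (f : OpenPartialHomeomorph X M) : Prop where
  smooth : ContMDiffOn 𝓘(ℝ, V) 𝓘(ℝ, V) ∞ f f.source
  smooth_symm : ContMDiffOn 𝓘(ℝ, V) 𝓘(ℝ, V) ∞ f.symm f.target

theorem mem_maximalAtlas_iff_isPartialDiffeo [IsManifold 𝓘(ℝ, V) ∞ X]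
    {e : OpenPartialHomeomorph X V} :
    e ∈ IsManifold.maximalAtlas 𝓘(ℝ, V) ∞ X ↔ IsPartialDiffeo V e := by
  rw [IsManifold.mem_maximalAtlas_iff_contMDiffOn]
  exact ⟨fun h => ⟨h.1, h.2⟩, fun h => ⟨h.1, h.2⟩⟩

theorem tderiv_comp {f : X → M} {h : M → Y} {x : X}
    (hh : MDifferentiableAt 𝓘(ℝ, V) 𝓘(ℝ, V) h (f x))
    (hf : MDifferentiableAt 𝓘(ℝ, V) 𝓘(ℝ, V) f x) :
    tderiv (V := V) (fun x => h (f x)) x = tderiv h (f x) ∘L tderiv f x :=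
  mfderiv_comp x hh hf

theorem tderiv_congr {f h : X → M} {x : X} (hfh : f =ᶠ[𝓝 x] h) :
    tderiv (V := V) f x = tderiv h x :=
  hfh.mfderiv_eq

theorem tderiv_eq_fderiv (f : V → V) (y : V) : tderiv f y = fderiv ℝ f y :=
  mfderiv_eq_fderiv

theorem tderiv_id (x : X) : tderiv (fun x : X => x) x = ContinuousLinearMap.id ℝ V :=
  mfderiv_id

theorem det_comp (A B : V →L[ℝ] V) : (A ∘L B).det = A.det * B.det := by
  simp only [ContinuousLinearMap.det, ContinuousLinearMap.toLinearMap_comp, LinearMap.det_comp]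

namespace IsPartialDiffeo

variable {f : OpenPartialHomeomorph X M}

protected theorem symm (hf : IsPartialDiffeo V f) : IsPartialDiffeo V f.symm :=
  ⟨hf.2, hf.1⟩

protected theorem trans {h : OpenPartialHomeomorph M Y} (hf : IsPartialDiffeo V f)
    (hh : IsPartialDiffeo V h) : IsPartialDiffeo V (f ≫ₕ h) where
  smooth := hh.smooth.comp' hf.smooth |>.mono (by simp)
  smooth_symm := hf.smooth_symm.comp' hh.smooth_symm |>.mono (by simp)

theorem contMDiffAt (hf : IsPartialDiffeo V f) {x : X} (hx : x ∈ f.source) :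
    ContMDiffAt 𝓘(ℝ, V) 𝓘(ℝ, V) ∞ f x :=
  hf.smooth.contMDiffAt (f.open_source.mem_nhds hx)

theorem mdifferentiableAt (hf : IsPartialDiffeo V f) {x : X} (hx : x ∈ f.source) :
    MDifferentiableAt 𝓘(ℝ, V) 𝓘(ℝ, V) f x :=
  (hf.contMDiffAt hx).mdifferentiableAt (by simp)

theorem tderiv_symm_comp (hf : IsPartialDiffeo V f) {x : X} (hx : x ∈ f.source) :
    tderiv f.symm (f x) ∘L tderiv f x = ContinuousLinearMap.id ℝ V := by
  rw [← tderiv_comp (hf.symm.mdifferentiableAt (f.map_source hx)) (hf.mdifferentiableAt hx),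
    ← tderiv_id x]
  exact tderiv_congr (f.eventually_left_inverse hx)

theorem tderiv_symm_apply (hf : IsPartialDiffeo V f) {x : X} (hx : x ∈ f.source) (v : V) :
    tderiv f.symm (f x) (tderiv f x v) = v :=
  DFunLike.congr_fun (hf.tderiv_symm_comp hx) v

theorem tderiv_ne_zero (hf : IsPartialDiffeo V f) {x : X} (hx : x ∈ f.source) {v : V}
    (hv : v ≠ 0) : tderiv f x v ≠ 0 := fun h =>
  hv (by rw [← hf.tderiv_symm_apply hx v, h, map_zero])

theorem det_tderiv_ne_zero (hf : IsPartialDiffeo V f) {x : X} (hx : x ∈ f.source) :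
    (tderiv (V := V) f x).det ≠ 0 := by
  have h := congrArg ContinuousLinearMap.det (hf.tderiv_symm_comp hx)
  rw [det_comp] at h
  exact right_ne_zero_of_mul_eq_one (h.trans (by simp [ContinuousLinearMap.det]))

variable {e e' : OpenPartialHomeomorph X V}

theorem fderiv_transition_comp (he : IsPartialDiffeo V e) (he' : IsPartialDiffeo V e') {x : X}
    (hx : x ∈ e.source) (hx' : x ∈ e'.source) :
    fderiv ℝ (e.symm ≫ₕ e') (e x) ∘L tderiv e x = tderiv e' x := by
  have htrans : MDifferentiableAt 𝓘(ℝ, V) 𝓘(ℝ, V) (e.symm ≫ₕ e') (e x) :=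
    (he.symm.trans he').mdifferentiableAt
      ⟨e.map_source hx, by simpa [e.left_inv hx] using hx'⟩
  rw [← tderiv_eq_fderiv, ← tderiv_comp htrans (he.mdifferentiableAt hx)]
  refine tderiv_congr ?_
  filter_upwards [e.eventually_left_inverse hx] with z hz
  simp [hz]

theorem det_fderiv_transition_mul (he : IsPartialDiffeo V e) (he' : IsPartialDiffeo V e') {x : X}
    (hx : x ∈ e.source) (hx' : x ∈ e'.source) :
    (fderiv ℝ (e.symm ≫ₕ e') (e x)).det * (tderiv (V := V) e x).det ^ 2 =
      (tderiv (V := V) e x).det * (tderiv (V := V) e' x).det := by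
  rw [← he.fderiv_transition_comp he' hx hx', det_comp]
  ring

theorem det_fderiv_transition_pos_iff (he : IsPartialDiffeo V e) (he' : IsPartialDiffeo V e')
    {x : X} (hx : x ∈ e.source) (hx' : x ∈ e'.source) :
    0 < (fderiv ℝ (e.symm ≫ₕ e') (e x)).det ↔
      0 < (tderiv (V := V) e x).det * (tderiv (V := V) e' x).det := by
  rw [← he.det_fderiv_transition_mul he' hx hx',
    mul_pos_iff_of_pos_right (sq_pos_of_ne_zero (he.det_tderiv_ne_zero hx))]

theorem det_fderiv_transition_neg_iff (he : IsPartialDiffeo V e) (he' : IsPartialDiffeo V e')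
    {x : X} (hx : x ∈ e.source) (hx' : x ∈ e'.source) :
    (fderiv ℝ (e.symm ≫ₕ e') (e x)).det < 0 ↔
      (tderiv (V := V) e x).det * (tderiv (V := V) e' x).det < 0 := by
  rw [← he.det_fderiv_transition_mul he' hx hx', ← neg_pos, ← neg_pos (a := _ * _), ← neg_mul,
    mul_pos_iff_of_pos_right (sq_pos_of_ne_zero (he.det_tderiv_ne_zero hx))]

end IsPartialDiffeo

/-- The charts `e` and `e'` induce the same orientation of the tangent space at `x`. -/
def SameOrientationAt (e e' : X → V) (x : X) : Prop :=
  0 < (tderiv (V := V) e x).det * (tderiv (V := V) e' x).det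

namespace SameOrientationAt

variable {e e' e₁ e₁' : X → V} {x : X}

protected theorem symm (h : SameOrientationAt e e' x) : SameOrientationAt e' e x := by
  rwa [SameOrientationAt, mul_comm]

theorem congr (h : SameOrientationAt e e' x) (h₁ : e₁ =ᶠ[𝓝 x] e) (h₁' : e₁' =ᶠ[𝓝 x] e') :
    SameOrientationAt e₁ e₁' x := by
  rwa [SameOrientationAt, tderiv_congr h₁, tderiv_congr h₁']

theorem comp {h h' : M → V} {f : OpenPartialHomeomorph X M} (hhh' : SameOrientationAt h h' (f x))
    (hf : IsPartialDiffeo V f) (hx : x ∈ f.source)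
    (hh : MDifferentiableAt 𝓘(ℝ, V) 𝓘(ℝ, V) h (f x))
    (hh' : MDifferentiableAt 𝓘(ℝ, V) 𝓘(ℝ, V) h' (f x)) :
    SameOrientationAt (fun z => h (f z)) (fun z => h' (f z)) x := by
  rw [SameOrientationAt, tderiv_comp hh (hf.mdifferentiableAt hx),
    tderiv_comp hh' (hf.mdifferentiableAt hx), det_comp, det_comp, mul_mul_mul_comm, ← sq]
  exact mul_pos hhh' (sq_pos_of_ne_zero (hf.det_tderiv_ne_zero hx))

end SameOrientationAt

end PartialDiffeo

section Conformal

variable {V : Type*} [NormedAddCommGroup V] [InnerProductSpace ℝ V]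
  {X M : Type*} [TopologicalSpace X] [ChartedSpace V X] [TopologicalSpace M] [ChartedSpace V M]

/-- The form `G x` is a positive multiple of the Euclidean inner product read in the chart `e`. -/
def ConformalAt (G : FormField V X) (e : X → V) (x : X) : Prop :=
  ∃ c : ℝ, 0 < c ∧ ∀ v w : V, G x v w = c * inner ℝ (tderiv e x v) (tderiv e x w)

variable (V) in
/-- The Euclidean metric of `V`, as a field of bilinear forms. -/
noncomputable def euclideanForm : FormField V V := fun _ => innerSL ℝ

theorem euclideanForm_apply (y v w : V) : euclideanForm V y v w = inner ℝ v w := rfl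

namespace ConformalAt

variable {G : FormField V X} {e e' : X → V} {x : X}

theorem congr (h : ConformalAt G e x) (he : e' =ᶠ[𝓝 x] e) : ConformalAt G e' x := by
  rwa [ConformalAt, tderiv_congr he]

theorem comp {T : V → V} (h : ConformalAt G e x) (hT : ConformalAt (euclideanForm V) T (e x))
    (hTd : DifferentiableAt ℝ T (e x)) (he : MDifferentiableAt 𝓘(ℝ, V) 𝓘(ℝ, V) e x) :
    ConformalAt G (fun x => T (e x)) x := by
  obtain ⟨c, hc, h⟩ := h
  obtain ⟨d, hd, hT⟩ := hT
  refine ⟨c * d, by positivity, fun v w => ?_⟩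
  rw [tderiv_comp hTd.mdifferentiableAt he, h, ← euclideanForm_apply (e x), hT, mul_assoc]
  rfl

theorem pullbackForm {G : FormField V M} {f : X → M} {e : M → V} (h : ConformalAt G e (f x))
    (he : MDifferentiableAt 𝓘(ℝ, V) 𝓘(ℝ, V) e (f x))
    (hf : MDifferentiableAt 𝓘(ℝ, V) 𝓘(ℝ, V) f x) :
    ConformalAt (pullbackForm f G) (fun x => e (f x)) x := by
  obtain ⟨c, hc, h⟩ := h
  refine ⟨c, hc, fun v w => ?_⟩
  rw [tderiv_comp he hf, pullbackForm_apply, h]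
  rfl

end ConformalAt

end Conformal

section ConformalChart

variable {n : ℕ} {X : Type*} [TopologicalSpace X] [ChartedSpace (E n) X]
  [IsManifold 𝓘(ℝ, E n) ∞ X] {g : RMetric n X} {e : OpenPartialHomeomorph X (E n)}

theorem IsPartialDiffeo.conformalAt_metricForm_symm_iff (he : IsPartialDiffeo (E n) e) {y : E n}
    (hy : y ∈ e.target) : ConformalAt (metricForm g) e (e.symm y) ↔
      ∃ c : ℝ, 0 < c ∧ ∀ a b : E n, coordMetric g e y a b = c * inner ℝ a b := by
  have hleft : ∀ v, tderiv e.symm y (tderiv e (e.symm y) v) = v := fun v => by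
    simpa only [e.right_inv hy] using he.tderiv_symm_apply (e.map_target hy) v
  have hright : ∀ v, tderiv e (e.symm y) (tderiv e.symm y v) = v := he.symm.tderiv_symm_apply hy
  refine exists_congr fun c => and_congr_right fun _ => ⟨fun h a b => ?_, fun h v w => ?_⟩
  · have hab := h (tderiv e.symm y a) (tderiv e.symm y b)
    rwa [hright, hright] at hab
  · rw [← h]
    change _ = metricForm g (e.symm y) (tderiv e.symm y _) (tderiv e.symm y _)
    rw [hleft, hleft]

theorem isConformalChart_iff :
    IsConformalChart g e ↔
      IsPartialDiffeo (E n) e ∧ ∀ x ∈ e.source, ConformalAt (metricForm g) e x := by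
  rw [IsConformalChart, mem_maximalAtlas_iff_isPartialDiffeo]
  refine and_congr_right fun he => ⟨fun h x hx => ?_, fun h y hy =>
    (he.conformalAt_metricForm_symm_iff hy).1 (h _ (e.map_target hy))⟩
  have hconf := (he.conformalAt_metricForm_symm_iff (e.map_source hx)).2 (h _ (e.map_source hx))
  rwa [e.left_inv hx] at hconf

theorem IsExpChart.conformalAt {p : X} {r : ℝ} (h : IsExpChart g p r e) :
    ConformalAt (metricForm g) e (e.symm 0) :=
  ((mem_maximalAtlas_iff_isPartialDiffeo.1 h.mem_smoothCharts).conformalAt_metricForm_symm_iff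
    (h.map_center ▸ e.map_source h.mem_source)).2
      ⟨1, one_pos, fun a b => (h.isometry_zero a b).trans (one_mul _).symm⟩

end ConformalChart

/-! ### Möbius transformations, similarities and inversions -/

section Mobius

variable {n : ℕ}

theorem isMobius_id : IsMobius (id : OnePoint (E n) → OnePoint (E n)) := by
  convert IsMobius.isometry (IsometryEquiv.refl (E n))
  ext z
  induction z using OnePoint.rec <;> rfl

theorem inversionExt_coe (c : E n) (R : ℝ) {x : E n} (hx : x ≠ c) :
    inversionExt c R (x : OnePoint (E n)) = (EuclideanGeometry.inversion c R x : E n) := by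
  simp only [inversionExt, OnePoint.elim_some, if_neg hx]

theorem inversionExt_center (c : E n) (R : ℝ) :
    inversionExt c R (c : OnePoint (E n)) = OnePoint.infty := by
  simp only [inversionExt, OnePoint.elim_some, if_true]

theorem inversionExt_infty (c : E n) (R : ℝ) :
    inversionExt c R OnePoint.infty = (c : OnePoint (E n)) := rfl

theorem inversionExt_inversionExt (c : E n) {R : ℝ} (hR : R ≠ 0) (z : OnePoint (E n)) :
    inversionExt c R (inversionExt c R z) = z := by
  induction z using OnePoint.rec with
  | infty => rw [inversionExt_infty, inversionExt_center]
  | coe x =>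
    rcases eq_or_ne x c with rfl | hx
    · rw [inversionExt_center, inversionExt_infty]
    · rw [inversionExt_coe c R hx, inversionExt_coe c R
        ((EuclideanGeometry.inversion_eq_center hR).not.2 hx),
        EuclideanGeometry.inversion_inversion c hR]

theorem IsMobius.exists_leftInverse {m : OnePoint (E n) → OnePoint (E n)} (hm : IsMobius m) :
    ∃ m', IsMobius m' ∧ Function.LeftInverse m' m := by
  induction hm with
  | isometry f =>
    refine ⟨_, IsMobius.isometry f.symm, fun z => ?_⟩
    induction z using OnePoint.rec with
    | infty => rfl
    | coe x => simp
  | inversion c R hR => exact ⟨_, .inversion c R hR, inversionExt_inversionExt c hR.ne'⟩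
  | comp _ _ ihf ihg =>
    obtain ⟨f', hf', hf⟩ := ihf
    obtain ⟨g', hg', hg⟩ := ihg
    exact ⟨g' ∘ f', hg'.comp hf', hf.comp hg⟩

theorem inversion_zero_apply {V : Type*} [NormedAddCommGroup V] [InnerProductSpace ℝ V] (R : ℝ)
    (y : V) : EuclideanGeometry.inversion 0 R y = (R / ‖y‖) ^ 2 • y := by
  simp [EuclideanGeometry.inversion]

/-- A homothety is the composition of two inversions with the same centre. -/
theorem exists_isMobius_smul {c : ℝ} (hc : 0 < c) :
    ∃ m : OnePoint (E n) → OnePoint (E n), IsMobius m ∧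
      ∀ y : E n, m y = ((c • y : E n) : OnePoint (E n)) := by
  refine ⟨_, (IsMobius.inversion 0 (√c) (by positivity)).comp (.inversion 0 1 one_pos),
    fun y => ?_⟩
  rw [Function.comp_apply]
  rcases eq_or_ne y 0 with rfl | hy
  · rw [inversionExt_center, inversionExt_infty, smul_zero]
  have hnorm : ‖y‖ ≠ 0 := norm_ne_zero_iff.2 hy
  rw [inversionExt_coe _ _ hy, inversionExt_coe _ _
    ((EuclideanGeometry.inversion_eq_center one_ne_zero).not.2 hy), inversion_zero_apply,
    inversion_zero_apply, smul_smul, norm_smul, Real.norm_of_nonneg (by positivity)]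
  congr 2
  field_simp
  rw [Real.sq_sqrt hc.le]

variable {X Y : Type*} [TopologicalSpace X] [TopologicalSpace Y]

/-- Near `x`, the map `e'` is the composition of `e` and a Möbius transformation. -/
def MobiusAt (e e' : X → E n) (x : X) : Prop :=
  ∃ m : OnePoint (E n) → OnePoint (E n), IsMobius m ∧
    ∀ᶠ z in 𝓝 x, m (e z : OnePoint (E n)) = (e' z : OnePoint (E n))

theorem mobiusCompatible_iff {e e' : OpenPartialHomeomorph X (E n)} :
    MobiusCompatible e e' ↔ ∀ x ∈ e.source, x ∈ e'.source → MobiusAt e e' x := by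
  rw [MobiusCompatible, forall_mem_transition_source_iff]
  refine forall₂_congr fun x hx => forall_congr' fun _ => exists_congr fun m =>
    and_congr_right fun _ => ?_
  rw [e.eventually_nhds (fun y : E n => m y = ((e.symm ≫ₕ e') y : E n)) hx]
  exact Filter.eventually_congr <| (e.eventually_left_inverse hx).mono fun z hz => by simp [hz]

namespace MobiusAt

variable {e e' e'' e₁ e₁' : X → E n} {x : X}

protected theorem refl (e : X → E n) (x : X) : MobiusAt e e x :=
  ⟨id, isMobius_id, .of_forall fun _ => rfl⟩

protected theorem symm (h : MobiusAt e e' x) : MobiusAt e' e x := by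
  obtain ⟨m, hm, h⟩ := h
  obtain ⟨m', hm', hleft⟩ := hm.exists_leftInverse
  exact ⟨m', hm', h.mono fun z hz => by rw [← hz, hleft]⟩

protected theorem trans (h : MobiusAt e e' x) (h' : MobiusAt e' e'' x) : MobiusAt e e'' x := by
  obtain ⟨m, hm, h⟩ := h
  obtain ⟨m', hm', h'⟩ := h'
  refine ⟨m' ∘ m, hm'.comp hm, ?_⟩
  filter_upwards [h, h'] with z hz hz'
  rw [Function.comp_apply, hz, hz']

theorem congr (h : MobiusAt e e' x) (h₁ : e₁ =ᶠ[𝓝 x] e) (h₁' : e₁' =ᶠ[𝓝 x] e') :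
    MobiusAt e₁ e₁' x := by
  obtain ⟨m, hm, h⟩ := h
  refine ⟨m, hm, ?_⟩
  filter_upwards [h, h₁, h₁'] with z hz hz₁ hz₁'
  rw [hz₁, hz₁', hz]

theorem comp {h h' : Y → E n} {f : X → Y} (hm : MobiusAt h h' (f x)) (hf : ContinuousAt f x) :
    MobiusAt (fun z => h (f z)) (fun z => h' (f z)) x := by
  obtain ⟨m, hm, hev⟩ := hm
  exact ⟨m, hm, hf.eventually hev⟩

end MobiusAt

end Mobius

section Similarity

variable {V : Type*} [NormedAddCommGroup V] [InnerProductSpace ℝ V]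

/-- The similarity of ratio `c` and linear part `c A` that maps `y₀` to the origin. -/
def similarity (c : ℝ) (A : V ≃ₗᵢ[ℝ] V) (y₀ y : V) : V := c • A (y - y₀)

theorem hasFDerivAt_similarity (c : ℝ) (A : V ≃ₗᵢ[ℝ] V) (y₀ y : V) :
    HasFDerivAt (similarity c A y₀) (c • (A : V →L[ℝ] V)) y := by
  have h : HasFDerivAt (fun y => A (y - y₀)) ((A : V →L[ℝ] V) ∘L .id ℝ V) y :=
    (A : V →L[ℝ] V).hasFDerivAt.comp y ((hasFDerivAt_id y).sub_const y₀)
  exact h.const_smul c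

theorem contDiff_similarity (c : ℝ) (A : V ≃ₗᵢ[ℝ] V) (y₀ : V) :
    ContDiff ℝ ∞ (similarity c A y₀) :=
  (A.contDiff.comp (contDiff_id.sub contDiff_const)).const_smul c

theorem conformalAt_similarity {c : ℝ} (hc : c ≠ 0) (A : V ≃ₗᵢ[ℝ] V) (y₀ y : V) :
    ConformalAt (euclideanForm V) (similarity c A y₀) y := by
  refine ⟨(c ^ 2)⁻¹, by positivity, fun a b => ?_⟩
  rw [tderiv_eq_fderiv, (hasFDerivAt_similarity c A y₀ y).fderiv, euclideanForm_apply]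
  simp only [smul_apply, ContinuousLinearEquiv.coe_coe, LinearIsometryEquiv.coe_coe,
    inner_smul_left, inner_smul_right, LinearIsometryEquiv.inner_map_map, RCLike.conj_to_real]
  field_simp

theorem ConformalAt.similarity {X : Type*} [TopologicalSpace X] [ChartedSpace V X]
    {G : FormField V X} {e : X → V} {x : X} (h : ConformalAt G e x)
    (he : MDifferentiableAt 𝓘(ℝ, V) 𝓘(ℝ, V) e x) {c : ℝ} (hc : c ≠ 0) (A : V ≃ₗᵢ[ℝ] V) (y₀ : V) :
    ConformalAt G (fun z => similarity c A y₀ (e z)) x :=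
  h.comp (conformalAt_similarity hc A y₀ (e x))
    (hasFDerivAt_similarity c A y₀ (e x)).differentiableAt he

theorem mobiusAt_similarity {n : ℕ} {X : Type*} [TopologicalSpace X] {c : ℝ} (hc : 0 < c)
    (A : E n ≃ₗᵢ[ℝ] E n) (y₀ : E n) (e : X → E n) (x : X) :
    MobiusAt e (fun z => similarity c A y₀ (e z)) x := by
  obtain ⟨m, hm, h⟩ := exists_isMobius_smul (n := n) hc
  refine ⟨m ∘ OnePoint.map ((IsometryEquiv.subRight y₀).trans A.toIsometryEquiv),
    hm.comp (.isometry _), .of_forall fun z => ?_⟩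
  simp [h, similarity]

end Similarity

section Inversion

variable {V : Type*} [NormedAddCommGroup V] [InnerProductSpace ℝ V]

variable (V) in
/-- The inversion in the unit sphere, as a partial homeomorphism of `V`. -/
noncomputable def unitInversion : OpenPartialHomeomorph V V where
  toFun := EuclideanGeometry.inversion 0 1
  invFun := EuclideanGeometry.inversion 0 1
  source := {0}ᶜ
  target := {0}ᶜ
  map_source' _ := (EuclideanGeometry.inversion_eq_center one_ne_zero).not.2
  map_target' _ := (EuclideanGeometry.inversion_eq_center one_ne_zero).not.2
  left_inv' y _ := EuclideanGeometry.inversion_inversion 0 one_ne_zero y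
  right_inv' y _ := EuclideanGeometry.inversion_inversion 0 one_ne_zero y
  open_source := isOpen_compl_singleton
  open_target := isOpen_compl_singleton
  continuousOn_toFun := continuousOn_const.inversion continuousOn_const continuousOn_id fun _ => id
  continuousOn_invFun := continuousOn_const.inversion continuousOn_const continuousOn_id fun _ => id

theorem unitInversion_apply (y : V) : unitInversion V y = (‖y‖ ^ 2)⁻¹ • y := by
  change EuclideanGeometry.inversion 0 1 y = _
  simp [inversion_zero_apply]

theorem unitInversion_unitInversion (y : V) : unitInversion V (unitInversion V y) = y :=
  EuclideanGeometry.inversion_inversion 0 one_ne_zero y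

theorem unitInversion_of_norm_eq_one {y : V} (hy : ‖y‖ = 1) : unitInversion V y = y := by
  simp [unitInversion_apply, hy]

theorem norm_unitInversion (y : V) : ‖unitInversion V y‖ = ‖y‖⁻¹ := by
  rcases eq_or_ne y 0 with rfl | hy
  · simp [unitInversion_apply]
  have hnorm : ‖y‖ ≠ 0 := norm_ne_zero_iff.2 hy
  rw [unitInversion_apply, norm_smul, Real.norm_of_nonneg (by positivity)]
  field_simp

theorem isPartialDiffeo_unitInversion : IsPartialDiffeo V (unitInversion V) := by
  have h : ContDiffOn ℝ ∞ (EuclideanGeometry.inversion (0 : V) 1) {0}ᶜ :=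
    contDiffOn_const.inversion contDiffOn_const contDiffOn_id fun _ => id
  exact ⟨h.contMDiffOn, h.contMDiffOn⟩

theorem hasFDerivAt_unitInversion {y : V} (hy : y ≠ 0) : HasFDerivAt (unitInversion V)
    ((1 / ‖y‖) ^ 2 • ((ℝ ∙ y)ᗮ.reflection : V →L[ℝ] V)) y := by
  have h := EuclideanGeometry.hasFDerivAt_inversion (R := 1) hy
  rwa [sub_zero, dist_zero_right] at h

theorem conformalAt_unitInversion {y : V} (hy : y ≠ 0) :
    ConformalAt (euclideanForm V) (unitInversion V) y := by
  have hnorm : ‖y‖ ≠ 0 := norm_ne_zero_iff.2 hy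
  refine ⟨‖y‖ ^ 4, by positivity, fun a b => ?_⟩
  rw [tderiv_eq_fderiv, (hasFDerivAt_unitInversion hy).fderiv, euclideanForm_apply]
  simp only [smul_apply, ContinuousLinearEquiv.coe_coe, LinearIsometryEquiv.coe_coe,
    inner_smul_left, inner_smul_right, LinearIsometryEquiv.inner_map_map, RCLike.conj_to_real]
  field_simp

theorem det_tderiv_unitInversion_neg [FiniteDimensional ℝ V] {y : V} (hy : y ≠ 0) :
    (tderiv (V := V) (unitInversion V) y).det < 0 := by
  have : 0 < ‖y‖ := norm_pos_iff.2 hy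
  have hdet : LinearMap.det ((ℝ ∙ y)ᗮ.reflection.toLinearMap) = -1 := by
    rw [Submodule.det_reflection, Submodule.orthogonal_orthogonal, finrank_span_singleton hy,
      pow_one]
  rw [tderiv_eq_fderiv, (hasFDerivAt_unitInversion hy).fderiv, ContinuousLinearMap.det,
    ContinuousLinearMap.toLinearMap_smul, LinearMap.det_smul]
  exact mul_neg_of_pos_of_neg (by positivity) (hdet.trans_lt (by norm_num))

theorem mobiusAt_unitInversion {n : ℕ} {X : Type*} [TopologicalSpace X] {e : X → E n} {x : X}
    (he : ContinuousAt e x) (hx : e x ≠ 0) : MobiusAt e (fun z => unitInversion (E n) (e z)) x :=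
  ⟨_, .inversion 0 1 one_pos, (he.eventually_ne hx).mono fun _ => inversionExt_coe 0 1⟩

end Inversion

/-! ### The topology of the connected sum -/

theorem t2Space_of_continuous_of_t2Space_fibers {Z Y : Type*} [TopologicalSpace Z]
    [TopologicalSpace Y] [T2Space Y] {h : Z → Y} (hh : Continuous h)
    (hs : ∀ z, ∃ s : Set Z, IsOpen s ∧ T2Space s ∧ h ⁻¹' {h z} ⊆ s) : T2Space Z := by
  refine ⟨fun z w hzw => ?_⟩
  by_cases hhzw : h z = h w
  · obtain ⟨s, hs, hT2, hsub⟩ := hs z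
    lift z to s using hsub rfl
    lift w to s using hsub hhzw.symm
    obtain ⟨u, v, hu, hv, hzu, hwv, huv⟩ := t2_separation (ne_of_apply_ne Subtype.val hzw)
    exact ⟨_, _, hs.isOpenMap_subtype_val u hu, hs.isOpenMap_subtype_val v hv,
      ⟨z, hzu, rfl⟩, ⟨w, hwv, rfl⟩, Set.disjoint_image_of_injective Subtype.val_injective huv⟩
  · obtain ⟨u, v, hu, hv, hzu, hwv, huv⟩ := t2_separation hhzw
    exact ⟨_, _, hu.preimage hh, hv.preimage hh, hzu, hwv, huv.preimage h⟩

section ChartNorm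

variable {n : ℕ} {M : Type*} [TopologicalSpace M]

/-- The norm of the coordinates in the chart `φ`, extended by the constant `r` outside the domain of
`φ`. If the image of `φ` is the ball of radius `r` this is a continuous function on `M`. -/
noncomputable def chartNorm (φ : OpenPartialHomeomorph M (E n)) (r : ℝ) (x : M) : ℝ :=
  open Classical in if x ∈ φ.source then ‖φ x‖ else r

variable {φ : OpenPartialHomeomorph M (E n)} {r s : ℝ} {x : M}

theorem chartNorm_of_mem (hx : x ∈ φ.source) : chartNorm φ r x = ‖φ x‖ := if_pos hx

theorem chartNorm_of_notMem (hx : x ∉ φ.source) : chartNorm φ r x = r := if_neg hx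

theorem norm_chart_lt (hφ : φ.target = Metric.ball 0 r) (hx : x ∈ φ.source) : ‖φ x‖ < r := by
  rw [← mem_ball_zero_iff, ← hφ]
  exact φ.map_source hx

theorem chartNorm_le (hφ : φ.target = Metric.ball 0 r) (x : M) : chartNorm φ r x ≤ r := by
  by_cases hx : x ∈ φ.source
  · exact (chartNorm_of_mem hx).trans_le (norm_chart_lt hφ hx).le
  · exact (chartNorm_of_notMem hx).le

theorem chartNorm_lt_iff (hs : s ≤ r) : chartNorm φ r x < s ↔ x ∈ chartBall φ s := by
  by_cases hx : x ∈ φ.source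
  · simp [chartNorm_of_mem hx, chartBall, hx]
  · simp [chartNorm_of_notMem hx, chartBall, hx, hs]

theorem chartNorm_le_iff (hs : s < r) : chartNorm φ r x ≤ s ↔ x ∈ chartClosedBall φ s := by
  by_cases hx : x ∈ φ.source
  · simp [chartNorm_of_mem hx, chartClosedBall, hx]
  · simp [chartNorm_of_notMem hx, chartClosedBall, hx, hs]

theorem chartBall_eq_source (hφ : φ.target = Metric.ball 0 r) : chartBall φ r = φ.source :=
  Set.Subset.antisymm (fun _ h => h.1) fun _ h => ⟨h, norm_chart_lt hφ h⟩

theorem chartBall_subset_chartClosedBall : chartBall φ s ⊆ chartClosedBall φ s :=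
  fun _ h => ⟨h.1, h.2.le⟩

theorem isOpen_chartBall (φ : OpenPartialHomeomorph M (E n)) (s : ℝ) : IsOpen (chartBall φ s) := by
  have hball : chartBall φ s = φ.source ∩ φ ⁻¹' Metric.ball 0 s := by ext; simp [chartBall]
  rw [hball]
  exact φ.isOpen_inter_preimage Metric.isOpen_ball

theorem isClosed_chartClosedBall [T2Space M] (hφ : φ.target = Metric.ball 0 r) (hs : s < r) :
    IsClosed (chartClosedBall φ s) := by
  have hsub : Metric.closedBall (0 : E n) s ⊆ φ.symm.source :=
    (Metric.closedBall_subset_ball hs).trans_eq hφ.symm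
  have hball : chartClosedBall φ s = φ.symm '' Metric.closedBall 0 s := by
    rw [φ.symm.image_eq_target_inter_inv_preimage hsub]
    ext
    simp [chartClosedBall]
  rw [hball]
  exact ((isCompact_closedBall 0 s).image_of_continuousOn (φ.continuousOn_symm.mono hsub)).isClosed

theorem continuous_chartNorm [T2Space M] (hφ : φ.target = Metric.ball 0 r) :
    Continuous (chartNorm φ r) := by
  rw [continuous_iff_continuousAt]
  intro x
  by_cases hx : x ∈ φ.source
  · refine (φ.continuousAt hx).norm.congr ?_
    filter_upwards [φ.open_source.mem_nhds hx] with y hy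
    rw [chartNorm_of_mem hy]
  · rw [ContinuousAt, chartNorm_of_notMem hx]
    refine tendsto_order.2 ⟨fun s hs => ?_,
      fun s hs => .of_forall fun y => (chartNorm_le hφ y).trans_lt hs⟩
    filter_upwards [(isClosed_chartClosedBall hφ hs).isOpen_compl.mem_nhds
      (fun h : x ∈ chartClosedBall φ s => hx h.1)] with y hy
    rwa [← not_le, chartNorm_le_iff hs]

end ChartNorm

section ScaledChart

variable {n : ℕ} {M : Type*} [TopologicalSpace M] {φ : OpenPartialHomeomorph M (E n)} {ε : ℝ}
  {x : M} {y : E n}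

/-- The rescaled chart `φ / ε`, denoted `i₁` and `i₂` for the two charts of a connected sum. -/
noncomputable def scaledChart (φ : OpenPartialHomeomorph M (E n)) (hε : 0 < ε) :
    OpenPartialHomeomorph M (E n) :=
  φ.transHomeomorph (Homeomorph.smulOfNeZero ε⁻¹ (inv_ne_zero hε.ne'))

variable (hε : 0 < ε)

theorem scaledChart_target (hφ : φ.target = Metric.ball 0 (2 * ε)) :
    (scaledChart φ hε).target = Metric.ball 0 2 := by
  ext y
  change ε⁻¹⁻¹ • y ∈ φ.target ↔ _
  rw [inv_inv, hφ, mem_ball_zero_iff, mem_ball_zero_iff, norm_smul, Real.norm_of_nonneg hε.le,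
    mul_comm, mul_lt_mul_iff_left₀ hε]

theorem norm_scaledChart (x : M) : ‖scaledChart φ hε x‖ = ‖φ x‖ / ε := by
  change ‖ε⁻¹ • φ x‖ = _
  rw [norm_smul, norm_inv, Real.norm_of_nonneg hε.le, div_eq_inv_mul]

theorem one_le_norm_scaledChart (hx : x ∈ φ.source) (hxε : x ∉ chartBall φ ε) :
    1 ≤ ‖scaledChart φ hε x‖ := by
  rw [norm_scaledChart, one_le_div hε]
  exact not_lt.1 fun h => hxε ⟨hx, h⟩

theorem norm_scaledChart_lt_two (hφ : φ.target = Metric.ball 0 (2 * ε)) (hx : x ∈ φ.source) :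
    ‖scaledChart φ hε x‖ < 2 := by
  rw [norm_scaledChart, div_lt_iff₀ hε]
  exact norm_chart_lt hφ hx

theorem mem_scaledChart_target (hφ : φ.target = Metric.ball 0 (2 * ε)) (hy : ‖y‖ < 2) :
    y ∈ (scaledChart φ hε).target := by
  rwa [scaledChart_target hε hφ, mem_ball_zero_iff]

theorem scaledChart_symm_notMem_chartBall (hy : y ∈ (scaledChart φ hε).target) (hy1 : 1 ≤ ‖y‖) :
    (scaledChart φ hε).symm y ∉ chartBall φ ε := by
  rintro ⟨-, h⟩
  rw [← div_lt_one hε, ← norm_scaledChart hε, (scaledChart φ hε).right_inv hy] at h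
  exact h.not_ge hy1

end ScaledChart

section Annulus

variable {n : ℕ}

variable (n) in
/-- The image `{1/2 < |y| < 2}` of the gluing chart. -/
def annulus : Set (E n) := {y | 1 / 2 < ‖y‖ ∧ ‖y‖ < 2}

theorem isOpen_annulus : IsOpen (annulus n) :=
  (isOpen_lt continuous_const continuous_norm).inter (isOpen_lt continuous_norm continuous_const)

theorem ne_zero_of_mem_annulus {y : E n} (hy : y ∈ annulus n) : y ≠ 0 :=
  norm_pos_iff.1 (one_half_pos.trans hy.1)

theorem unitInversion_mem_annulus {y : E n} (hy : y ∈ annulus n) :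
    unitInversion (E n) y ∈ annulus n := by
  have hpos : 0 < ‖y‖ := one_half_pos.trans hy.1
  rw [annulus, Set.mem_ofPred_eq, norm_unitInversion, one_div, inv_lt_inv₀ two_pos hpos,
    inv_lt_comm₀ hpos two_pos, ← one_div]
  exact hy.symm

theorem one_le_norm_unitInversion_iff {y : E n} (hy : y ∈ annulus n) :
    1 ≤ ‖unitInversion (E n) y‖ ↔ ‖y‖ ≤ 1 := by
  rw [norm_unitInversion, one_le_inv₀ (one_half_pos.trans hy.1)]

theorem forall_mem_annulus {P : E n → Prop} (outer : ∀ y : E n, 1 ≤ ‖y‖ → ‖y‖ < 2 → P y)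
    (inner : ∀ y : E n, 1 ≤ ‖y‖ → ‖y‖ < 2 → P (unitInversion (E n) y)) :
    ∀ y ∈ annulus n, P y := by
  intro y hy
  rcases le_total 1 ‖y‖ with h | h
  · exact outer y h hy.2
  · rw [← unitInversion_unitInversion y]
    exact inner _ ((one_le_norm_unitInversion_iff hy).2 h) (unitInversion_mem_annulus hy).2

end Annulus

section Topology

variable {n : ℕ} {M N : Type*} [TopologicalSpace M] [TopologicalSpace N]
  {φ : OpenPartialHomeomorph M (E n)} {ψ : OpenPartialHomeomorph N (E n)} {ε : ℝ}

theorem continuous_proj : Continuous (proj φ ψ ε) := continuous_quot_mk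

theorem isQuotientMap_proj : Topology.IsQuotientMap (proj φ ψ ε) := isQuotientMap_quot_mk

theorem proj_surjective : Function.Surjective (proj φ ψ ε) := Quot.mk_surjective

section Swap

variable (φ ψ ε) in
/-- The exchange of the two summands of a connected sum. -/
def swap : ConnSum φ ψ ε → ConnSum ψ φ ε :=
  Quot.lift (fun a => proj ψ φ ε a.swap) <| by
    rintro _ _ ⟨x, y, rfl, rfl, hx, hy, hnorm, hxy⟩
    exact (Quot.sound ⟨y, x, rfl, rfl, hy, hx, hxy ▸ hnorm, hxy.symm⟩).symm

theorem swap_proj (a : PreSum φ ψ ε) : swap φ ψ ε (proj φ ψ ε a) = proj ψ φ ε a.swap := rfl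

theorem swap_swap (z : ConnSum φ ψ ε) : swap ψ φ ε (swap φ ψ ε z) = z := by
  obtain ⟨a, rfl⟩ := proj_surjective z
  rw [swap_proj, swap_proj, Sum.swap_swap]

theorem continuous_swap : Continuous (swap φ ψ ε) :=
  continuous_quot_lift _ (continuous_proj.comp (Homeomorph.sumComm _ _).continuous)

variable (φ ψ ε) in
/-- The exchange of the two summands of a connected sum, as a homeomorphism. -/
def swapHomeomorph : ConnSum φ ψ ε ≃ₜ ConnSum ψ φ ε where
  toFun := swap φ ψ ε
  invFun := swap ψ φ ε
  left_inv := swap_swap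
  right_inv := swap_swap
  continuous_toFun := continuous_swap
  continuous_invFun := continuous_swap

instance [h : Nonempty (ConnSum φ ψ ε)] : Nonempty (ConnSum ψ φ ε) := h.map (swap φ ψ ε)

theorem forall_connSum {P : ConnSum φ ψ ε → Prop} (hinl : ∀ x, P (proj φ ψ ε (Sum.inl x)))
    (hinr : ∀ y, P (swap ψ φ ε (proj ψ φ ε (Sum.inl y)))) (z : ConnSum φ ψ ε) : P z := by
  obtain ⟨x | y, rfl⟩ := proj_surjective z
  exacts [hinl x, hinr y]

end Swap

section Height

/-- The height `|φ| - ε` or `ε - |ψ|` above the neck, on the disjoint union. -/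
noncomputable def preHeight (φ : OpenPartialHomeomorph M (E n))
    (ψ : OpenPartialHomeomorph N (E n)) (ε : ℝ) : PreSum φ ψ ε → ℝ :=
  Sum.elim (fun x => chartNorm φ (2 * ε) x.1 - ε) (fun y => ε - chartNorm ψ (2 * ε) y.1)

/-- The height above the neck, positive on the side of `M` and negative on the side of `N`. -/
noncomputable def height (φ : OpenPartialHomeomorph M (E n)) (ψ : OpenPartialHomeomorph N (E n))
    (ε : ℝ) : ConnSum φ ψ ε → ℝ :=
  Quot.lift (preHeight φ ψ ε) <| by
    rintro _ _ ⟨x, y, rfl, rfl, hx, hy, h, hxy⟩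
    simp [preHeight, chartNorm_of_mem hx, chartNorm_of_mem hy, ← hxy, h]

theorem continuous_height [T2Space M] [T2Space N] (hφ : φ.target = Metric.ball 0 (2 * ε))
    (hψ : ψ.target = Metric.ball 0 (2 * ε)) : Continuous (height φ ψ ε) := by
  refine continuous_quot_lift _ ?_
  exact (((continuous_chartNorm hφ).comp continuous_subtype_val).sub continuous_const).sumElim
    (continuous_const.sub ((continuous_chartNorm hψ).comp continuous_subtype_val))

theorem height_inl (x : {x : M // x ∉ chartBall φ ε}) :
    height φ ψ ε (proj φ ψ ε (Sum.inl x)) = chartNorm φ (2 * ε) x.1 - ε := rfl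

theorem height_swap (z : ConnSum φ ψ ε) : height ψ φ ε (swap φ ψ ε z) = -height φ ψ ε z := by
  obtain ⟨x | y, rfl⟩ := proj_surjective z
  exacts [(neg_sub _ _).symm, (neg_sub _ _).symm]

theorem height_inl_nonneg (hε : 0 < ε) (x : {x : M // x ∉ chartBall φ ε}) :
    0 ≤ height φ ψ ε (proj φ ψ ε (Sum.inl x)) := by
  rw [height_inl, sub_nonneg, ← not_lt, chartNorm_lt_iff (by linarith)]
  exact x.2

theorem height_inl_pos_iff (hε : 0 < ε) (x : {x : M // x ∉ chartBall φ ε}) :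
    0 < height φ ψ ε (proj φ ψ ε (Sum.inl x)) ↔ x.1 ∉ chartClosedBall φ ε := by
  rw [height_inl, sub_pos, ← not_le, chartNorm_le_iff (by linarith)]

theorem exists_inl_of_height_pos (hε : 0 < ε) {z : ConnSum φ ψ ε} (hz : 0 < height φ ψ ε z) :
    ∃ x, x.1 ∉ chartClosedBall φ ε ∧ proj φ ψ ε (Sum.inl x) = z := by
  induction z using forall_connSum with
  | hinl x => exact ⟨x, (height_inl_pos_iff hε x).1 hz, rfl⟩
  | hinr y =>
    rw [height_swap, neg_pos] at hz
    exact absurd hz (height_inl_nonneg hε y).not_gt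

theorem abs_height_inl_lt_iff (hε : 0 < ε) (hφ : φ.target = Metric.ball 0 (2 * ε))
    (x : {x : M // x ∉ chartBall φ ε}) :
    |height φ ψ ε (proj φ ψ ε (Sum.inl x))| < ε ↔ x.1 ∈ φ.source := by
  rw [abs_of_nonneg (height_inl_nonneg hε x), height_inl, sub_lt_iff_lt_add, ← two_mul,
    chartNorm_lt_iff le_rfl, chartBall_eq_source hφ]

theorem abs_height_swap (z : ConnSum φ ψ ε) :
    |height ψ φ ε (swap φ ψ ε z)| = |height φ ψ ε z| := by
  rw [height_swap, abs_neg]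

theorem abs_height_lt_iff (hε : 0 < ε) (hφ : φ.target = Metric.ball 0 (2 * ε))
    (hψ : ψ.target = Metric.ball 0 (2 * ε)) (a : PreSum φ ψ ε) :
    |height φ ψ ε (proj φ ψ ε a)| < ε ↔ a ∈ annuli φ ψ ε := by
  rcases a with x | y
  · rw [abs_height_inl_lt_iff hε hφ, ← chartBall_eq_source hφ]
    rfl
  · rw [← abs_height_swap, swap_proj, Sum.swap_inr, abs_height_inl_lt_iff hε hψ,
      ← chartBall_eq_source hψ]
    rfl

theorem setOf_abs_height_lt (hε : 0 < ε) (hφ : φ.target = Metric.ball 0 (2 * ε))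
    (hψ : ψ.target = Metric.ball 0 (2 * ε)) :
    {z | |height φ ψ ε z| < ε} = proj φ ψ ε '' annuli φ ψ ε := by
  rw [← Set.image_preimage_eq {z | |height φ ψ ε z| < ε} proj_surjective]
  exact congrArg _ (Set.ext (abs_height_lt_iff hε hφ hψ))

theorem height_pos_or_neg_or_abs_lt (hε : 0 < ε) (z : ConnSum φ ψ ε) :
    0 < height φ ψ ε z ∨ height φ ψ ε z < 0 ∨ |height φ ψ ε z| < ε := by
  rcases lt_trichotomy (height φ ψ ε z) 0 with h | h | h
  · exact .inr (.inl h)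
  · exact .inr (.inr (by rwa [h, abs_zero]))
  · exact .inl h

end Height

section Inclusion

/-- The projection from the side of `M` to `M`, continued beyond the neck by `φ⁻¹ ∘ ψ`. -/
noncomputable def toLeft (φ : OpenPartialHomeomorph M (E n)) (ψ : OpenPartialHomeomorph N (E n))
    (ε : ℝ) : ConnSum φ ψ ε → M :=
  Quot.lift (Sum.elim Subtype.val fun y => φ.symm (ψ y.1)) <| by
    rintro _ _ ⟨x, y, rfl, rfl, hx, -, -, hxy⟩
    simp [← hxy, φ.left_inv hx]

variable [Nonempty (ConnSum φ ψ ε)]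

variable (φ ψ ε) in
/-- The inclusion of the part of `M`, extended to `B(p, ε)` by an arbitrary constant. -/
noncomputable def fromLeft (x : M) : ConnSum φ ψ ε :=
  open Classical in
  if h : x ∉ chartBall φ ε then proj φ ψ ε (Sum.inl ⟨x, h⟩) else Classical.arbitrary _

theorem fromLeft_of_notMem {x : M} (h : x ∉ chartBall φ ε) :
    fromLeft φ ψ ε x = proj φ ψ ε (Sum.inl ⟨x, h⟩) := dif_pos h

theorem fromLeft_coe (x : {x : M // x ∉ chartBall φ ε}) :
    fromLeft φ ψ ε x = proj φ ψ ε (Sum.inl x) := fromLeft_of_notMem x.2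

theorem continuousOn_fromLeft : ContinuousOn (fromLeft φ ψ ε) (chartBall φ ε)ᶜ := by
  rw [continuousOn_iff_continuous_domRestrict]
  have h : Continuous fun x : {x : M // x ∉ chartBall φ ε} => proj φ ψ ε (Sum.inl x) :=
    continuous_proj.comp continuous_inl
  exact h.congr fun x => (fromLeft_coe x).symm

variable [T2Space M] [T2Space N]

/-- The inclusion of the part of `M` as a partial homeomorphism. -/
noncomputable def leftIncl (hε : 0 < ε)
    (hφ : φ.target = Metric.ball 0 (2 * ε)) (hψ : ψ.target = Metric.ball 0 (2 * ε)) :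
    OpenPartialHomeomorph M (ConnSum φ ψ ε) where
  toFun := fromLeft φ ψ ε
  invFun := toLeft φ ψ ε
  source := (chartClosedBall φ ε)ᶜ
  target := {z | 0 < height φ ψ ε z}
  map_source' x hx := by
    rw [fromLeft_of_notMem (mt (chartBall_subset_chartClosedBall ·) hx)]
    exact (height_inl_pos_iff hε _).2 hx
  map_target' z hz := by
    obtain ⟨x, hx, rfl⟩ := exists_inl_of_height_pos hε hz
    exact hx
  left_inv' x hx := by
    rw [fromLeft_of_notMem (mt (chartBall_subset_chartClosedBall ·) hx)]
    rfl
  right_inv' z hz := by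
    obtain ⟨x, -, rfl⟩ := exists_inl_of_height_pos hε hz
    exact fromLeft_coe x
  open_source := (isClosed_chartClosedBall hφ (by linarith)).isOpen_compl
  open_target := isOpen_lt continuous_const (continuous_height hφ hψ)
  continuousOn_toFun :=
    continuousOn_fromLeft.mono (Set.compl_subset_compl.2 chartBall_subset_chartClosedBall)
  continuousOn_invFun := by
    rw [isQuotientMap_proj.continuousOn_isOpen_iff
      (isOpen_lt continuous_const (continuous_height hφ hψ))]
    rintro (x | y) ha
    · refine ContinuousAt.continuousWithinAt ?_
      rw [← Topology.IsOpenEmbedding.inl.continuousAt_iff]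
      exact continuous_subtype_val.continuousAt
    · obtain hy := neg_pos.1 ((height_swap (proj ψ φ ε (.inl y))).symm.trans_gt ha)
      exact absurd hy (height_inl_nonneg hε y).not_gt

/-- The inclusion of the part of `N` as a partial homeomorphism. -/
noncomputable def rightIncl (hε : 0 < ε)
    (hφ : φ.target = Metric.ball 0 (2 * ε)) (hψ : ψ.target = Metric.ball 0 (2 * ε)) :
    OpenPartialHomeomorph N (ConnSum φ ψ ε) :=
  (leftIncl hε hψ hφ).transHomeomorph (swapHomeomorph ψ φ ε)

theorem rightIncl_target (hε : 0 < ε)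
    (hφ : φ.target = Metric.ball 0 (2 * ε)) (hψ : ψ.target = Metric.ball 0 (2 * ε)) :
    (rightIncl hε hφ hψ).target = {z | height φ ψ ε z < 0} := by
  ext z
  change 0 < height ψ φ ε (swap φ ψ ε z) ↔ _
  rw [height_swap, neg_pos]
  rfl

end Inclusion

section GlueChart

theorem preGlue_eq_of_glueRel {a b : PreSum φ ψ ε} (h : GlueRel φ ψ ε a b) :
    preGlue φ ψ ε a = preGlue φ ψ ε b := by
  obtain ⟨x, y, rfl, rfl, -, -, hx, hxy⟩ := h
  rcases eq_or_ne ε 0 with rfl | hε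
  · simp [preGlue]
  have hnorm : ‖ε⁻¹ • ψ y.1‖ = 1 := by
    rw [← hxy, norm_smul, norm_inv, hx, Real.norm_of_nonneg (hx ▸ norm_nonneg _),
      inv_mul_cancel₀ hε]
  simp [preGlue, hnorm, hxy]

/-- The gluing map on `M ♯ N`. -/
noncomputable def glueFun (φ : OpenPartialHomeomorph M (E n)) (ψ : OpenPartialHomeomorph N (E n))
    (ε : ℝ) : ConnSum φ ψ ε → E n :=
  Quot.lift (preGlue φ ψ ε) fun _ _ => preGlue_eq_of_glueRel

theorem glueFun_inl (hε : 0 < ε) (x : {x : M // x ∉ chartBall φ ε}) :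
    glueFun φ ψ ε (proj φ ψ ε (Sum.inl x)) = scaledChart φ hε x.1 := rfl

theorem glueFun_swap (z : ConnSum φ ψ ε) :
    glueFun ψ φ ε (swap φ ψ ε z) = unitInversion (E n) (glueFun φ ψ ε z) := by
  obtain ⟨x | y, rfl⟩ := proj_surjective z
  · exact (unitInversion_apply _).symm
  · refine (unitInversion_unitInversion _).symm.trans (congrArg _ ?_)
    exact unitInversion_apply _

theorem glueFun_mem_annulus (hε : 0 < ε) (hφ : φ.target = Metric.ball 0 (2 * ε))
    (hψ : ψ.target = Metric.ball 0 (2 * ε)) {z : ConnSum φ ψ ε} (hz : |height φ ψ ε z| < ε) :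
    glueFun φ ψ ε z ∈ annulus n := by
  induction z using forall_connSum with
  | hinl x =>
    rw [abs_height_inl_lt_iff hε hφ] at hz
    exact ⟨one_half_lt_one.trans_le (one_le_norm_scaledChart hε hz x.2),
      norm_scaledChart_lt_two hε hφ hz⟩
  | hinr y =>
    rw [abs_height_swap, abs_height_inl_lt_iff hε hψ] at hz
    rw [glueFun_swap]
    exact unitInversion_mem_annulus
      ⟨one_half_lt_one.trans_le (one_le_norm_scaledChart hε hz y.2),
        norm_scaledChart_lt_two hε hψ hz⟩

theorem continuousOn_glueFun [T2Space M] [T2Space N] (hε : 0 < ε)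
    (hφ : φ.target = Metric.ball 0 (2 * ε)) (hψ : ψ.target = Metric.ball 0 (2 * ε)) :
    ContinuousOn (glueFun φ ψ ε) {z | |height φ ψ ε z| < ε} := by
  rw [isQuotientMap_proj.continuousOn_isOpen_iff
    (isOpen_lt (continuous_height hφ hψ).abs continuous_const)]
  intro a ha
  refine ContinuousAt.continuousWithinAt ?_
  replace ha := (abs_height_lt_iff hε hφ hψ a).1 ha
  rcases a with x | y
  · rw [← Topology.IsOpenEmbedding.inl.continuousAt_iff]
    exact ((scaledChart φ hε).continuousAt ha.1).comp continuous_subtype_val.continuousAt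
  · rw [← Topology.IsOpenEmbedding.inr.continuousAt_iff]
    have hy : scaledChart ψ hε y.1 ≠ 0 :=
      norm_pos_iff.1 (one_pos.trans_le (one_le_norm_scaledChart hε ha.1 y.2))
    have hcont :=
      ((unitInversion (E n)).continuousAt hy).comp ((scaledChart ψ hε).continuousAt ha.1)
    exact (hcont.comp_of_eq continuous_subtype_val.continuousAt rfl).congr
      (.of_forall fun y => unitInversion_apply _)

variable [Nonempty (ConnSum φ ψ ε)]

theorem fromLeft_scaledChart_symm (hε : 0 < ε) {y : E n} (hy : y ∈ (scaledChart φ hε).target)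
    (hy1 : 1 ≤ ‖y‖) : fromLeft φ ψ ε ((scaledChart φ hε).symm y) =
      proj φ ψ ε (Sum.inl ⟨_, scaledChart_symm_notMem_chartBall hε hy hy1⟩) :=
  fromLeft_of_notMem _

theorem fromLeft_eq_swap_fromLeft (hε : 0 < ε) (hφ : φ.target = Metric.ball 0 (2 * ε))
    (hψ : ψ.target = Metric.ball 0 (2 * ε)) {y : E n} (hy : ‖y‖ = 1) :
    fromLeft φ ψ ε ((scaledChart φ hε).symm y) =
      swap ψ φ ε (fromLeft ψ φ ε ((scaledChart ψ hε).symm y)) := by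
  have hyφ := mem_scaledChart_target hε hφ (hy.trans_lt one_lt_two)
  have hyψ := mem_scaledChart_target hε hψ (hy.trans_lt one_lt_two)
  rw [fromLeft_scaledChart_symm hε hyφ hy.ge, fromLeft_scaledChart_symm hε hyψ hy.ge]
  have hφy := (inv_smul_eq_iff₀ hε.ne').1 ((scaledChart φ hε).right_inv hyφ)
  have hψy := (inv_smul_eq_iff₀ hε.ne').1 ((scaledChart ψ hε).right_inv hyψ)
  refine Quot.sound ⟨_, _, rfl, rfl, (scaledChart φ hε).map_target hyφ,
    (scaledChart ψ hε).map_target hyψ, ?_, hφy.trans hψy.symm⟩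
  exact (congrArg _ hφy).trans (by rw [norm_smul, hy, Real.norm_of_nonneg hε.le, mul_one])

variable (φ ψ) in
/-- The inverse of the gluing chart. -/
noncomputable def glueInv (hε : 0 < ε) (y : E n) : ConnSum φ ψ ε :=
  open Classical in
  if 1 ≤ ‖y‖ then fromLeft φ ψ ε ((scaledChart φ hε).symm y)
  else swap ψ φ ε (fromLeft ψ φ ε ((scaledChart ψ hε).symm (unitInversion (E n) y)))

theorem glueInv_of_one_le (hε : 0 < ε) {y : E n} (hy : 1 ≤ ‖y‖) :
    glueInv φ ψ hε y = fromLeft φ ψ ε ((scaledChart φ hε).symm y) := if_pos hy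

theorem glueInv_unitInversion (hε : 0 < ε) (hφ : φ.target = Metric.ball 0 (2 * ε))
    (hψ : ψ.target = Metric.ball 0 (2 * ε)) {y : E n} (hy : 1 ≤ ‖y‖) :
    glueInv φ ψ hε (unitInversion (E n) y) = swap ψ φ ε (glueInv ψ φ hε y) := by
  rw [glueInv_of_one_le hε hy]
  rcases hy.eq_or_lt with hy | hy
  · rw [unitInversion_of_norm_eq_one hy.symm, glueInv_of_one_le hε hy.le,
      fromLeft_eq_swap_fromLeft hε hφ hψ hy.symm]
  · rw [glueInv, if_neg, unitInversion_unitInversion]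
    rw [norm_unitInversion, not_le]
    exact inv_lt_one_of_one_lt₀ hy

theorem glueInv_of_one_le_of_lt_two (hε : 0 < ε) (hφ : φ.target = Metric.ball 0 (2 * ε)) {y : E n}
    (hy1 : 1 ≤ ‖y‖) (hy2 : ‖y‖ < 2) : glueInv φ ψ hε y = proj φ ψ ε (Sum.inl
      ⟨_, scaledChart_symm_notMem_chartBall hε (mem_scaledChart_target hε hφ hy2) hy1⟩) :=
  (glueInv_of_one_le hε hy1).trans (fromLeft_of_notMem _)

theorem abs_height_glueInv_lt (hε : 0 < ε) (hφ : φ.target = Metric.ball 0 (2 * ε))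
    (hψ : ψ.target = Metric.ball 0 (2 * ε)) :
    ∀ y ∈ annulus n, |height φ ψ ε (glueInv φ ψ hε y)| < ε := by
  refine forall_mem_annulus (fun y hy1 hy2 => ?_) (fun y hy1 hy2 => ?_)
  · rw [glueInv_of_one_le_of_lt_two hε hφ hy1 hy2, abs_height_inl_lt_iff hε hφ]
    exact (scaledChart φ hε).map_target (mem_scaledChart_target hε hφ hy2)
  · rw [glueInv_unitInversion hε hφ hψ hy1, abs_height_swap,
      glueInv_of_one_le_of_lt_two hε hψ hy1 hy2, abs_height_inl_lt_iff hε hψ]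
    exact (scaledChart ψ hε).map_target (mem_scaledChart_target hε hψ hy2)

theorem glueFun_glueInv (hε : 0 < ε) (hφ : φ.target = Metric.ball 0 (2 * ε))
    (hψ : ψ.target = Metric.ball 0 (2 * ε)) :
    ∀ y ∈ annulus n, glueFun φ ψ ε (glueInv φ ψ hε y) = y := by
  refine forall_mem_annulus (fun y hy1 hy2 => ?_) (fun y hy1 hy2 => ?_)
  · rw [glueInv_of_one_le_of_lt_two hε hφ hy1 hy2, glueFun_inl hε,
      (scaledChart φ hε).right_inv (mem_scaledChart_target hε hφ hy2)]
  · rw [glueInv_unitInversion hε hφ hψ hy1, glueFun_swap,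
      glueInv_of_one_le_of_lt_two hε hψ hy1 hy2, glueFun_inl hε,
      (scaledChart ψ hε).right_inv (mem_scaledChart_target hε hψ hy2)]

theorem glueInv_scaledChart (hε : 0 < ε) (x : {x : M // x ∉ chartBall φ ε})
    (hx : x.1 ∈ φ.source) : glueInv φ ψ hε (scaledChart φ hε x.1) = proj φ ψ ε (Sum.inl x) := by
  rw [glueInv_of_one_le hε (one_le_norm_scaledChart hε hx x.2), (scaledChart φ hε).left_inv hx,
    fromLeft_coe]

theorem glueInv_glueFun (hε : 0 < ε) (hφ : φ.target = Metric.ball 0 (2 * ε))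
    (hψ : ψ.target = Metric.ball 0 (2 * ε)) {z : ConnSum φ ψ ε} (hz : |height φ ψ ε z| < ε) :
    glueInv φ ψ hε (glueFun φ ψ ε z) = z := by
  induction z using forall_connSum with
  | hinl x =>
    rw [glueFun_inl hε, glueInv_scaledChart hε x ((abs_height_inl_lt_iff hε hφ x).1 hz)]
  | hinr y =>
    have hy : y.1 ∈ ψ.source := by rwa [abs_height_swap, abs_height_inl_lt_iff hε hψ] at hz
    rw [glueFun_swap, glueFun_inl hε,
      glueInv_unitInversion hε hφ hψ (one_le_norm_scaledChart hε hy y.2),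
      glueInv_scaledChart hε y hy]

theorem continuousOn_fromLeft_scaledChart_symm (hε : 0 < ε)
    (hφ : φ.target = Metric.ball 0 (2 * ε)) :
    ContinuousOn (fun y => fromLeft φ ψ ε ((scaledChart φ hε).symm y))
      {y : E n | 1 ≤ ‖y‖ ∧ ‖y‖ < 2} :=
  continuousOn_fromLeft.comp
    ((scaledChart φ hε).continuousOn_symm.mono fun _ hy => mem_scaledChart_target hε hφ hy.2)
    fun _ hy => scaledChart_symm_notMem_chartBall hε (mem_scaledChart_target hε hφ hy.2) hy.1

theorem continuousOn_glueInv (hε : 0 < ε) (hφ : φ.target = Metric.ball 0 (2 * ε))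
    (hψ : ψ.target = Metric.ball 0 (2 * ε)) : ContinuousOn (glueInv φ ψ hε) (annulus n) := by
  refine ContinuousOn.if ?_ ?_ ?_
  · rintro y ⟨-, hy⟩
    have hnorm : ‖y‖ = 1 := (frontier_le_subset_eq continuous_const continuous_norm hy).symm
    rw [unitInversion_of_norm_eq_one hnorm, fromLeft_eq_swap_fromLeft hε hφ hψ hnorm]
  · rw [(isClosed_le continuous_const continuous_norm).closure_eq]
    exact (continuousOn_fromLeft_scaledChart_symm hε hφ).mono fun y hy => ⟨hy.2, hy.1.2⟩
  · have hclosure : closure {y : E n | ¬ 1 ≤ ‖y‖} ⊆ {y | ‖y‖ ≤ 1} :=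
      closure_minimal (fun y hy => (not_le.1 hy).le) (isClosed_le continuous_norm continuous_const)
    refine continuous_swap.comp_continuousOn <|
      (continuousOn_fromLeft_scaledChart_symm hε hψ).comp
        ((unitInversion (E n)).continuousOn.mono fun y hy => ne_zero_of_mem_annulus hy.1)
        fun y hy => ?_
    exact ⟨(one_le_norm_unitInversion_iff hy.1).2 (hclosure hy.2),
      (unitInversion_mem_annulus hy.1).2⟩

variable [T2Space M] [T2Space N]

/-- The gluing chart. -/
noncomputable def glueChart (hε : 0 < ε) (hφ : φ.target = Metric.ball 0 (2 * ε))
    (hψ : ψ.target = Metric.ball 0 (2 * ε)) : OpenPartialHomeomorph (ConnSum φ ψ ε) (E n) where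
  toFun := glueFun φ ψ ε
  invFun := glueInv φ ψ hε
  source := {z | |height φ ψ ε z| < ε}
  target := annulus n
  map_source' _ := glueFun_mem_annulus hε hφ hψ
  map_target' := abs_height_glueInv_lt hε hφ hψ
  left_inv' _ := glueInv_glueFun hε hφ hψ
  right_inv' := glueFun_glueInv hε hφ hψ
  open_source := isOpen_lt (continuous_height hφ hψ).abs continuous_const
  open_target := isOpen_annulus
  continuousOn_toFun := continuousOn_glueFun hε hφ hψ
  continuousOn_invFun := continuousOn_glueInv hε hφ hψ

end GlueChart

section Separation

variable [Nonempty (ConnSum φ ψ ε)] [T2Space M] [T2Space N]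

theorem mem_leftIncl_or_rightIncl_or_glueChart (hε : 0 < ε) (hφ : φ.target = Metric.ball 0 (2 * ε))
    (hψ : ψ.target = Metric.ball 0 (2 * ε)) (z : ConnSum φ ψ ε) :
    z ∈ (leftIncl hε hφ hψ).target ∨ z ∈ (rightIncl hε hφ hψ).target ∨
      z ∈ (glueChart hε hφ hψ).source := by
  rw [rightIncl_target]
  exact height_pos_or_neg_or_abs_lt hε z

theorem t2Space_connSum (hε : 0 < ε) (hφ : φ.target = Metric.ball 0 (2 * ε))
    (hψ : ψ.target = Metric.ball 0 (2 * ε)) : T2Space (ConnSum φ ψ ε) := by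
  refine t2Space_of_continuous_of_t2Space_fibers (continuous_height hφ hψ) fun z => ?_
  rcases mem_leftIncl_or_rightIncl_or_glueChart hε hφ hψ z with hz | hz | hz
  · refine ⟨_, (leftIncl hε hφ hψ).open_target,
      (leftIncl hε hφ hψ).toHomeomorphSourceTarget.t2Space, fun w hw => ?_⟩
    exact hz.trans_eq hw.symm
  · refine ⟨_, (rightIncl hε hφ hψ).open_target,
      (rightIncl hε hφ hψ).toHomeomorphSourceTarget.t2Space, fun w hw => ?_⟩
    rw [rightIncl_target] at hz ⊢
    exact hw.trans_lt hz
  · refine ⟨_, (glueChart hε hφ hψ).open_source,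
      (glueChart hε hφ hψ).toHomeomorphSourceTarget.symm.t2Space, fun w hw => ?_⟩
    exact (congrArg abs hw).trans_lt hz

theorem secondCountableTopology_connSum [SecondCountableTopology M] [SecondCountableTopology N]
    (hε : 0 < ε) (hφ : φ.target = Metric.ball 0 (2 * ε))
    (hψ : ψ.target = Metric.ball 0 (2 * ε)) : SecondCountableTopology (ConnSum φ ψ ε) := by
  let U : Fin 3 → Set (ConnSum φ ψ ε) :=
    ![(leftIncl hε hφ hψ).target, (rightIncl hε hφ hψ).target, (glueChart hε hφ hψ).source]
  have hU : ∀ i, SecondCountableTopology (U i) := by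
    simp only [Fin.forall_fin_succ, IsEmpty.forall_iff, and_true]
    exact ⟨(leftIncl hε hφ hψ).toHomeomorphSourceTarget.symm.secondCountableTopology,
      (rightIncl hε hφ hψ).toHomeomorphSourceTarget.symm.secondCountableTopology,
      (glueChart hε hφ hψ).toHomeomorphSourceTarget.secondCountableTopology⟩
  refine TopologicalSpace.secondCountableTopology_of_countable_cover (U := U) ?_ ?_
  · simp only [Fin.forall_fin_succ, IsEmpty.forall_iff, and_true]
    exact ⟨(leftIncl hε hφ hψ).open_target, (rightIncl hε hφ hψ).open_target,
      (glueChart hε hφ hψ).open_source⟩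
  · refine Set.eq_univ_of_forall fun z => Set.mem_iUnion.2 ?_
    rcases mem_leftIncl_or_rightIncl_or_glueChart hε hφ hψ z with hz | hz | hz
    exacts [⟨0, hz⟩, ⟨1, hz⟩, ⟨2, hz⟩]

end Separation

theorem compactSpace_connSum [CompactSpace M] [CompactSpace N] :
    CompactSpace (ConnSum φ ψ ε) := by
  have : CompactSpace {x : M // x ∉ chartBall φ ε} :=
    isCompact_iff_compactSpace.1 (isOpen_chartBall φ ε).isClosed_compl.isCompact
  have : CompactSpace {y : N // y ∉ chartBall ψ ε} :=
    isCompact_iff_compactSpace.1 (isOpen_chartBall ψ ε).isClosed_compl.isCompact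
  exact Quot.compactSpace

theorem nonempty_connSum (hn : 0 < n) (hε : 0 < ε) (hφ : φ.target = Metric.ball 0 (2 * ε)) :
    Nonempty (ConnSum φ ψ ε) := by
  have : Nonempty (Fin n) := ⟨⟨0, hn⟩⟩
  obtain ⟨y, hy⟩ := (NormedSpace.sphere_nonempty (x := (0 : E n)) (r := 1)).2 zero_le_one
  rw [mem_sphere_zero_iff_norm] at hy
  exact ⟨proj φ ψ ε (Sum.inl ⟨_, scaledChart_symm_notMem_chartBall hε
    (mem_scaledChart_target hε hφ (hy.trans_lt one_lt_two)) hy.ge⟩)⟩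

end Topology

/-! ### The smooth structure of the connected sum -/

section Gluing

variable {X Y Z H : Type*} [TopologicalSpace X] [TopologicalSpace Y] [TopologicalSpace Z]
  [TopologicalSpace H]

/-- Read through the partial homeomorphism `i`, the chart `k` of `Z` is a restriction of the chart
`f` of `X`. -/
def ReadsAs (i : OpenPartialHomeomorph X Z) (k : OpenPartialHomeomorph Z H)
    (f : OpenPartialHomeomorph X H) : Prop :=
  ∀ x ∈ i.source, i x ∈ k.source → x ∈ f.source ∧ k (i x) = f x

/-- `Z` is the union of the images of `i` and `i'`, which are disjoint, and of the domain of the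
chart `k`, which on each side is read as a chart `fX`, `fY`. -/
structure IsGluing (i : OpenPartialHomeomorph X Z) (i' : OpenPartialHomeomorph Y Z)
    (k : OpenPartialHomeomorph Z H) (fX : OpenPartialHomeomorph X H)
    (fY : OpenPartialHomeomorph Y H) : Prop where
  disjoint : Disjoint i.target i'.target
  cover : ∀ z, z ∈ i.target ∨ z ∈ i'.target ∨ z ∈ k.source
  readsAs_left : ReadsAs i k fX
  readsAs_right : ReadsAs i' k fY

/-- The charts of `Z` obtained from those of `A` on `X`, those of `B` on `Y`, and the chart `k`
(`gluedAtlas` for arbitrary gluing maps). -/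
def combinedAtlas (i : OpenPartialHomeomorph X Z) (i' : OpenPartialHomeomorph Y Z)
    (k : OpenPartialHomeomorph Z H) (A : Set (OpenPartialHomeomorph X H))
    (B : Set (OpenPartialHomeomorph Y H)) : Set (OpenPartialHomeomorph Z H) :=
  (fun e => i.symm ≫ₕ e) '' A ∪ (fun e => i'.symm ≫ₕ e) '' B ∪ {k}

variable {i : OpenPartialHomeomorph X Z} {i' : OpenPartialHomeomorph Y Z}
  {k : OpenPartialHomeomorph Z H} {f : OpenPartialHomeomorph X H} {f' : OpenPartialHomeomorph Y H}
  {A : Set (OpenPartialHomeomorph X H)} {B : Set (OpenPartialHomeomorph Y H)}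

theorem ReadsAs.symm_mem_source (h : ReadsAs i k f) {z : Z} (hz : z ∈ i.target)
    (hzk : z ∈ k.source) : i.symm z ∈ f.source :=
  (h _ (i.map_target hz) (by rwa [i.right_inv hz])).1

theorem ReadsAs.eventuallyEq (h : ReadsAs i k f) {z : Z} (hz : z ∈ i.target) (hzk : z ∈ k.source) :
    k =ᶠ[𝓝 z] fun z => f (i.symm z) := by
  filter_upwards [i.open_target.mem_nhds hz, k.open_source.mem_nhds hzk] with w hw hwk
  rw [← (h _ (i.map_target hw) (by rwa [i.right_inv hw])).2, i.right_inv hw]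

theorem IsGluing.notMem_left (h : IsGluing i i' k f f') {z : Z} (hz : z ∈ i'.target) :
    z ∉ i.target :=
  h.disjoint.notMem_of_mem_right hz

theorem forall_mem_combinedAtlas {P : OpenPartialHomeomorph Z H → Prop} :
    (∀ e ∈ combinedAtlas i i' k A B, P e) ↔
      (∀ e ∈ A, P (i.symm ≫ₕ e)) ∧ (∀ e ∈ B, P (i'.symm ≫ₕ e)) ∧ P k := by
  simp only [combinedAtlas, Set.mem_union, or_imp, forall_and, Set.forall_mem_image,
    Set.mem_singleton_iff, forall_eq, and_assoc]

theorem IsGluing.exists_mem_combinedAtlas (h : IsGluing i i' k f f')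
    (hA : ∀ x, ∃ e ∈ A, x ∈ e.source) (hB : ∀ y, ∃ e ∈ B, y ∈ e.source) (z : Z) :
    ∃ e ∈ combinedAtlas i i' k A B, z ∈ e.source := by
  rcases h.cover z with hz | hz | hz
  · obtain ⟨e, he, hze⟩ := hA (i.symm z)
    exact ⟨_, .inl (.inl ⟨e, he, rfl⟩), hz, hze⟩
  · obtain ⟨e, he, hze⟩ := hB (i'.symm z)
    exact ⟨_, .inl (.inr ⟨e, he, rfl⟩), hz, hze⟩
  · exact ⟨k, .inr rfl, hz⟩

theorem IsGluing.forall_combinedAtlas (h : IsGluing i i' k f f')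
    {R : (Z → H) → (Z → H) → Z → Prop} (hsymm : ∀ {e e' z}, R e e' z → R e' e z)
    (hcongr : ∀ {e e' e₁ e₁' z}, R e e' z → e₁ =ᶠ[𝓝 z] e → e₁' =ᶠ[𝓝 z] e' → R e₁ e₁' z)
    (hk : ∀ z ∈ k.source, R k k z)
    (hA : ∀ e ∈ A, ∀ e' ∈ insert f A, ∀ z ∈ i.target, i.symm z ∈ e.source →
      i.symm z ∈ e'.source → R (fun z => e (i.symm z)) (fun z => e' (i.symm z)) z)
    (hB : ∀ e ∈ B, ∀ e' ∈ insert f' B, ∀ z ∈ i'.target, i'.symm z ∈ e.source →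
      i'.symm z ∈ e'.source → R (fun z => e (i'.symm z)) (fun z => e' (i'.symm z)) z) :
    ∀ e ∈ combinedAtlas i i' k A B, ∀ e' ∈ combinedAtlas i i' k A B,
      ∀ z ∈ e.source, z ∈ e'.source → R e e' z := by
  have hleft : ∀ e ∈ A, ∀ z ∈ (i.symm ≫ₕ e).source, z ∈ k.source → R (i.symm ≫ₕ e) k z :=
    fun e he z hz hzk => hcongr (hA e he f (.inl rfl) z hz.1 hz.2
      (h.readsAs_left.symm_mem_source hz.1 hzk)) .rfl (h.readsAs_left.eventuallyEq hz.1 hzk)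
  have hright : ∀ e ∈ B, ∀ z ∈ (i'.symm ≫ₕ e).source, z ∈ k.source → R (i'.symm ≫ₕ e) k z :=
    fun e he z hz hzk => hcongr (hB e he f' (.inl rfl) z hz.1 hz.2
      (h.readsAs_right.symm_mem_source hz.1 hzk)) .rfl (h.readsAs_right.eventuallyEq hz.1 hzk)
  simp only [forall_mem_combinedAtlas]
  refine ⟨fun e he => ⟨?_, ?_, hleft e he⟩, fun e he => ⟨?_, ?_, hright e he⟩,
    fun e he z hz hze => hsymm (hleft e he z hze hz),
    fun e he z hz hze => hsymm (hright e he z hze hz), fun z hz _ => hk z hz⟩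
  · exact fun e' he' z hz hz' => hA e he e' (.inr he') z hz.1 hz.2 hz'.2
  · exact fun e' _ z hz hz' => absurd hz.1 (h.notMem_left hz'.1)
  · exact fun e' _ z hz hz' => absurd hz'.1 (h.notMem_left hz.1)
  · exact fun e' he' z hz hz' => hB e he e' (.inr he') z hz.1 hz.2 hz'.2

/-- The charted space structure given by a family of charts whose domains cover the space. -/
@[reducible] noncomputable def chartedSpaceOfCover (A : Set (OpenPartialHomeomorph Z H))
    (hA : ∀ z, ∃ e ∈ A, z ∈ e.source) : ChartedSpace H Z where
  atlas := A
  chartAt z := (hA z).choose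
  mem_chart_source z := (hA z).choose_spec.2
  chart_mem_atlas z := (hA z).choose_spec.1

end Gluing

section SmoothGluing

variable {V : Type*} [NormedAddCommGroup V] [NormedSpace ℝ V]

/-- Near `x`, the map `e'` is a smooth function of `e`. -/
def SmoothTransitionAt {X : Type*} [TopologicalSpace X] (e e' : X → V) (x : X) : Prop :=
  ∃ m : V → V, ContDiffAt ℝ ∞ m (e x) ∧ e' =ᶠ[𝓝 x] m ∘ e

namespace SmoothTransitionAt

variable {X Y : Type*} [TopologicalSpace X] [TopologicalSpace Y] {x : X}

protected theorem refl (e : X → V) (x : X) : SmoothTransitionAt e e x :=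
  ⟨id, contDiffAt_id, .rfl⟩

theorem congr {e e' e₁ e₁' : X → V} (h : SmoothTransitionAt e e' x) (h₁ : e₁ =ᶠ[𝓝 x] e)
    (h₁' : e₁' =ᶠ[𝓝 x] e') : SmoothTransitionAt e₁ e₁' x := by
  obtain ⟨m, hm, h⟩ := h
  exact ⟨m, h₁.eq_of_nhds ▸ hm, (h₁'.trans h).trans (h₁.symm.fun_comp m)⟩

theorem comp {e e' : Y → V} {f : X → Y} (h : SmoothTransitionAt e e' (f x))
    (hf : ContinuousAt f x) : SmoothTransitionAt (fun z => e (f z)) (fun z => e' (f z)) x := by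
  obtain ⟨m, hm, h⟩ := h
  exact ⟨m, hm, hf.eventually h⟩

theorem contDiffAt {e : OpenPartialHomeomorph X V} {e' : X → V} (h : SmoothTransitionAt e e' x)
    (hx : x ∈ e.source) : ContDiffAt ℝ ∞ (e' ∘ e.symm) (e x) := by
  obtain ⟨m, hm, h⟩ := h
  refine hm.congr_of_eventuallyEq ?_
  rw [← e.left_inv hx] at h
  filter_upwards [(e.continuousAt_symm (e.map_source hx)).eventually h,
    e.eventually_right_inverse (e.map_source hx)] with y hy hey
  rw [Function.comp_apply, hy, Function.comp_apply, hey]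

end SmoothTransitionAt

theorem IsPartialDiffeo.smoothTransitionAt {X : Type*} [TopologicalSpace X] [ChartedSpace V X]
    {e e' : OpenPartialHomeomorph X V} (he : IsPartialDiffeo V e) (he' : IsPartialDiffeo V e')
    {x : X} (hx : x ∈ e.source) (hx' : x ∈ e'.source) : SmoothTransitionAt e e' x :=
  ⟨e.symm ≫ₕ e',
    ((he.symm.trans he').contMDiffAt ⟨e.map_source hx, by simpa [e.left_inv hx]⟩).contDiffAt,
    (e.eventually_left_inverse hx).mono fun z hz => by simp [hz]⟩

theorem isPartialDiffeo_of_locally {X Z : Type*} [TopologicalSpace X] [ChartedSpace V X]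
    [TopologicalSpace Z] [ChartedSpace V Z] {i : OpenPartialHomeomorph X Z}
    (h : ∀ x ∈ i.source, ∃ d : OpenPartialHomeomorph X Z, IsPartialDiffeo V d ∧ x ∈ d.source ∧
      d.source ⊆ i.source ∧ Set.EqOn i d d.source) : IsPartialDiffeo V i where
  smooth x hx := by
    obtain ⟨d, hd, hxd, -, hid⟩ := h x hx
    exact ((hd.contMDiffAt hxd).congr_of_eventuallyEq
      (hid.eventuallyEq_of_mem (d.open_source.mem_nhds hxd))).contMDiffWithinAt
  smooth_symm z hz := by
    obtain ⟨d, hd, hxd, hsub, hid⟩ := h (i.symm z) (i.map_target hz)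
    have hzd : z ∈ d.target := by
      rw [← i.right_inv hz, hid hxd]
      exact d.map_source hxd
    refine ((hd.symm.contMDiffAt hzd).congr_of_eventuallyEq ?_).contMDiffWithinAt
    filter_upwards [d.open_target.mem_nhds hzd] with w hw
    rw [← i.left_inv (hsub (d.map_target hw)), hid (d.map_target hw), d.right_inv hw]

variable {X Y Z : Type*} [TopologicalSpace X] [ChartedSpace V X] [IsManifold 𝓘(ℝ, V) ∞ X]
  [TopologicalSpace Y] [ChartedSpace V Y] [IsManifold 𝓘(ℝ, V) ∞ Y] [TopologicalSpace Z]
  {i : OpenPartialHomeomorph X Z} {i' : OpenPartialHomeomorph Y Z}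
  {k : OpenPartialHomeomorph Z V} {f : OpenPartialHomeomorph X V} {f' : OpenPartialHomeomorph Y V}

theorem IsGluing.isManifold (h : IsGluing i i' k f f') (hf : IsPartialDiffeo V f)
    (hf' : IsPartialDiffeo V f') [ChartedSpace V Z]
    (hZ : atlas V Z = combinedAtlas i i' k (atlas V X) (atlas V Y)) :
    IsManifold 𝓘(ℝ, V) ∞ Z := by
  have hX : ∀ e ∈ insert f (atlas V X), IsPartialDiffeo V e :=
    Set.forall_mem_insert.2 ⟨hf, fun e he =>
      mem_maximalAtlas_iff_isPartialDiffeo.1 (IsManifold.subset_maximalAtlas he)⟩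
  have hY : ∀ e ∈ insert f' (atlas V Y), IsPartialDiffeo V e :=
    Set.forall_mem_insert.2 ⟨hf', fun e he =>
      mem_maximalAtlas_iff_isPartialDiffeo.1 (IsManifold.subset_maximalAtlas he)⟩
  have hR := h.forall_combinedAtlas (A := atlas V X) (B := atlas V Y)
    (R := fun e e' z => SmoothTransitionAt e e' z ∧ SmoothTransitionAt e' e z) And.symm
    (fun h h₁ h₁' => ⟨h.1.congr h₁ h₁', h.2.congr h₁' h₁⟩) (fun z _ => ⟨.refl _ _, .refl _ _⟩)
    (fun e he e' he' z hz hze hze' =>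
      ⟨((hX e (.inr he)).smoothTransitionAt (hX e' he') hze hze').comp (i.continuousAt_symm hz),
        ((hX e' he').smoothTransitionAt (hX e (.inr he)) hze' hze).comp (i.continuousAt_symm hz)⟩)
    (fun e he e' he' z hz hze hze' =>
      ⟨((hY e (.inr he)).smoothTransitionAt (hY e' he') hze hze').comp (i'.continuousAt_symm hz),
        ((hY e' he').smoothTransitionAt (hY e (.inr he)) hze' hze).comp (i'.continuousAt_symm hz)⟩)
  refine isManifold_of_contDiffOn _ _ _ fun e e' he he' => ?_
  rw [hZ] at he he'
  have hsmooth : ∀ y ∈ (e.symm ≫ₕ e').source, ContDiffAt ℝ ∞ (e.symm ≫ₕ e') y :=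
    forall_mem_transition_source_iff.2 fun z hz hz' => (hR e he e' he' z hz hz').1.contDiffAt hz
  exact fun y hy => (hsmooth y hy.1).contDiffWithinAt

theorem isPartialDiffeo_of_symm_trans_mem [ChartedSpace V Z] [IsManifold 𝓘(ℝ, V) ∞ Z]
    (h : ∀ e ∈ atlas V X, i.symm ≫ₕ e ∈ IsManifold.maximalAtlas 𝓘(ℝ, V) ∞ Z) :
    IsPartialDiffeo V i := by
  refine isPartialDiffeo_of_locally fun x hx => ?_
  have he := mem_maximalAtlas_iff_isPartialDiffeo.1 (IsManifold.chart_mem_maximalAtlas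
    (I := 𝓘(ℝ, V)) (n := ∞) x)
  have hie := mem_maximalAtlas_iff_isPartialDiffeo.1 (h _ (chart_mem_atlas V x))
  refine ⟨_, he.trans hie.symm, by simp [hx], fun z hz => ?_, fun z hz => ?_⟩
  · simp only [mfld_simps] at hz
    simpa only [(chartAt V x).left_inv hz.1] using hz.2.2
  · simp only [mfld_simps] at hz ⊢
    rw [(chartAt V x).left_inv hz.1]

end SmoothGluing

section RescaledCharts

variable {n : ℕ} {M N : Type*} [TopologicalSpace M] [TopologicalSpace N]
  {φ : OpenPartialHomeomorph M (E n)} {ψ : OpenPartialHomeomorph N (E n)} {ε : ℝ} (hε : 0 < ε)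

/-- The chart `ψ / ε` followed by the inversion in the unit sphere: the reading of the gluing
chart on the side of `N`. -/
noncomputable def invertedChart (ψ : OpenPartialHomeomorph N (E n)) (hε : 0 < ε) :
    OpenPartialHomeomorph N (E n) :=
  scaledChart ψ hε ≫ₕ unitInversion (E n)

theorem scaledChart_eq_similarity :
    ⇑(scaledChart φ hε) = fun x => similarity ε⁻¹ (.refl ℝ (E n)) 0 (φ x) := by
  ext1 x
  simp [similarity, scaledChart]

theorem mem_invertedChart_source {y : N} :
    y ∈ (invertedChart ψ hε).source ↔ y ∈ ψ.source ∧ ψ y ≠ 0 := by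
  change y ∈ ψ.source ∧ ε⁻¹ • ψ y ≠ 0 ↔ _
  rw [smul_ne_zero_iff_right (inv_ne_zero hε.ne')]

theorem isPartialDiffeo_smulOfNeZero {V : Type*} [NormedAddCommGroup V] [NormedSpace ℝ V] {c : ℝ}
    (hc : c ≠ 0) :
    IsPartialDiffeo V (Homeomorph.smulOfNeZero (α := V) c hc).toOpenPartialHomeomorph :=
  ⟨(contDiff_const_smul c).contMDiff.contMDiffOn, (contDiff_const_smul c⁻¹).contMDiff.contMDiffOn⟩

theorem isPartialDiffeo_scaledChart [ChartedSpace (E n) M] (hφ : IsPartialDiffeo (E n) φ) :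
    IsPartialDiffeo (E n) (scaledChart φ hε) := by
  rw [scaledChart, φ.transHomeomorph_eq_trans]
  exact hφ.trans (isPartialDiffeo_smulOfNeZero _)

theorem isPartialDiffeo_invertedChart [ChartedSpace (E n) N] (hψ : IsPartialDiffeo (E n) ψ) :
    IsPartialDiffeo (E n) (invertedChart ψ hε) :=
  (isPartialDiffeo_scaledChart hε hψ).trans isPartialDiffeo_unitInversion

end RescaledCharts

section GluingMaps

variable {n : ℕ} {M N : Type*} [TopologicalSpace M] [T2Space M] [TopologicalSpace N] [T2Space N]
  {φ : OpenPartialHomeomorph M (E n)} {ψ : OpenPartialHomeomorph N (E n)} {ε : ℝ}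
  (hε : 0 < ε)

section

variable (hφ : φ.target = Metric.ball 0 (2 * ε)) (hψ : ψ.target = Metric.ball 0 (2 * ε))

theorem readsAs_leftIncl [Nonempty (ConnSum φ ψ ε)] :
    ReadsAs (leftIncl hε hφ hψ) (glueChart hε hφ hψ) (scaledChart φ hε) := by
  intro x hx hxk
  have hmem := mt (chartBall_subset_chartClosedBall ·) hx
  have hval : leftIncl hε hφ hψ x = proj φ ψ ε (.inl ⟨x, hmem⟩) := fromLeft_of_notMem hmem
  rw [hval] at hxk ⊢
  exact ⟨(abs_height_inl_lt_iff hε hφ _).1 hxk, rfl⟩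

theorem readsAs_rightIncl [Nonempty (ConnSum φ ψ ε)] :
    ReadsAs (rightIncl hε hφ hψ) (glueChart hε hφ hψ) (invertedChart ψ hε) := by
  intro y hy hyk
  have hyk' : leftIncl hε hψ hφ y ∈ (glueChart hε hψ hφ).source :=
    (abs_height_swap _).symm.trans_lt hyk
  obtain ⟨hyψ, hval⟩ := readsAs_leftIncl hε hψ hφ y hy hyk'
  refine ⟨(mem_invertedChart_source hε).2 ⟨hyψ, fun h0 => hy ⟨hyψ, by simp [h0, hε.le]⟩⟩, ?_⟩
  exact (glueFun_swap _).trans (congrArg (unitInversion (E n)) hval)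

theorem isGluing_glueChart [Nonempty (ConnSum φ ψ ε)] :
    IsGluing (leftIncl hε hφ hψ) (rightIncl hε hφ hψ) (glueChart hε hφ hψ) (scaledChart φ hε)
      (invertedChart ψ hε) where
  disjoint := by
    rw [rightIncl_target]
    exact Set.disjoint_left.2 fun z (hz : 0 < height φ ψ ε z) hz' => hz.not_gt hz'
  cover := mem_leftIncl_or_rightIncl_or_glueChart hε hφ hψ
  readsAs_left := readsAs_leftIncl hε hφ hψ
  readsAs_right := readsAs_rightIncl hε hφ hψ

end

theorem exists_gluingMaps (hn : 0 < n) (hφ : φ.target = Metric.ball 0 (2 * ε))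
    (hψ : ψ.target = Metric.ball 0 (2 * ε)) [ChartedSpace (E n) M]
    [IsManifold 𝓘(ℝ, E n) ∞ M] [ChartedSpace (E n) N] [IsManifold 𝓘(ℝ, E n) ∞ N]
    (hφs : φ ∈ smoothCharts n M) (hψs : ψ ∈ smoothCharts n N) :
    ∃ (_ : ChartedSpace (E n) (ConnSum φ ψ ε)) (_ : IsManifold 𝓘(ℝ, E n) ∞ (ConnSum φ ψ ε))
      (j : GluingMaps φ ψ ε),
      IsGluing j.inM j.inN j.glue (scaledChart φ hε) (invertedChart ψ hε) := by
  have := nonempty_connSum (ψ := ψ) hn hε hφ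
  have hglue := isGluing_glueChart hε hφ hψ
  let : ChartedSpace (E n) (ConnSum φ ψ ε) := chartedSpaceOfCover _ <|
    hglue.exists_mem_combinedAtlas (fun x => ⟨_, chart_mem_atlas (E n) x, mem_chart_source _ x⟩)
      (fun y => ⟨_, chart_mem_atlas (E n) y, mem_chart_source _ y⟩)
  have : IsManifold 𝓘(ℝ, E n) ∞ (ConnSum φ ψ ε) := hglue.isManifold
    (isPartialDiffeo_scaledChart hε (mem_maximalAtlas_iff_isPartialDiffeo.1 hφs))
    (isPartialDiffeo_invertedChart hε (mem_maximalAtlas_iff_isPartialDiffeo.1 hψs)) rfl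
  have hleft : IsPartialDiffeo (E n) (leftIncl hε hφ hψ) :=
    isPartialDiffeo_of_symm_trans_mem fun e he =>
      IsManifold.subset_maximalAtlas (.inl (.inl ⟨e, he, rfl⟩))
  have hright : IsPartialDiffeo (E n) (rightIncl hε hφ hψ) :=
    isPartialDiffeo_of_symm_trans_mem fun e he =>
      IsManifold.subset_maximalAtlas (.inl (.inr ⟨e, he, rfl⟩))
  refine ⟨inferInstance, inferInstance,
    { inM := leftIncl hε hφ hψ
      inM_source := rfl
      inM_apply := fun x _ => fromLeft_coe x
      inM_smooth := hleft.smooth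
      inM_symm_smooth := hleft.smooth_symm
      inN := rightIncl hε hφ hψ
      inN_source := rfl
      inN_apply := fun y _ => congrArg (swap ψ φ ε) (fromLeft_coe y)
      inN_smooth := hright.smooth
      inN_symm_smooth := hright.smooth_symm
      glue := glueChart hε hφ hψ
      glue_source := setOf_abs_height_lt hε hφ hψ
      glue_apply := fun _ _ => rfl
      glue_target := rfl
      glue_mem := IsManifold.subset_maximalAtlas (.inr rfl) }, hglue⟩

end GluingMaps

/-! ### Diffeomorphisms of a vector space with a prescribed germ -/

section VectorSpaceDiffeo

variable {V : Type*} [NormedAddCommGroup V] [NormedSpace ℝ V]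

variable (V) in
/-- The group of the permutations of `V` that are diffeomorphisms. -/
def diffeos : Subgroup (Equiv.Perm V) where
  carrier := {f | ContDiff ℝ ∞ f ∧ ContDiff ℝ ∞ f.symm}
  one_mem' := ⟨contDiff_id, contDiff_id⟩
  mul_mem' hf hh := ⟨hf.1.comp hh.1, hh.2.comp hf.2⟩
  inv_mem' hf := ⟨hf.2, hf.1⟩

theorem approximatesLinearOn_id_add {u : V → V} {c : NNReal} (hl : LipschitzWith c u) :
    ApproximatesLinearOn (fun x => x + u x) (.id ℝ V) Set.univ c := by
  intro x _ y _
  have h := hl.dist_le_mul x y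
  rw [dist_eq_norm, dist_eq_norm] at h
  rwa [ContinuousLinearMap.id_apply, show x + u x - (y + u y) - (x - y) = u x - u y by abel]

theorem subsingleton_or_lt_inv_nnnorm_id {c : NNReal} (hc : c < 1) :
    Subsingleton V ∨ c < ‖ContinuousLinearMap.id ℝ V‖₊⁻¹ := by
  rcases subsingleton_or_nontrivial V with h | h
  · exact .inl h
  · have hnorm : ‖ContinuousLinearMap.id ℝ V‖₊ = 1 := NNReal.eq ContinuousLinearMap.norm_id
    exact .inr (by rwa [hnorm, inv_one])

theorem exists_hasFDerivAt_equiv_id_add [CompleteSpace V] {u : V → V} {c : NNReal} (hc : c < 1)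
    (hl : LipschitzWith c u) {x : V} (hu : DifferentiableAt ℝ u x) :
    ∃ A : V ≃L[ℝ] V, HasFDerivAt (fun x => x + u x) (A : V →L[ℝ] V) x := by
  have hdu : ‖-fderiv ℝ u x‖ < 1 := by
    rw [norm_neg]
    exact (norm_fderiv_le_of_lipschitz ℝ hl).trans_lt (by exact_mod_cast hc)
  refine ⟨ContinuousLinearEquiv.unitsEquiv ℝ V (Units.oneSub _ hdu), ?_⟩
  have hsum : HasFDerivAt (fun x => x + u x) (.id ℝ V + fderiv ℝ u x) x :=
    (hasFDerivAt_id x).add hu.hasFDerivAt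
  have hunit : (ContinuousLinearEquiv.unitsEquiv ℝ V (Units.oneSub _ hdu) : V →L[ℝ] V) =
      .id ℝ V + fderiv ℝ u x := by
    ext1 v
    change (1 - -fderiv ℝ u x) v = _
    simp
  rwa [hunit]

theorem exists_mem_diffeos_id_add [CompleteSpace V] {u : V → V} (hu : ContDiff ℝ ∞ u)
    {c : NNReal} (hc : c < 1) (hl : LipschitzWith c u) : ∃ f ∈ diffeos V, ∀ x, f x = x + u x := by
  have happ : ApproximatesLinearOn (fun x => x + u x)
      ((ContinuousLinearEquiv.refl ℝ V : V ≃L[ℝ] V) : V →L[ℝ] V) Set.univ c :=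
    approximatesLinearOn_id_add hl
  let H := happ.toHomeomorph _ (subsingleton_or_lt_inv_nnnorm_id hc)
  have hH : ContDiff ℝ ∞ H := contDiff_id.add hu
  refine ⟨H.toEquiv, ⟨hH, contDiff_iff_contDiffAt.2 fun y => ?_⟩, fun x => rfl⟩
  obtain ⟨A, hA⟩ := exists_hasFDerivAt_equiv_id_add hc hl
    (hu.differentiable (by simp) (H.symm y))
  exact H.toOpenPartialHomeomorph.contDiffAt_symm (Set.mem_univ y) hA hH.contDiffAt

theorem lipschitzWith_smul_of_lipschitzOnWith {η : V → ℝ} {w : V → V} {L δ r : NNReal}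
    (hη : LipschitzWith L η) (hη1 : ∀ x, ‖η x‖ ≤ 1) (hη0 : ∀ x, r ≤ ‖x‖ → η x = 0)
    (hw : LipschitzOnWith δ w (Metric.closedBall 0 r)) (hw0 : w 0 = 0) :
    LipschitzWith (L * (δ * r) + δ) fun x => η x • w x := by
  have hnear : ∀ x y : V, ‖x‖ ≤ r →
      dist (η x • w x) (η y • w y) ≤ (L * (δ * r) + δ) * dist x y := by
    intro x y hx
    have hwx : ‖w x‖ ≤ δ * r := by
      have h := hw.dist_le_mul x (by simpa using hx) 0 (by simp)
      rw [hw0, dist_zero_right, dist_zero_right] at h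
      exact h.trans (by gcongr)
    have hvar : ‖(η x - η y) • w x‖ ≤ L * dist x y * (δ * r) := by
      rw [norm_smul]
      exact mul_le_mul (hη.dist_le_mul x y) hwx (norm_nonneg _) (by positivity)
    have hrest : ‖η y • (w x - w y)‖ ≤ δ * dist x y := by
      rcases le_total ‖y‖ r with hy | hy
      · rw [norm_smul, ← dist_eq_norm]
        exact (mul_le_of_le_one_left dist_nonneg (hη1 y)).trans
          (hw.dist_le_mul x (by simpa using hx) y (by simpa using hy))
      · rw [hη0 y hy, zero_smul, norm_zero]
        positivity
    calc dist (η x • w x) (η y • w y)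
        = ‖(η x - η y) • w x + η y • (w x - w y)‖ := by rw [dist_eq_norm]; congr 1; module
      _ ≤ L * dist x y * (δ * r) + δ * dist x y := norm_add_le_of_le hvar hrest
      _ = (L * (δ * r) + δ) * dist x y := by ring
  refine LipschitzWith.of_dist_le_mul fun x y => ?_
  push_cast
  rcases le_total ‖x‖ r with hx | hx
  · exact hnear x y hx
  rcases le_total ‖y‖ r with hy | hy
  · rw [dist_comm, dist_comm x y]
    exact hnear y x hy
  · rw [hη0 x hx, hη0 y hy, zero_smul, zero_smul, dist_self]
    positivity

theorem pow_apply_of_smul {f : Equiv.Perm V} {a s : ℝ} (hs : 1 < s)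
    (hf : ∀ x, ‖x‖ ≤ a → f x = s • x) (j : ℕ) {x : V} (hx : s ^ j * ‖x‖ ≤ a) :
    (f ^ j) x = s ^ j • x := by
  induction j with
  | zero => simp
  | succ j ih =>
    have hle : s ^ j * ‖x‖ ≤ a := hx.trans' (by gcongr; exacts [hs.le, j.le_succ])
    rw [pow_succ', Equiv.Perm.mul_apply, ih hle, hf, smul_smul, pow_succ']
    rwa [norm_smul, Real.norm_of_nonneg (by positivity)]

variable [FiniteDimensional ℝ V]

variable (V) in
theorem exists_bump_lipschitzWith : ∃ C : NNReal, ∀ r : NNReal, 0 < r → ∃ η : V → ℝ,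
    ContDiff ℝ ∞ η ∧ LipschitzWith (C / r) η ∧ (∀ x, ‖η x‖ ≤ 1) ∧
      (∀ x, ‖x‖ ≤ r / 2 → η x = 1) ∧ ∀ x, r ≤ ‖x‖ → η x = 0 := by
  let b : ContDiffBump (0 : V) := ⟨1 / 2, 1, by norm_num, by norm_num⟩
  obtain ⟨C, hC⟩ := ContDiff.lipschitzWith_of_hasCompactSupport b.hasCompactSupport
    (b.contDiff (n := ⊤)) (by simp)
  refine ⟨C, fun r hr => ⟨fun x => b ((r : ℝ)⁻¹ • x),
    b.contDiff.comp (contDiff_const_smul _), ?_, fun x => ?_, fun x hx => ?_, fun x hx => ?_⟩⟩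
  · refine LipschitzWith.of_dist_le_mul fun x y => (hC.dist_le_mul _ _).trans_eq ?_
    rw [dist_smul₀, norm_inv, NNReal.norm_eq, NNReal.coe_div, div_eq_mul_inv, mul_assoc]
  · rw [Real.norm_of_nonneg b.nonneg]
    exact b.le_one
  · refine b.one_of_mem_closedBall ?_
    rw [mem_closedBall_zero_iff, norm_smul, norm_inv, NNReal.norm_eq, ← div_eq_inv_mul,
      div_le_iff₀ (by exact_mod_cast hr)]
    exact hx.trans_eq (by ring)
  · refine b.zero_of_le_dist ?_
    rw [dist_zero_right, norm_smul, norm_inv, NNReal.norm_eq, ← div_eq_inv_mul]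
    exact (one_le_div (by exact_mod_cast hr)).2 hx

theorem exists_mem_diffeos_dilation {a b : ℝ} (ha : 0 < a) (hab : a < b) :
    ∃ s : ℝ, 1 < s ∧ ∃ f ∈ diffeos V, (∀ x, ‖x‖ ≤ a → f x = s • x) ∧ ∀ x, b ≤ ‖x‖ → f x = x := by
  let η : ContDiffBump (0 : V) := ⟨a, b, ha, hab⟩
  have hu : ContDiff ℝ ∞ fun x : V => η x • x := η.contDiff.smul contDiff_id
  obtain ⟨C, hC⟩ := ContDiff.lipschitzWith_of_hasCompactSupport η.hasCompactSupport.smul_right hu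
    (by simp)
  let t : NNReal := (C + 1)⁻¹
  have ht : 0 < t := by positivity
  have hl : LipschitzWith (t * C) fun x : V => (t : ℝ) • η x • x := by
    refine LipschitzWith.of_dist_le_mul fun x y => ?_
    rw [dist_smul₀, NNReal.norm_eq, NNReal.coe_mul, mul_assoc]
    gcongr
    exact LipschitzWith.dist_le_mul hC x y
  have htC : t * C < 1 := by
    rw [inv_mul_lt_iff₀ (by positivity), mul_one]
    exact lt_add_one C
  obtain ⟨f, hf, hfx⟩ := exists_mem_diffeos_id_add (hu.const_smul (t : ℝ)) htC hl
  refine ⟨1 + t, lt_add_of_pos_right 1 ht, f, hf, fun x hx => ?_, fun x hx => ?_⟩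
  · rw [hfx, η.one_of_mem_closedBall (by simpa using hx), one_smul, add_smul, one_smul]
  · rw [hfx, η.zero_of_le_dist (by simpa using hx), zero_smul, smul_zero, add_zero]

theorem exists_mem_diffeos_extending_germ {k : V → V} {U : Set V} (hU : IsOpen U)
    (h0 : (0 : V) ∈ U) (hk : ContDiffOn ℝ ∞ k U) (hk0 : k 0 = 0)
    (hdk : HasFDerivAt k (.id ℝ V) 0) {R : ℝ} (hR : 0 < R) :
    ∃ f ∈ diffeos V, f =ᶠ[𝓝 0] k ∧ ∀ x, R ≤ ‖x‖ → f x = x := by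
  obtain ⟨C, hC⟩ := exists_bump_lipschitzWith V
  let δ : NNReal := (2 * (C + 1))⁻¹
  have hδ : 0 < δ := by positivity
  have hstrict : HasStrictFDerivAt (fun x => k x - x) (0 : V →L[ℝ] V) 0 := by
    have hsub := ((hk.contDiffAt (hU.mem_nhds h0)).hasStrictFDerivAt' hdk (by simp)).sub
      (hasStrictFDerivAt_id (0 : V))
    rwa [sub_self] at hsub
  obtain ⟨W, hW, hlip⟩ := hstrict.exists_lipschitzOnWith_of_nnnorm_lt δ (by simpa using hδ)
  obtain ⟨r, hr, hrR, hball⟩ : ∃ r : NNReal, 0 < r ∧ r ≤ R ∧ Metric.closedBall 0 r ⊆ W ∩ U := by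
    obtain ⟨r, hr, hball⟩ := Metric.nhds_basis_closedBall.mem_iff.1
      (Filter.inter_mem hW (hU.mem_nhds h0))
    exact ⟨⟨min r R, (lt_min hr hR).le⟩, lt_min hr hR, min_le_right _ _,
      (Metric.closedBall_subset_closedBall (min_le_left _ _)).trans hball⟩
  obtain ⟨η, hη, hηlip, hηle, hη1, hη0⟩ := hC r hr
  have hsmooth : ContDiff ℝ ∞ fun x => η x • (k x - x) := by
    refine contDiff_iff_contDiffAt.2 fun x => ?_
    rcases le_or_gt ‖x‖ r with hx | hx
    · exact hη.contDiffAt.smul ((hk.contDiffAt (hU.mem_nhds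
        (hball (mem_closedBall_zero_iff.2 hx)).2)).sub contDiffAt_id)
    · refine contDiffAt_const.congr_of_eventuallyEq (f := fun _ => 0) ?_
      filter_upwards [(isOpen_lt continuous_const continuous_norm).mem_nhds hx] with y hy
      rw [hη0 y (le_of_lt hy), zero_smul]
  have hhalf : C / r * (δ * r) + δ = 1 / 2 := by
    simp only [δ]
    field_simp
  have hl := lipschitzWith_smul_of_lipschitzOnWith hηlip hηle hη0
    (hlip.mono (hball.trans Set.inter_subset_left)) (by rw [hk0, sub_zero])
  obtain ⟨f, hf, hfx⟩ := exists_mem_diffeos_id_add hsmooth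
    (hhalf.trans_lt (NNReal.half_lt_self one_ne_zero)) hl
  refine ⟨f, hf, ?_, fun x hx => by rw [hfx, hη0 x (hrR.trans hx), zero_smul, add_zero]⟩
  filter_upwards [Metric.closedBall_mem_nhds (0 : V) (half_pos (NNReal.coe_pos.2 hr))] with x hx
  rw [hfx, hη1 x (mem_closedBall_zero_iff.1 hx), one_smul, add_sub_cancel]

/-- The diffeomorphism is inverse to `S ^ j * K` with an extension `K` of the germ and a dilation
`S`, whose powers shrink the ball of radius `a` into the region where `K` agrees with the germ. -/
theorem exists_mem_diffeos_linearizing {k : V → V} {U : Set V} (hU : IsOpen U)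
    (h0 : (0 : V) ∈ U) (hk : ContDiffOn ℝ ∞ k U) (hk0 : k 0 = 0)
    (hdk : HasFDerivAt k (.id ℝ V) 0) {a b : ℝ} (ha : 0 < a) (hab : a < b) :
    ∃ c > (0 : ℝ), ∃ f ∈ diffeos V, (∀ x, b ≤ ‖x‖ → f x = x) ∧
      ∀ y, ‖y‖ < a → f y ∈ U ∧ y = c • k (f y) := by
  obtain ⟨s, hs, S, hS, hSa, hSb⟩ := exists_mem_diffeos_dilation (V := V) ha hab
  obtain ⟨K, hK, hKk, hKb⟩ := exists_mem_diffeos_extending_germ hU h0 hk hk0 hdk (ha.trans hab)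
  have hK0 : K.symm 0 = 0 := by rw [Equiv.symm_apply_eq, hKk.self_of_nhds, hk0]
  have hcont : Filter.Tendsto K.symm (𝓝 0) (𝓝 0) := by
    simpa only [hK0] using hK.2.continuous.tendsto 0
  have hgood : ∀ᶠ x in 𝓝 (0 : V), K.symm x ∈ U ∧ K (K.symm x) = k (K.symm x) :=
    hcont.eventually ((hU.eventually_mem h0).and hKk)
  obtain ⟨d, hd, hball⟩ := Metric.eventually_nhds_iff_ball.1 hgood
  obtain ⟨j, hj⟩ := pow_unbounded_of_one_lt (a / d) hs
  have hsj : 0 < s ^ j := by positivity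
  refine ⟨s ^ j, hsj, (S ^ j * K)⁻¹, inv_mem (mul_mem (pow_mem hS j) hK), fun x hx => ?_,
    fun y hy => ?_⟩
  · rw [Equiv.Perm.inv_eq_iff_eq, Equiv.Perm.mul_apply, hKb x hx,
      Equiv.Perm.pow_apply_eq_self_of_apply_eq_self (hSb x hx)]
  · have hy' : ‖(s ^ j)⁻¹ • y‖ = ‖y‖ / s ^ j := by
      rw [norm_smul, Real.norm_of_nonneg (by positivity), ← div_eq_inv_mul]
    have hSj : (S ^ j)⁻¹ y = (s ^ j)⁻¹ • y := by
      rw [Equiv.Perm.inv_eq_iff_eq, pow_apply_of_smul hs hSa, smul_inv_smul₀ hsj.ne']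
      rw [hy', mul_div_cancel₀ _ hsj.ne']
      exact hy.le
    have hmem : (s ^ j)⁻¹ • y ∈ Metric.ball (0 : V) d := by
      rw [mem_ball_zero_iff, hy', div_lt_comm₀ hsj hd]
      exact (div_lt_div_of_pos_right hy hd).trans hj
    obtain ⟨hmemU, hKeq⟩ := hball _ hmem
    rw [mul_inv_rev, Equiv.Perm.mul_apply, hSj]
    exact ⟨hmemU, by
      rw [Equiv.Perm.inv_def, ← hKeq, Equiv.apply_symm_apply, smul_inv_smul₀ hsj.ne']⟩

end VectorSpaceDiffeo

/-! ### Making a chart conformal and Möbius compatible -/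

section Extension

section

variable {M V : Type*} [TopologicalSpace M] [TopologicalSpace V] {φ : OpenPartialHomeomorph M V}

/-- The map that reads `f` in the chart `φ`, extended by the identity. -/
noncomputable def extendById (φ : OpenPartialHomeomorph M V) (f : V → V) : M → M :=
  open Classical in φ.source.piecewise (φ.symm ∘ f ∘ φ) id

theorem extendById_of_mem {f : V → V} {x : M} (hx : x ∈ φ.source) :
    extendById φ f x = φ.symm (f (φ x)) := by
  classical exact Set.piecewise_eq_of_mem _ _ _ hx

theorem extendById_of_notMem {f : V → V} {x : M} (hx : x ∉ φ.source) : extendById φ f x = x := by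
  classical exact Set.piecewise_eq_of_notMem _ _ _ hx

theorem apply_mem_of_forall_notMem_fixed {α : Type*} {f : Equiv.Perm α} {s : Set α}
    (hf : ∀ y ∉ s, f y = y) {y : α} (hy : y ∈ s) : f y ∈ s := by
  by_contra h
  exact h (by rwa [f.injective (hf _ h)])

theorem extendById_symm_extendById {f : Equiv.Perm V} (hf : ∀ y ∉ φ.target, f y = y) (x : M) :
    extendById φ f.symm (extendById φ f x) = x := by
  by_cases hx : x ∈ φ.source
  · have hfx : f (φ x) ∈ φ.target := apply_mem_of_forall_notMem_fixed hf (φ.map_source hx)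
    rw [extendById_of_mem hx, extendById_of_mem (φ.map_target hfx), φ.right_inv hfx,
      Equiv.symm_apply_apply, φ.left_inv hx]
  · rw [extendById_of_notMem hx, extendById_of_notMem hx]

theorem extendById_eventuallyEq_id [T2Space M] {K : Set V} (hK : IsCompact K)
    (hKφ : K ⊆ φ.target) {f : V → V} (hf : ∀ y ∉ K, f y = y) {x : M} (hx : x ∉ φ.source) :
    extendById φ f =ᶠ[𝓝 x] id := by
  have hclosed : IsClosed (φ.symm '' K) :=
    (hK.image_of_continuousOn (φ.continuousOn_symm.mono hKφ)).isClosed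
  have hxK : x ∉ φ.symm '' K := by
    rintro ⟨y, hy, rfl⟩
    exact hx (φ.map_target (hKφ hy))
  filter_upwards [hclosed.isOpen_compl.mem_nhds hxK] with z hz
  by_cases hzφ : z ∈ φ.source
  · have hzK : φ z ∉ K := fun h => hz ⟨φ z, h, φ.left_inv hzφ⟩
    rw [extendById_of_mem hzφ, hf _ hzK, φ.left_inv hzφ, id]
  · exact extendById_of_notMem hzφ

end

variable {V : Type*} [NormedAddCommGroup V] [NormedSpace ℝ V] {M : Type*} [TopologicalSpace M]
  [T2Space M] {φ : OpenPartialHomeomorph M V} {K : Set V} (hK : IsCompact K) (hKφ : K ⊆ φ.target)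
  [ChartedSpace V M]

include hK hKφ in
theorem contMDiff_extendById (hφ : IsPartialDiffeo V φ) {f : Equiv.Perm V} (hfs : ContDiff ℝ ∞ f)
    (hf : ∀ y ∉ K, f y = y) : ContMDiff 𝓘(ℝ, V) 𝓘(ℝ, V) ∞ (extendById φ f) := by
  intro x
  by_cases hx : x ∈ φ.source
  · have hfx : f (φ x) ∈ φ.target := apply_mem_of_forall_notMem_fixed
      (fun y hy => hf y fun h => hy (hKφ h)) (φ.map_source hx)
    have hconj : ContMDiffAt 𝓘(ℝ, V) 𝓘(ℝ, V) ∞ (fun z => φ.symm (f (φ z))) x :=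
      ContMDiffAt.comp x (g := φ.symm) (hφ.symm.contMDiffAt hfx)
        (hfs.contMDiff.contMDiffAt.comp x (hφ.contMDiffAt hx))
    refine hconj.congr_of_eventuallyEq ?_
    filter_upwards [φ.open_source.mem_nhds hx] with z hz using extendById_of_mem hz
  · exact contMDiffAt_id.congr_of_eventuallyEq (extendById_eventuallyEq_id hK hKφ hf hx)

include hK hKφ in
theorem exists_isPartialDiffeo_extending (hφ : IsPartialDiffeo V φ) {f : Equiv.Perm V}
    (hfs : f ∈ diffeos V) (hf : ∀ y ∉ K, f y = y) :
    ∃ F : M ≃ₜ M, IsPartialDiffeo V F.toOpenPartialHomeomorph ∧ (∀ x ∉ φ.source, F =ᶠ[𝓝 x] id) ∧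
      ∀ x ∈ φ.source, F x = φ.symm (f (φ x)) := by
  have hf' : ∀ y ∉ K, f.symm y = y := fun y hy => (f.symm_apply_eq).2 (hf y hy).symm
  have hsmooth := contMDiff_extendById hK hKφ hφ hfs.1 hf
  have hsmooth' := contMDiff_extendById hK hKφ hφ hfs.2 hf'
  let F : M ≃ₜ M :=
    { toFun := extendById φ f
      invFun := extendById φ f.symm
      left_inv := extendById_symm_extendById fun y hy => hf y fun h => hy (hKφ h)
      right_inv := extendById_symm_extendById (f := f.symm) fun y hy => hf' y fun h => hy (hKφ h)
      continuous_toFun := hsmooth.continuous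
      continuous_invFun := hsmooth'.continuous }
  exact ⟨F, ⟨hsmooth.contMDiffOn, hsmooth'.contMDiffOn⟩,
    fun x hx => extendById_eventuallyEq_id hK hKφ hf hx, fun x hx => extendById_of_mem hx⟩

end Extension

section Linearization

variable {V : Type*} [NormedAddCommGroup V] [InnerProductSpace ℝ V]

theorem exists_similarity_leftInverse [FiniteDimensional ℝ V] {D : V →L[ℝ] V} {d : ℝ} (hd : 0 < d)
    (hD : ∀ v w, inner ℝ (D v) (D w) = d * inner ℝ v w) :
    ∃ c > (0 : ℝ), ∃ A : V ≃ₗᵢ[ℝ] V, ∀ v, c • A (D v) = v := by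
  have hsd : √d ≠ 0 := (Real.sqrt_pos.2 hd).ne'
  let B : V →ₗᵢ[ℝ] V := LinearMap.isometryOfInner ((√d)⁻¹ • (D : V →ₗ[ℝ] V)) fun v w => by
    simp only [LinearMap.smul_apply, ContinuousLinearMap.coe_coe, real_inner_smul_left,
      real_inner_smul_right, hD]
    rw [← mul_assoc, ← mul_assoc, ← mul_inv, Real.mul_self_sqrt hd.le, inv_mul_cancel₀ hd.ne',
      one_mul]
  refine ⟨(√d)⁻¹, by positivity, (B.toLinearIsometryEquiv rfl).symm, fun v => ?_⟩
  have hDv : D v = √d • B.toLinearIsometryEquiv rfl v := (smul_inv_smul₀ hsd (D v)).symm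
  rw [hDv, map_smul, LinearIsometryEquiv.symm_apply_apply, inv_smul_smul₀ hsd]

theorem exists_similarity_hasFDerivAt_id [FiniteDimensional ℝ V] {t : V → V} {y : V}
    (ht : DifferentiableAt ℝ t y) (hty : ConformalAt (euclideanForm V) t y) :
    ∃ c > (0 : ℝ), ∃ A : V ≃ₗᵢ[ℝ] V,
      HasFDerivAt (fun z => similarity c A (t y) (t z)) (.id ℝ V) y := by
  obtain ⟨d, hd, htd⟩ := hty
  rw [tderiv_eq_fderiv] at htd
  obtain ⟨c, hc, A, hA⟩ := exists_similarity_leftInverse (inv_pos.2 hd) (D := fderiv ℝ t y)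
    fun v w => by rw [eq_inv_mul_iff_mul_eq₀ hd.ne', ← htd, euclideanForm_apply]
  refine ⟨c, hc, A, ?_⟩
  have hcomp := (hasFDerivAt_similarity c A (t y) (t y)).comp y ht.hasFDerivAt
  rwa [show (c • (A : V →L[ℝ] V)) ∘L fderiv ℝ t y = .id ℝ V from
    ContinuousLinearMap.ext hA] at hcomp

variable {M : Type*} [TopologicalSpace M] [ChartedSpace V M] {φ e : OpenPartialHomeomorph M V}

theorem IsPartialDiffeo.contDiffAt_transition (he : IsPartialDiffeo V e)
    (hφ : IsPartialDiffeo V φ) {y : V} (hy : y ∈ φ.target) (hye : φ.symm y ∈ e.source) :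
    ContDiffAt ℝ ∞ (fun z => e (φ.symm z)) y :=
  contMDiffAt_iff_contDiffAt.1
    (ContMDiffAt.comp y (g := e) (he.contMDiffAt hye) (hφ.symm.contMDiffAt hy))

theorem ConformalAt.transition {G : FormField V M} {y : V} (hφ : IsPartialDiffeo V φ)
    (he : IsPartialDiffeo V e) (hy : y ∈ φ.target) (hye : φ.symm y ∈ e.source)
    (hGφ : ConformalAt G φ (φ.symm y)) (hGe : ConformalAt G e (φ.symm y)) :
    ConformalAt (euclideanForm V) (fun z => e (φ.symm z)) y := by
  obtain ⟨c, hc, hcφ⟩ := hGφ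
  obtain ⟨d, hd, hde⟩ := hGe
  refine ⟨c⁻¹ * d, by positivity, fun v w => ?_⟩
  have hφv : ∀ v, tderiv φ (φ.symm y) (tderiv φ.symm y v) = v := hφ.symm.tderiv_symm_apply hy
  rw [tderiv_comp (he.mdifferentiableAt hye) (hφ.symm.mdifferentiableAt hy), mul_assoc,
    ContinuousLinearMap.comp_apply, ContinuousLinearMap.comp_apply, ← hde, hcφ, hφv, hφv,
    inv_mul_cancel_left₀ hc.ne', euclideanForm_apply]

theorem exists_linearizing_diffeo [FiniteDimensional ℝ V] [T2Space M] {a r : ℝ} (ha : 0 < a)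
    (har : a < r) (hφ : IsPartialDiffeo V φ) (hφr : φ.target = Metric.ball 0 r)
    (he : IsPartialDiffeo V e) (h0e : φ.symm 0 ∈ e.source) {G : FormField V M}
    (hGφ : ConformalAt G φ (φ.symm 0)) (hGe : ConformalAt G e (φ.symm 0)) :
    ∃ F : M ≃ₜ M, IsPartialDiffeo V F.toOpenPartialHomeomorph ∧ (∀ x ∉ φ.source, F =ᶠ[𝓝 x] id) ∧
      ∃ c > (0 : ℝ), ∃ A y₀, ∀ x ∈ φ.source, ‖φ x‖ < a →
        F x ∈ e.source ∧ φ x = similarity c A y₀ (e (F x)) := by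
  have h0 : (0 : V) ∈ φ.target := by simpa [hφr] using ha.trans har
  have htrans {y : V} := he.contDiffAt_transition hφ (y := y)
  obtain ⟨c₁, hc₁, A, hk⟩ := exists_similarity_hasFDerivAt_id
    ((htrans h0 h0e).differentiableAt (by simp)) (hGφ.transition hφ he h0 h0e hGe)
  have hks : ContDiffOn ℝ ∞ (fun z => similarity c₁ A (e (φ.symm 0)) (e (φ.symm z)))
      (φ.target ∩ φ.symm ⁻¹' e.source) := fun y hy =>
    ((contDiff_similarity c₁ A _).contDiffAt.comp y (htrans hy.1 hy.2)).contDiffWithinAt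
  obtain ⟨b, hab, hbr⟩ := exists_between har
  obtain ⟨c, hc, f, hf, hfb, hfa⟩ := exists_mem_diffeos_linearizing
    (φ.isOpen_inter_preimage_symm e.open_source) ⟨h0, h0e⟩ hks (by simp [similarity]) hk ha hab
  obtain ⟨F, hF, hFid, hFφ⟩ := exists_isPartialDiffeo_extending (isCompact_closedBall 0 b)
    (hφr ▸ Metric.closedBall_subset_ball hbr) hφ hf
    fun y hy => hfb y (by simpa using (not_le.1 (mt mem_closedBall_zero_iff.2 hy)).le)
  refine ⟨F, hF, hFid, c * c₁, by positivity, A, e (φ.symm 0), fun x hx hxa => ?_⟩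
  obtain ⟨hmem, heq⟩ := hfa _ hxa
  rw [hFφ x hx]
  exact ⟨hmem.2, heq.trans (smul_smul _ _ _)⟩

end Linearization

section Deformation

variable {n : ℕ} {M : Type*} [TopologicalSpace M] [ChartedSpace (E n) M]
  [IsManifold 𝓘(ℝ, E n) ∞ M]

/-- The pullback of a Riemannian metric by a diffeomorphism. -/
noncomputable def pullbackMetric {X : Type*} [TopologicalSpace X] [ChartedSpace (E n) X]
    [IsManifold 𝓘(ℝ, E n) ∞ X] (g : RMetric n M) (F : X ≃ₜ M)
    (hF : IsPartialDiffeo (E n) F.toOpenPartialHomeomorph) : RMetric n X :=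
  metricOfForm (pullbackForm F (metricForm g)) (fun _ _ _ => metricForm_symm g _ _ _)
    (fun x _ hv => metricForm_pos g _ (hF.tderiv_ne_zero (Set.mem_univ x) hv))
    (fun x => (smoothFormAt_metricForm g (F x)).pullbackForm (hF.contMDiffAt (Set.mem_univ x)))

theorem metricForm_pullbackMetric {X : Type*} [TopologicalSpace X] [ChartedSpace (E n) X]
    [IsManifold 𝓘(ℝ, E n) ∞ X] (g : RMetric n M) (F : X ≃ₜ M)
    (hF : IsPartialDiffeo (E n) F.toOpenPartialHomeomorph) :
    metricForm (pullbackMetric g F hF) = pullbackForm F (metricForm g) := rfl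

theorem isConformalChart_pullbackMetric {X : Type*} [TopologicalSpace X] [ChartedSpace (E n) X]
    [IsManifold 𝓘(ℝ, E n) ∞ X] {g : RMetric n M} {F : X ≃ₜ M}
    (hF : IsPartialDiffeo (E n) F.toOpenPartialHomeomorph) {e : OpenPartialHomeomorph M (E n)}
    (he : IsConformalChart g e) :
    IsConformalChart (pullbackMetric g F hF) (F.toOpenPartialHomeomorph ≫ₕ e) := by
  rw [isConformalChart_iff] at he ⊢
  refine ⟨hF.trans he.1, fun x hx => ?_⟩
  rw [OpenPartialHomeomorph.trans_source] at hx
  exact (he.2 _ hx.2).pullbackForm (he.1.mdifferentiableAt hx.2) (hF.mdifferentiableAt hx.1)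

theorem exists_conformal_deformation [T2Space M] {g : RMetric n M} {a r : ℝ} (ha : 0 < a)
    (har : a < r) {φ e : OpenPartialHomeomorph M (E n)} (hφ : IsPartialDiffeo (E n) φ)
    (hφr : φ.target = Metric.ball 0 r) (hgφ : ConformalAt (metricForm g) φ (φ.symm 0))
    (he : IsConformalChart g e) (h0e : φ.symm 0 ∈ e.source) :
    ∃ (F : M ≃ₜ M) (hF : IsPartialDiffeo (E n) F.toOpenPartialHomeomorph),
      (∀ x ∉ φ.source, F =ᶠ[𝓝 x] id) ∧
      ∀ x ∈ φ.source, ‖φ x‖ < a → F x ∈ e.source ∧ MobiusAt (fun z => e (F z)) φ x ∧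
        ConformalAt (metricForm (pullbackMetric g F hF)) φ x := by
  obtain ⟨hes, hec⟩ := isConformalChart_iff.1 he
  obtain ⟨F, hF, hFid, c, hc, A, y₀, hFe⟩ :=
    exists_linearizing_diffeo ha har hφ hφr hes h0e hgφ (hec _ h0e)
  refine ⟨F, hF, hFid, fun x hx hxa => ?_⟩
  have hFx : F x ∈ e.source := (hFe x hx hxa).1
  have hφe : φ =ᶠ[𝓝 x] fun z => similarity c A y₀ (e (F z)) := by
    filter_upwards [(isOpen_chartBall φ a).mem_nhds ⟨hx, hxa⟩] with z hz
    exact (hFe z hz.1 hz.2).2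
  have hconf : ConformalAt (pullbackForm F (metricForm g)) (fun z => e (F z)) x :=
    (hec _ hFx).pullbackForm (hes.mdifferentiableAt hFx) (hF.mdifferentiableAt (Set.mem_univ x))
  exact ⟨hFx, (mobiusAt_similarity hc A y₀ _ x).congr .rfl hφe,
    (hconf.similarity ((hF.trans hes).mdifferentiableAt (by simpa using hFx)) hc.ne' A y₀).congr
      hφe⟩

end Deformation

/-! ### Atlases of the connected sum -/

section Orientation

theorem mul_pos_of_mul_mul_mul_pos {a b c : ℝ} (h : 0 < a * b * (b * c)) : 0 < a * c :=
  pos_of_mul_pos_left (b := b ^ 2) (by linear_combination h) (sq_nonneg b)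

variable {V : Type*} [NormedAddCommGroup V] [NormedSpace ℝ V] {X : Type*} [TopologicalSpace X]
  [ChartedSpace V X]

theorem SameOrientationAt.trans {e e' e'' : X → V} {x : X}
    (h₁ : SameOrientationAt e e' x) (h₂ : SameOrientationAt e' e'' x) :
    SameOrientationAt e e'' x :=
  mul_pos_of_mul_mul_mul_pos (mul_pos h₁ h₂)

/-- The charts `e` and `e'` induce opposite orientations of the tangent space at `x`. -/
def OppositeOrientationAt (e e' : X → V) (x : X) : Prop :=
  (tderiv (V := V) e x).det * (tderiv (V := V) e' x).det < 0

theorem OppositeOrientationAt.trans {e e' e'' : X → V} {x : X} (h : OppositeOrientationAt e e' x)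
    (h' : OppositeOrientationAt e' e'' x) : SameOrientationAt e e'' x :=
  mul_pos_of_mul_mul_mul_pos (mul_pos_of_neg_of_neg h h')

theorem SameOrientationAt.trans_opposite {e e' e'' : X → V} {x : X} (h : SameOrientationAt e e' x)
    (h' : OppositeOrientationAt e' e'' x) : OppositeOrientationAt e e'' x := by
  rw [OppositeOrientationAt, ← neg_pos, ← mul_neg] at h' ⊢
  exact mul_pos_of_mul_mul_mul_pos (mul_pos h h')

variable {T : V → V} {e : OpenPartialHomeomorph X V} {x : X}

theorem IsPartialDiffeo.det_mul_det_comp (he : IsPartialDiffeo V e) (hx : x ∈ e.source)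
    (hT : DifferentiableAt ℝ T (e x)) :
    (tderiv (V := V) e x).det * (tderiv (V := V) (fun z => T (e z)) x).det =
      (fderiv ℝ T (e x)).det * (tderiv (V := V) e x).det ^ 2 := by
  rw [tderiv_comp hT.mdifferentiableAt (he.mdifferentiableAt hx), det_comp, tderiv_eq_fderiv]
  ring

theorem IsPartialDiffeo.sameOrientationAt_comp (he : IsPartialDiffeo V e) (hx : x ∈ e.source)
    (hT : DifferentiableAt ℝ T (e x)) (hdet : 0 < (fderiv ℝ T (e x)).det) :
    SameOrientationAt e (fun z => T (e z)) x := by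
  rw [SameOrientationAt, he.det_mul_det_comp hx hT]
  exact mul_pos hdet (sq_pos_of_ne_zero (he.det_tderiv_ne_zero hx))

theorem IsPartialDiffeo.oppositeOrientationAt_comp (he : IsPartialDiffeo V e) (hx : x ∈ e.source)
    (hT : DifferentiableAt ℝ T (e x)) (hdet : (fderiv ℝ T (e x)).det < 0) :
    OppositeOrientationAt e (fun z => T (e z)) x := by
  rw [OppositeOrientationAt, he.det_mul_det_comp hx hT]
  exact mul_neg_of_neg_of_pos hdet (sq_pos_of_ne_zero (he.det_tderiv_ne_zero hx))

end Orientation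

section RescaledCharts

variable {n : ℕ} {X : Type*} [TopologicalSpace X] {f : OpenPartialHomeomorph X (E n)} {ε : ℝ}
  (hε : 0 < ε)

theorem mobiusAt_scaledChart (x : X) : MobiusAt f (scaledChart f hε) x := by
  rw [scaledChart_eq_similarity hε]
  exact mobiusAt_similarity (inv_pos.2 hε) _ _ _ _

theorem mobiusAt_invertedChart {x : X} (hx : x ∈ (invertedChart f hε).source) :
    MobiusAt f (invertedChart f hε) x :=
  (mobiusAt_scaledChart hε x).trans
    (mobiusAt_unitInversion ((scaledChart f hε).continuousAt hx.1) hx.2)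

theorem MobiusCompatible.trans_mobiusAt {e f f' : OpenPartialHomeomorph X (E n)}
    (h : MobiusCompatible e f) (hsub : f'.source ⊆ f.source)
    (hff' : ∀ x ∈ f'.source, MobiusAt f f' x) : MobiusCompatible e f' :=
  mobiusCompatible_iff.2 fun x hx hx' =>
    (mobiusCompatible_iff.1 h x hx (hsub hx')).trans (hff' x hx')

variable [ChartedSpace (E n) X]

theorem sameOrientationAt_scaledChart (hf : IsPartialDiffeo (E n) f) {x : X} (hx : x ∈ f.source) :
    SameOrientationAt f (scaledChart f hε) x := by
  rw [scaledChart_eq_similarity hε]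
  have hT := hasFDerivAt_similarity ε⁻¹ (.refl ℝ (E n)) 0 (f x)
  refine hf.sameOrientationAt_comp hx hT.differentiableAt ?_
  rw [hT.fderiv, ContinuousLinearMap.det, ContinuousLinearMap.toLinearMap_smul, LinearMap.det_smul]
  have hdet : LinearMap.det ((.refl ℝ (E n) : E n ≃ₗᵢ[ℝ] E n) : E n →ₗ[ℝ] E n) = 1 :=
    LinearMap.det_id
  exact mul_pos (by positivity) (one_pos.trans_eq hdet.symm)

theorem oppositeOrientationAt_invertedChart (hf : IsPartialDiffeo (E n) f) {x : X}
    (hx : x ∈ (invertedChart f hε).source) : OppositeOrientationAt f (invertedChart f hε) x := by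
  have hdet := det_tderiv_unitInversion_neg hx.2
  rw [tderiv_eq_fderiv] at hdet
  have hopp := (isPartialDiffeo_scaledChart hε hf).oppositeOrientationAt_comp hx.1
    (hasFDerivAt_unitInversion hx.2).differentiableAt hdet
  exact (sameOrientationAt_scaledChart hε hf hx.1).trans_opposite hopp

theorem isConformalChart_scaledChart [IsManifold 𝓘(ℝ, E n) ∞ X] {g : RMetric n X}
    (h : IsConformalChart g f) : IsConformalChart g (scaledChart f hε) := by
  rw [isConformalChart_iff] at h ⊢
  refine ⟨isPartialDiffeo_scaledChart hε h.1, fun x hx => ?_⟩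
  rw [scaledChart_eq_similarity hε]
  exact (h.2 x hx).similarity (h.1.mdifferentiableAt hx) (inv_ne_zero hε.ne') _ _

theorem isConformalChart_invertedChart [IsManifold 𝓘(ℝ, E n) ∞ X] {g : RMetric n X}
    (h : IsConformalChart g f) : IsConformalChart g (invertedChart f hε) := by
  have hscaled := isConformalChart_iff.1 (isConformalChart_scaledChart hε h)
  refine isConformalChart_iff.2 ⟨isPartialDiffeo_invertedChart hε (isConformalChart_iff.1 h).1,
    fun x hx => ?_⟩
  have h0 : scaledChart f hε x ≠ 0 := hx.2
  exact ConformalAt.comp (T := unitInversion (E n)) (hscaled.2 x hx.1)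
    (conformalAt_unitInversion h0) (hasFDerivAt_unitInversion h0).differentiableAt
    (hscaled.1.mdifferentiableAt hx.1)

end RescaledCharts

section OrientedAtlas

variable {n : ℕ} {X : Type*} [TopologicalSpace X] [ChartedSpace (E n) X]
  [IsManifold 𝓘(ℝ, E n) ∞ X] {A : Set (OpenPartialHomeomorph X (E n))}
  {e f : OpenPartialHomeomorph X (E n)} {x : X}

theorem IsOrientedAtlas.isPartialDiffeo (hA : IsOrientedAtlas A) (he : e ∈ A) :
    IsPartialDiffeo (E n) e :=
  mem_maximalAtlas_iff_isPartialDiffeo.1 (hA.subset he)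

theorem IsOrientedAtlas.sameOrientationAt (hA : IsOrientedAtlas A) (he : e ∈ A) (hf : f ∈ A)
    (hx : x ∈ e.source) (hx' : x ∈ f.source) : SameOrientationAt e f x :=
  ((hA.isPartialDiffeo he).det_fderiv_transition_pos_iff (hA.isPartialDiffeo hf) hx hx').1
    (forall_mem_transition_source_iff.1 (hA.jacobian_pos e he f hf) x hx hx')

theorem PreservesOrientation.sameOrientationAt (h : PreservesOrientation A f)
    (hA : IsOrientedAtlas A) (hf : IsPartialDiffeo (E n) f) (he : e ∈ A) (hx : x ∈ e.source)
    (hx' : x ∈ f.source) : SameOrientationAt e f x :=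
  ((hA.isPartialDiffeo he).det_fderiv_transition_pos_iff hf hx hx').1
    (forall_mem_transition_source_iff.1 (h e he) x hx hx')

theorem ReversesOrientation.oppositeOrientationAt (h : ReversesOrientation A f)
    (hA : IsOrientedAtlas A) (hf : IsPartialDiffeo (E n) f) (he : e ∈ A) (hx : x ∈ e.source)
    (hx' : x ∈ f.source) : OppositeOrientationAt e f x :=
  ((hA.isPartialDiffeo he).det_fderiv_transition_neg_iff hf hx hx').1
    (forall_mem_transition_source_iff.1 (h e he) x hx hx')

end OrientedAtlas

section GluedAtlas

variable {n : ℕ} {X Y Z : Type*} [TopologicalSpace X] [TopologicalSpace Y] [TopologicalSpace Z]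
  {i : OpenPartialHomeomorph X Z} {i' : OpenPartialHomeomorph Y Z}
  {k : OpenPartialHomeomorph Z (E n)} {f : OpenPartialHomeomorph X (E n)}
  {f' : OpenPartialHomeomorph Y (E n)} {A : Set (OpenPartialHomeomorph X (E n))}
  {B : Set (OpenPartialHomeomorph Y (E n))}

theorem IsGluing.swap (h : IsGluing i i' k f f') : IsGluing i' i k f' f :=
  ⟨h.disjoint.symm, fun z => or_left_comm.1 (h.cover z), h.readsAs_right, h.readsAs_left⟩

theorem combinedAtlas_comm : combinedAtlas i i' k A B = combinedAtlas i' i k B A := by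
  rw [combinedAtlas, combinedAtlas, Set.union_comm (_ '' A)]

theorem IsGluing.mobiusCompatible_left (h : IsGluing i i' k f f')
    {e : OpenPartialHomeomorph X (E n)} (hA : ∀ c ∈ A, MobiusCompatible c e)
    (hef : Disjoint e.source f.source) :
    ∀ c ∈ combinedAtlas i i' k A B, MobiusCompatible c (i.symm ≫ₕ e) := by
  simp only [forall_mem_combinedAtlas, mobiusCompatible_iff]
  refine ⟨fun c hc z hz hz' => ?_, fun c _ z hz hz' => ?_, fun z hz hz' => ?_⟩
  · exact (mobiusCompatible_iff.1 (hA c hc) _ hz.2 hz'.2).comp (i.continuousAt_symm hz.1)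
  · exact absurd hz'.1 (h.notMem_left hz.1)
  · exact absurd (h.readsAs_left.symm_mem_source hz'.1 hz) (hef.notMem_of_mem_left hz'.2)

theorem IsGluing.mobiusCompatible_right (h : IsGluing i i' k f f')
    {e : OpenPartialHomeomorph Y (E n)} (hB : ∀ c ∈ B, MobiusCompatible c e)
    (hef : Disjoint e.source f'.source) :
    ∀ c ∈ combinedAtlas i i' k A B, MobiusCompatible c (i'.symm ≫ₕ e) := by
  rw [combinedAtlas_comm]
  exact h.swap.mobiusCompatible_left hB hef

variable [ChartedSpace (E n) X] [ChartedSpace (E n) Y] [ChartedSpace (E n) Z]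
  [IsManifold 𝓘(ℝ, E n) ∞ X] [IsManifold 𝓘(ℝ, E n) ∞ Y] [IsManifold 𝓘(ℝ, E n) ∞ Z]
  (hi : IsPartialDiffeo (E n) i) (hi' : IsPartialDiffeo (E n) i') (hk : IsPartialDiffeo (E n) k)

include hi hi' hk in
theorem combinedAtlas_subset_smoothCharts (hA : A ⊆ smoothCharts n X) (hB : B ⊆ smoothCharts n Y) :
    combinedAtlas i i' k A B ⊆ smoothCharts n Z := by
  simp only [Set.subset_def, forall_mem_combinedAtlas, mem_maximalAtlas_iff_isPartialDiffeo]
    at hA hB ⊢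
  exact ⟨fun e he => hi.symm.trans (hA e he), fun e he => hi'.symm.trans (hB e he), hk⟩

include hi hi' hk in
theorem IsGluing.isMobiusAtlas (h : IsGluing i i' k f f') (hA : IsMobiusAtlas A)
    (hB : IsMobiusAtlas B) (hf : ∀ e ∈ A, MobiusCompatible e f)
    (hf' : ∀ e ∈ B, MobiusCompatible e f') : IsMobiusAtlas (combinedAtlas i i' k A B) where
  subset := combinedAtlas_subset_smoothCharts hi hi' hk hA.subset hB.subset
  cover := h.exists_mem_combinedAtlas hA.cover hB.cover
  compatible := by
    have hA' : ∀ e ∈ A, ∀ e' ∈ insert f A, MobiusCompatible e e' := fun e he =>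
      Set.forall_mem_insert.2 ⟨hf e he, hA.compatible e he⟩
    have hB' : ∀ e ∈ B, ∀ e' ∈ insert f' B, MobiusCompatible e e' := fun e he =>
      Set.forall_mem_insert.2 ⟨hf' e he, hB.compatible e he⟩
    simp only [mobiusCompatible_iff] at hA' hB' ⊢
    exact h.forall_combinedAtlas .symm .congr (fun z _ => .refl k z)
      (fun e he e' he' z hz hze hze' => (hA' e he e' he' _ hze hze').comp (i.continuousAt_symm hz))
      fun e he e' he' z hz hze hze' => (hB' e he e' he' _ hze hze').comp (i'.continuousAt_symm hz)

include hi hi' hk in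
theorem IsGluing.isOrientedAtlas (h : IsGluing i i' k f f') (hA : IsOrientedAtlas A)
    (hB : IsOrientedAtlas B) (hfs : IsPartialDiffeo (E n) f) (hfs' : IsPartialDiffeo (E n) f')
    (hf : ∀ e ∈ A, ∀ x ∈ e.source, x ∈ f.source → SameOrientationAt e f x)
    (hf' : ∀ e ∈ B, ∀ y ∈ e.source, y ∈ f'.source → SameOrientationAt e f' y) :
    IsOrientedAtlas (combinedAtlas i i' k A B) where
  subset := combinedAtlas_subset_smoothCharts hi hi' hk hA.subset hB.subset
  cover := h.exists_mem_combinedAtlas hA.cover hB.cover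
  jacobian_pos := by
    have hC : ∀ e ∈ combinedAtlas i i' k A B, IsPartialDiffeo (E n) e := fun e he =>
      mem_maximalAtlas_iff_isPartialDiffeo.1
        (combinedAtlas_subset_smoothCharts hi hi' hk hA.subset hB.subset he)
    have hAd : ∀ e ∈ insert f A, IsPartialDiffeo (E n) e :=
      Set.forall_mem_insert.2 ⟨hfs, fun e he => hA.isPartialDiffeo he⟩
    have hBd : ∀ e ∈ insert f' B, IsPartialDiffeo (E n) e :=
      Set.forall_mem_insert.2 ⟨hfs', fun e he => hB.isPartialDiffeo he⟩
    have hA' : ∀ e ∈ A, ∀ e' ∈ insert f A, ∀ x ∈ e.source, x ∈ e'.source →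
        SameOrientationAt e e' x := fun e he =>
      Set.forall_mem_insert.2 ⟨hf e he, fun e' he' x => hA.sameOrientationAt he he'⟩
    have hB' : ∀ e ∈ B, ∀ e' ∈ insert f' B, ∀ y ∈ e.source, y ∈ e'.source →
        SameOrientationAt e e' y := fun e he =>
      Set.forall_mem_insert.2 ⟨hf' e he, fun e' he' y => hB.sameOrientationAt he he'⟩
    have hsame := h.forall_combinedAtlas (A := A) (B := B) (R := SameOrientationAt) .symm .congr
      (fun z hz => mul_self_pos.2 (hk.det_tderiv_ne_zero hz)) ?_ ?_
    · exact fun e he e' he' => forall_mem_transition_source_iff.2 fun z hz hz' =>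
        ((hC e he).det_fderiv_transition_pos_iff (hC e' he') hz hz').2 (hsame e he e' he' z hz hz')
    · exact fun e he e' he' z hz hze hze' => (hA' e he e' he' _ hze hze').comp hi.symm hz
        ((hAd e (.inr he)).mdifferentiableAt hze) ((hAd e' he').mdifferentiableAt hze')
    · exact fun e he e' he' z hz hze hze' => (hB' e he e' he' _ hze hze').comp hi'.symm hz
        ((hBd e (.inr he)).mdifferentiableAt hze) ((hBd e' he').mdifferentiableAt hze')

end GluedAtlas

/-! ### The glued metric -/

section ConvexCombination

theorem mul_add_mul_add_mul_pos {a b c x y z : ℝ} (ha : 0 ≤ a) (hb : 0 ≤ b) (hc : 0 ≤ c)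
    (h : a + b + c = 1) (hx : a ≠ 0 → 0 < x) (hy : b ≠ 0 → 0 < y) (hz : c ≠ 0 → 0 < z) :
    0 < a * x + b * y + c * z := by
  have hpos : ∀ {a x : ℝ}, 0 ≤ a → (a ≠ 0 → 0 < x) → a ≠ 0 → 0 < a * x :=
    fun ha hx h0 => mul_pos (ha.lt_of_ne' h0) (hx h0)
  have hnonneg : ∀ {a x : ℝ}, 0 ≤ a → (a ≠ 0 → 0 < x) → 0 ≤ a * x := fun {a x} ha hx => by
    rcases eq_or_ne a 0 with rfl | h0
    · simp
    · exact (hpos ha hx h0).le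
  by_cases h0 : a = 0
  · by_cases h1 : b = 0
    · linarith [hpos hc hz (by rintro rfl; simp [h0, h1] at h), hnonneg ha hx, hnonneg hb hy]
    · linarith [hpos hb hy h1, hnonneg ha hx, hnonneg hc hz]
  · linarith [hpos ha hx h0, hnonneg hb hy, hnonneg hc hz]

variable {V : Type*} [NormedAddCommGroup V] [InnerProductSpace ℝ V]
  {X : Type*} [TopologicalSpace X] [ChartedSpace V X]

theorem ConformalAt.convexCombination {G₁ G₀ G₂ : FormField V X} {e : X → V} {x : X}
    {χ₁ χ₀ χ₂ : X → ℝ} (h₁ : 0 ≤ χ₁ x) (h₀ : 0 ≤ χ₀ x) (h₂ : 0 ≤ χ₂ x)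
    (hsum : χ₁ x + χ₀ x + χ₂ x = 1) (hG₁ : χ₁ x ≠ 0 → ConformalAt G₁ e x)
    (hG₀ : χ₀ x ≠ 0 → ConformalAt G₀ e x) (hG₂ : χ₂ x ≠ 0 → ConformalAt G₂ e x) :
    ConformalAt (fun z => χ₁ z • G₁ z + χ₀ z • G₀ z + χ₂ z • G₂ z) e x := by
  have hfactor : ∀ {a : ℝ} {G : FormField V X}, (a ≠ 0 → ConformalAt G e x) →
      ∃ c, (a ≠ 0 → 0 < c) ∧
        ∀ v w, a * G x v w = a * (c * inner ℝ (tderiv e x v) (tderiv e x w)) := fun {a G} h => by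
    rcases eq_or_ne a 0 with rfl | ha
    · exact ⟨0, by simp, by simp⟩
    · obtain ⟨c, hc, hG⟩ := h ha
      exact ⟨c, fun _ => hc, fun v w => by rw [hG]⟩
  obtain ⟨c₁, hc₁, hG₁⟩ := hfactor hG₁
  obtain ⟨c₀, hc₀, hG₀⟩ := hfactor hG₀
  obtain ⟨c₂, hc₂, hG₂⟩ := hfactor hG₂
  refine ⟨χ₁ x * c₁ + χ₀ x * c₀ + χ₂ x * c₂,
    mul_add_mul_add_mul_pos h₁ h₀ h₂ hsum hc₁ hc₀ hc₂, fun v w => ?_⟩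
  simp only [add_apply, smul_apply, smul_eq_mul, hG₁, hG₀, hG₂]
  ring

end ConvexCombination

section PullbackForm

variable {V : Type*} [NormedAddCommGroup V] [NormedSpace ℝ V] {X Z : Type*} [TopologicalSpace X]
  [ChartedSpace V X] [TopologicalSpace Z] [ChartedSpace V Z] {i : OpenPartialHomeomorph X Z}

theorem IsPartialDiffeo.pullbackForm_eq_of_eq_pullbackForm_symm (hi : IsPartialDiffeo V i) {x : X}
    (hx : x ∈ i.source) {G : FormField V X} {G' : FormField V Z}
    (h : G' (i x) = pullbackForm i.symm G (i x)) : pullbackForm i G' x = G x := by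
  ext v w
  rw [pullbackForm_apply, h, pullbackForm_apply, hi.tderiv_symm_apply hx, hi.tderiv_symm_apply hx,
    i.left_inv hx]

theorem IsPartialDiffeo.pullbackForm_pos (hi : IsPartialDiffeo V i) {x : X} (hx : x ∈ i.source)
    {G : FormField V Z} (hG : ∀ v, v ≠ 0 → 0 < G (i x) v v) {v : V} (hv : v ≠ 0) :
    0 < pullbackForm i G x v v :=
  hG _ (hi.tderiv_ne_zero hx hv)

end PullbackForm

section ConformalPullback

variable {V : Type*} [NormedAddCommGroup V] [InnerProductSpace ℝ V] {X : Type*}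
  [TopologicalSpace X] [ChartedSpace V X]

theorem conformalAt_pullbackForm_euclideanForm (e : X → V) (x : X) :
    ConformalAt (pullbackForm e (euclideanForm V)) e x :=
  ⟨1, one_pos, fun v w => by rw [one_mul, pullbackForm_apply, euclideanForm_apply]⟩

theorem conformalAt_pullbackForm_euclideanForm_of_conformalAt {G : FormField V X} {e e' : X → V}
    {x : X} (h : ConformalAt G e x) (h' : ConformalAt G e' x) :
    ConformalAt (pullbackForm e' (euclideanForm V)) e x := by
  obtain ⟨c, hc, h⟩ := h
  obtain ⟨c', hc', h'⟩ := h'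
  refine ⟨c'⁻¹ * c, by positivity, fun v w => ?_⟩
  rw [mul_assoc, ← h, h', inv_mul_cancel_left₀ hc'.ne', pullbackForm_apply, euclideanForm_apply]

variable {n : ℕ} {M Z : Type*} [TopologicalSpace M] [ChartedSpace (E n) M]
  [IsManifold 𝓘(ℝ, E n) ∞ M] [TopologicalSpace Z] [ChartedSpace (E n) Z]
  {i : OpenPartialHomeomorph M Z} {g : RMetric n M} {e : OpenPartialHomeomorph M (E n)} {z : Z}

theorem IsPartialDiffeo.conformalAt_pullbackForm_symm (hi : IsPartialDiffeo (E n) i)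
    (he : IsConformalChart g e) (hz : z ∈ (i.symm ≫ₕ e).source) :
    ConformalAt (pullbackForm i.symm (metricForm g)) (i.symm ≫ₕ e) z :=
  ((isConformalChart_iff.1 he).2 _ hz.2).pullbackForm
    ((isConformalChart_iff.1 he).1.mdifferentiableAt hz.2) (hi.symm.mdifferentiableAt hz.1)

theorem ReadsAs.conformalAt_pullbackForm_symm {k : OpenPartialHomeomorph Z (E n)}
    (h : ReadsAs i k e) (hi : IsPartialDiffeo (E n) i) (he : IsConformalChart g e)
    (hz : z ∈ i.target) (hzk : z ∈ k.source) :
    ConformalAt (pullbackForm i.symm (metricForm g)) k z :=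
  (hi.conformalAt_pullbackForm_symm he ⟨hz, h.symm_mem_source hz hzk⟩).congr
    (h.eventuallyEq hz hzk)

end ConformalPullback

section GluedForm

variable {n : ℕ} {X Y Z : Type*} [TopologicalSpace X] [TopologicalSpace Y] [TopologicalSpace Z]
  [ChartedSpace (E n) X] [ChartedSpace (E n) Y] [ChartedSpace (E n) Z]

/-- The field of forms `χ₁ G + χ₀ k^*δ + χ₂ G'` on `Z`, where `δ` is the Euclidean metric and `G`,
`G'` are transported to `Z` by `i`, `i'`. -/
noncomputable def gluedForm (i : OpenPartialHomeomorph X Z) (i' : OpenPartialHomeomorph Y Z)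
    (k : OpenPartialHomeomorph Z (E n)) (χ₁ χ₀ χ₂ : Z → ℝ) (G : FormField (E n) X)
    (G' : FormField (E n) Y) : FormField (E n) Z := fun z =>
  χ₁ z • pullbackForm i.symm G z + χ₀ z • pullbackForm k (euclideanForm (E n)) z +
    χ₂ z • pullbackForm i'.symm G' z

variable {M N : Type*} [TopologicalSpace M] [TopologicalSpace N]
  [ChartedSpace (E n) M] [ChartedSpace (E n) N] {φ : OpenPartialHomeomorph M (E n)}
  {ψ : OpenPartialHomeomorph N (E n)} {ε : ℝ} [ChartedSpace (E n) (ConnSum φ ψ ε)]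
  {j : GluingMaps φ ψ ε} {χ₁ χ₀ χ₂ : ConnSum φ ψ ε → ℝ}

theorem isPartialDiffeo_inM (j : GluingMaps φ ψ ε) : IsPartialDiffeo (E n) j.inM :=
  ⟨j.inM_smooth, j.inM_symm_smooth⟩

theorem isPartialDiffeo_inN (j : GluingMaps φ ψ ε) : IsPartialDiffeo (E n) j.inN :=
  ⟨j.inN_smooth, j.inN_symm_smooth⟩

theorem IsCutoff.mem_inM_target (h : IsCutoff j χ₁ χ₀ χ₂) {z : ConnSum φ ψ ε} (hz : χ₁ z ≠ 0) :
    z ∈ j.inM.target :=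
  h.support₁ (subset_tsupport _ hz)

theorem IsCutoff.mem_glue_source (h : IsCutoff j χ₁ χ₀ χ₂) {z : ConnSum φ ψ ε} (hz : χ₀ z ≠ 0) :
    z ∈ j.glue.source :=
  h.support₀ (subset_tsupport _ hz)

theorem IsCutoff.mem_inN_target (h : IsCutoff j χ₁ χ₀ χ₂) {z : ConnSum φ ψ ε} (hz : χ₂ z ≠ 0) :
    z ∈ j.inN.target :=
  h.support₂ (subset_tsupport _ hz)

variable [IsManifold 𝓘(ℝ, E n) ∞ (ConnSum φ ψ ε)]

theorem isPartialDiffeo_glue (j : GluingMaps φ ψ ε) : IsPartialDiffeo (E n) j.glue :=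
  mem_maximalAtlas_iff_isPartialDiffeo.1 j.glue_mem

variable [IsManifold 𝓘(ℝ, E n) ∞ M] [IsManifold 𝓘(ℝ, E n) ∞ N] {gM : RMetric n M}
  {gN : RMetric n N}

theorem isGluedMetric_iff {g : RMetric n (ConnSum φ ψ ε)} :
    IsGluedMetric gM gN j χ₁ χ₀ χ₂ g ↔
      metricForm g = gluedForm j.inM j.inN j.glue χ₁ χ₀ χ₂ (metricForm gM) (metricForm gN) :=
  ⟨fun h => funext fun z => ContinuousLinearMap.ext fun v => ContinuousLinearMap.ext (h z v),
    fun h z v w => congr($h z v w)⟩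

theorem agreesOutside_iff {g : RMetric n (ConnSum φ ψ ε)} :
    AgreesOutside gM gN j g ↔
      (∀ x ∉ φ.source, pullbackForm j.inM (metricForm g) x = metricForm gM x) ∧
        ∀ y ∉ ψ.source, pullbackForm j.inN (metricForm g) y = metricForm gN y :=
  ⟨fun h => ⟨fun x hx => ContinuousLinearMap.ext fun v => ContinuousLinearMap.ext (h.1 x hx v),
      fun y hy => ContinuousLinearMap.ext fun v => ContinuousLinearMap.ext (h.2 y hy v)⟩,
    fun h => ⟨fun x hx v w => congr($(h.1 x hx) v w), fun y hy v w => congr($(h.2 y hy) v w)⟩⟩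

theorem IsCutoff.smoothFormAt_gluedForm (h : IsCutoff j χ₁ χ₀ χ₂) (z : ConnSum φ ψ ε) :
    SmoothFormAt (gluedForm j.inM j.inN j.glue χ₁ χ₀ χ₂ (metricForm gM) (metricForm gN)) z := by
  have hM := SmoothFormAt.smul_of_tsupport_subset (fun w hw =>
    (smoothFormAt_metricForm gM _).pullbackForm ((isPartialDiffeo_inM j).symm.contMDiffAt hw))
    h.smooth₁ h.support₁ z
  have hglue := SmoothFormAt.smul_of_tsupport_subset (fun w hw =>
    (smoothFormAt_const (innerSL ℝ) _).pullbackForm ((isPartialDiffeo_glue j).contMDiffAt hw))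
    h.smooth₀ h.support₀ z
  have hN := SmoothFormAt.smul_of_tsupport_subset (fun w hw =>
    (smoothFormAt_metricForm gN _).pullbackForm ((isPartialDiffeo_inN j).symm.contMDiffAt hw))
    h.smooth₂ h.support₂ z
  exact (hM.add hglue).add hN

theorem IsCutoff.gluedForm_pos (h : IsCutoff j χ₁ χ₀ χ₂) (z : ConnSum φ ψ ε) {v : E n}
    (hv : v ≠ 0) :
    0 < gluedForm j.inM j.inN j.glue χ₁ χ₀ χ₂ (metricForm gM) (metricForm gN) z v v := by
  obtain ⟨h₁, h₀, h₂⟩ := h.nonneg z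
  refine mul_add_mul_add_mul_pos h₁ h₀ h₂ (h.sum_eq_one z) (fun hz => ?_) (fun hz => ?_)
    (fun hz => ?_)
  · exact (isPartialDiffeo_inM j).symm.pullbackForm_pos (h.mem_inM_target hz)
      (fun _ => metricForm_pos gM _) hv
  · exact (isPartialDiffeo_glue j).pullbackForm_pos (G := euclideanForm (E n))
      (h.mem_glue_source hz) (fun _ => real_inner_self_pos.2) hv
  · exact (isPartialDiffeo_inN j).symm.pullbackForm_pos (h.mem_inN_target hz)
      (fun _ => metricForm_pos gN _) hv

theorem IsCutoff.exists_isGluedMetric (h : IsCutoff j χ₁ χ₀ χ₂) (gM : RMetric n M)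
    (gN : RMetric n N) : ∃ g : RMetric n (ConnSum φ ψ ε), IsGluedMetric gM gN j χ₁ χ₀ χ₂ g :=
  ⟨metricOfForm (gluedForm j.inM j.inN j.glue χ₁ χ₀ χ₂ (metricForm gM) (metricForm gN))
      (fun z v w => by
        simp only [gluedForm, add_apply, smul_apply, pullbackForm_apply, metricForm_symm gM _
          (tderiv j.inM.symm z v), metricForm_symm gN _ (tderiv j.inN.symm z v),
          euclideanForm_apply, real_inner_comm (tderiv j.glue z v)])
      (fun z _ => h.gluedForm_pos z) h.smoothFormAt_gluedForm,
    isGluedMetric_iff.2 rfl⟩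

variable {g : RMetric n (ConnSum φ ψ ε)} {f : OpenPartialHomeomorph M (E n)}
  {f' : OpenPartialHomeomorph N (E n)}

theorem IsGluedMetric.agreesOutside (hg : IsGluedMetric gM gN j χ₁ χ₀ χ₂ g)
    (h : IsCutoff j χ₁ χ₀ χ₂) (hj : IsGluing j.inM j.inN j.glue f f')
    (hf : f.source ⊆ φ.source) (hf' : f'.source ⊆ ψ.source) : AgreesOutside gM gN j g := by
  rw [isGluedMetric_iff] at hg
  refine agreesOutside_iff.2 ⟨fun x hx => ?_, fun y hy => ?_⟩
  · have hxs : x ∈ j.inM.source := by rw [j.inM_source]; exact fun h => hx h.1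
    have h₀ : χ₀ (j.inM x) = 0 := by_contra fun h0 =>
      hx (hf (hj.readsAs_left x hxs (h.mem_glue_source h0)).1)
    have h₂ : χ₂ (j.inM x) = 0 := by_contra fun h0 =>
      hj.notMem_left (h.mem_inN_target h0) (j.inM.map_source hxs)
    have h₁ : χ₁ (j.inM x) = 1 := by simpa [h₀, h₂] using h.sum_eq_one (j.inM x)
    exact (isPartialDiffeo_inM j).pullbackForm_eq_of_eq_pullbackForm_symm hxs
      (by ext v w; simp [hg, gluedForm, h₀, h₁, h₂])
  · have hys : y ∈ j.inN.source := by rw [j.inN_source]; exact fun h => hy h.1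
    have h₀ : χ₀ (j.inN y) = 0 := by_contra fun h0 =>
      hy (hf' (hj.readsAs_right y hys (h.mem_glue_source h0)).1)
    have h₁ : χ₁ (j.inN y) = 0 := by_contra fun h0 =>
      hj.notMem_left (j.inN.map_source hys) (h.mem_inM_target h0)
    have h₂ : χ₂ (j.inN y) = 1 := by simpa [h₀, h₁] using h.sum_eq_one (j.inN y)
    exact (isPartialDiffeo_inN j).pullbackForm_eq_of_eq_pullbackForm_symm hys
      (by ext v w; simp [hg, gluedForm, h₀, h₁, h₂])

theorem IsGluedMetric.isConformalChart (hg : IsGluedMetric gM gN j χ₁ χ₀ χ₂ g)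
    (h : IsCutoff j χ₁ χ₀ χ₂) {k : OpenPartialHomeomorph (ConnSum φ ψ ε) (E n)}
    (hj : IsGluing j.inM j.inN k f f') (hk : IsPartialDiffeo (E n) k) (hkj : ⇑k = j.glue)
    (hχk : tsupport χ₀ ⊆ k.source) (hf : IsConformalChart gM f) (hf' : IsConformalChart gN f')
    {A : Set (OpenPartialHomeomorph M (E n))} {B : Set (OpenPartialHomeomorph N (E n))}
    (hA : ∀ e ∈ A, IsConformalChart gM e) (hB : ∀ e ∈ B, IsConformalChart gN e) :
    ∀ e ∈ combinedAtlas j.inM j.inN k A B, IsConformalChart g e := by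
  have hconf : ∀ {e : OpenPartialHomeomorph (ConnSum φ ψ ε) (E n)} {z}
      (_ : χ₁ z ≠ 0 → ConformalAt (pullbackForm j.inM.symm (metricForm gM)) e z)
      (_ : z ∈ k.source → ConformalAt (pullbackForm k (euclideanForm (E n))) e z)
      (_ : χ₂ z ≠ 0 → ConformalAt (pullbackForm j.inN.symm (metricForm gN)) e z),
      ConformalAt (metricForm g) e z := fun {e z} h₁ h₀ h₂ => by
    rw [isGluedMetric_iff.1 hg]
    exact .convexCombination (h.nonneg z).1 (h.nonneg z).2.1 (h.nonneg z).2.2 (h.sum_eq_one z) h₁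
      (fun hz => hkj ▸ h₀ (hχk (subset_tsupport _ hz))) h₂
  have hMk : ∀ z ∈ j.inM.target, z ∈ k.source →
      ConformalAt (pullbackForm j.inM.symm (metricForm gM)) k z := fun z =>
    hj.readsAs_left.conformalAt_pullbackForm_symm (isPartialDiffeo_inM j) hf
  have hNk : ∀ z ∈ j.inN.target, z ∈ k.source →
      ConformalAt (pullbackForm j.inN.symm (metricForm gN)) k z := fun z =>
    hj.readsAs_right.conformalAt_pullbackForm_symm (isPartialDiffeo_inN j) hf'
  refine forall_mem_combinedAtlas.2 ⟨fun e he => ?_, fun e he => ?_, ?_⟩ <;>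
    refine isConformalChart_iff.2 ⟨?_, fun z hz => ?_⟩
  · exact (isPartialDiffeo_inM j).symm.trans (isConformalChart_iff.1 (hA e he)).1
  · have hze := (isPartialDiffeo_inM j).conformalAt_pullbackForm_symm (hA e he) hz
    exact hconf (fun _ => hze) (fun hzk =>
      conformalAt_pullbackForm_euclideanForm_of_conformalAt hze (hMk z hz.1 hzk))
      fun hz₂ => absurd hz.1 (hj.notMem_left (h.mem_inN_target hz₂))
  · exact (isPartialDiffeo_inN j).symm.trans (isConformalChart_iff.1 (hB e he)).1
  · have hze := (isPartialDiffeo_inN j).conformalAt_pullbackForm_symm (hB e he) hz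
    exact hconf (fun hz₁ => absurd (h.mem_inM_target hz₁) (hj.notMem_left hz.1)) (fun hzk =>
      conformalAt_pullbackForm_euclideanForm_of_conformalAt hze (hNk z hz.1 hzk)) fun _ => hze
  · exact hk
  · exact hconf (fun hz₁ => hMk z (h.mem_inM_target hz₁) hz)
      (fun _ => conformalAt_pullbackForm_euclideanForm k z)
      fun hz₂ => hNk z (h.mem_inN_target hz₂) hz

end GluedForm

section Cutoff

variable {n : ℕ} {M N : Type*} [TopologicalSpace M] [TopologicalSpace N]
  [ChartedSpace (E n) M] [ChartedSpace (E n) N] {φ : OpenPartialHomeomorph M (E n)}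
  {ψ : OpenPartialHomeomorph N (E n)} {ε : ℝ} [ChartedSpace (E n) (ConnSum φ ψ ε)]
  [IsManifold 𝓘(ℝ, E n) ∞ (ConnSum φ ψ ε)] {j : GluingMaps φ ψ ε}
  {k : OpenPartialHomeomorph (ConnSum φ ψ ε) (E n)} {f : OpenPartialHomeomorph M (E n)}
  {f' : OpenPartialHomeomorph N (E n)}

theorem IsGluing.exists_isCutoff [T2Space (ConnSum φ ψ ε)]
    [SecondCountableTopology (ConnSum φ ψ ε)] (hj : IsGluing j.inM j.inN k f f')
    (hk : k.source ⊆ j.glue.source) :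
    ∃ χ₁ χ₀ χ₂ : ConnSum φ ψ ε → ℝ, IsCutoff j χ₁ χ₀ χ₂ ∧ tsupport χ₀ ⊆ k.source := by
  have := Manifold.locallyCompact_of_finiteDimensional (M := ConnSum φ ψ ε) 𝓘(ℝ, E n)
  obtain ⟨χ, hχ⟩ := SmoothPartitionOfUnity.exists_isSubordinate 𝓘(ℝ, E n)
    (s := (Set.univ : Set (ConnSum φ ψ ε))) isClosed_univ
    ![j.inM.target, k.source, j.inN.target]
    (fun a => by
      fin_cases a
      exacts [j.inM.open_target, k.open_source, j.inN.open_target])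
    (fun z _ => Set.mem_iUnion.2 <| (hj.cover z).elim (fun h => ⟨0, h⟩)
      fun h => h.elim (fun h => ⟨2, h⟩) fun h => ⟨1, h⟩)
  refine ⟨χ 0, χ 1, χ 2, ⟨(χ 0).contMDiff, (χ 1).contMDiff, (χ 2).contMDiff,
    fun z => ⟨χ.nonneg 0 z, χ.nonneg 1 z, χ.nonneg 2 z⟩, fun z => ?_, hχ 0, (hχ 1).trans hk, hχ 2⟩,
    hχ 1⟩
  rw [← χ.sum_eq_one (Set.mem_univ z), finsum_eq_sum_of_fintype, Fin.sum_univ_three]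

end Cutoff

/-! ### Restricting to a thinner neck -/

section Neck

theorem IsPartialDiffeo.transOfSet {V : Type*} [NormedAddCommGroup V] [NormedSpace ℝ V]
    {X : Type*} [TopologicalSpace X] [ChartedSpace V X] {f : OpenPartialHomeomorph X V}
    (hf : IsPartialDiffeo V f) {s : Set V} (hs : IsOpen s) :
    IsPartialDiffeo V (f ≫ₕ .ofSet s hs) :=
  hf.trans ⟨contMDiffOn_id, contMDiffOn_id⟩

variable {n : ℕ} {M N : Type*} [TopologicalSpace M] [TopologicalSpace N]

/-- The restriction of the chart `φ` to the points whose coordinates have norm less than `a`. -/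
noncomputable def restrictToBall (φ : OpenPartialHomeomorph M (E n)) (a : ℝ) :
    OpenPartialHomeomorph M (E n) :=
  φ ≫ₕ .ofSet (Metric.ball 0 a) Metric.isOpen_ball

theorem mem_restrictToBall_source {φ : OpenPartialHomeomorph M (E n)} {a : ℝ} {x : M} :
    x ∈ (restrictToBall φ a).source ↔ x ∈ φ.source ∧ ‖φ x‖ < a :=
  and_congr_right fun _ => mem_ball_zero_iff

/-- The restriction of the chart `k` to the points whose coordinates lie in the annulus
`ρ⁻¹ < |y| < ρ`, which is invariant under the unit inversion. -/
noncomputable def restrictToAnnulus (k : OpenPartialHomeomorph M (E n)) (ρ : ℝ) :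
    OpenPartialHomeomorph M (E n) :=
  k ≫ₕ .ofSet {y | ‖y‖ ∈ Set.Ioo ρ⁻¹ ρ} (isOpen_Ioo.preimage continuous_norm)

theorem mem_restrictToAnnulus_source {k : OpenPartialHomeomorph M (E n)} {ρ : ℝ} {x : M} :
    x ∈ (restrictToAnnulus k ρ).source ↔ x ∈ k.source ∧ ρ⁻¹ < ‖k x‖ ∧ ‖k x‖ < ρ :=
  Iff.rfl

variable {φ : OpenPartialHomeomorph M (E n)} {ψ : OpenPartialHomeomorph N (E n)} {ε ρ : ℝ}
  (hε : 0 < ε)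

theorem ReadsAs.restrictToAnnulus_scaledChart {Z : Type*} [TopologicalSpace Z]
    {i : OpenPartialHomeomorph M Z} {k : OpenPartialHomeomorph Z (E n)}
    (h : ReadsAs i k (scaledChart φ hε)) :
    ReadsAs i (restrictToAnnulus k ρ) (scaledChart (restrictToBall φ (ρ * ε)) hε) := by
  intro x hx hxρ
  obtain ⟨hxk, -, hxρ⟩ := mem_restrictToAnnulus_source.1 hxρ
  obtain ⟨hxφ, hkx⟩ := h x hx hxk
  rw [hkx, norm_scaledChart, div_lt_iff₀ hε] at hxρ
  exact ⟨mem_restrictToBall_source.2 ⟨hxφ, hxρ⟩, hkx⟩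

theorem invertedChart_restrictToBall_apply {a : ℝ} (x : M) :
    invertedChart (restrictToBall φ a) hε x = invertedChart φ hε x :=
  congrArg (unitInversion (E n)) (a₁ := scaledChart (restrictToBall φ a) hε x)
    (a₂ := scaledChart φ hε x) rfl

theorem ReadsAs.restrictToAnnulus_invertedChart {Z : Type*} [TopologicalSpace Z]
    {i : OpenPartialHomeomorph M Z} {k : OpenPartialHomeomorph Z (E n)}
    (h : ReadsAs i k (invertedChart φ hε)) (hρ : 0 < ρ) :
    ReadsAs i (restrictToAnnulus k ρ) (invertedChart (restrictToBall φ (ρ * ε)) hε) := by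
  intro x hx hxρ
  obtain ⟨hxk, hxρ, -⟩ := mem_restrictToAnnulus_source.1 hxρ
  obtain ⟨hxφ, hkx⟩ := h x hx hxk
  obtain ⟨hxφ, hx0⟩ := (mem_invertedChart_source hε).1 hxφ
  have hnorm : ‖k (i x)‖ = (‖φ x‖ / ε)⁻¹ := by
    rw [hkx, ← norm_scaledChart hε]
    exact norm_unitInversion _
  have hpos : 0 < ‖φ x‖ / ε := div_pos (norm_pos_iff.2 hx0) hε
  rw [hnorm, inv_lt_inv₀ hρ hpos, div_lt_iff₀ hε] at hxρ
  exact ⟨(mem_invertedChart_source hε).2 ⟨mem_restrictToBall_source.2 ⟨hxφ, hxρ⟩, hx0⟩,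
    hkx.trans (invertedChart_restrictToBall_apply hε x).symm⟩

include hε in
theorem norm_preGlue_inl {x : {x : M // x ∉ chartBall φ ε}} (hx : x.1 ∈ chartClosedBall φ ε) :
    ‖preGlue φ ψ ε (.inl x)‖ = 1 := by
  have hnorm : ‖φ x.1‖ = ε := hx.2.antisymm (not_lt.1 fun h => x.2 ⟨hx.1, h⟩)
  exact (norm_scaledChart hε x.1).trans (by rw [hnorm, div_self hε.ne'])

include hε in
theorem norm_preGlue_inr {y : {y : N // y ∉ chartBall ψ ε}} (hy : y.1 ∈ chartClosedBall ψ ε) :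
    ‖preGlue φ ψ ε (.inr y)‖ = 1 := by
  have hpre : preGlue φ ψ ε (.inr y) = unitInversion (E n) (preGlue ψ φ ε (.inl y)) :=
    (unitInversion_apply _).symm
  rw [hpre, norm_unitInversion, norm_preGlue_inl hε hy, inv_one]

variable [ChartedSpace (E n) M] [ChartedSpace (E n) N] [ChartedSpace (E n) (ConnSum φ ψ ε)]
  {j : GluingMaps φ ψ ε}

include hε in
theorem norm_glue_eq_one {z : ConnSum φ ψ ε} (hz : z ∈ j.glue.source) (hzM : z ∉ j.inM.target)
    (hzN : z ∉ j.inN.target) : ‖j.glue z‖ = 1 := by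
  rw [j.glue_source] at hz
  obtain ⟨x | y, ha, rfl⟩ := hz <;> rw [j.glue_apply _ ha]
  · refine norm_preGlue_inl hε (by_contra fun hx => hzM ?_)
    have hxs : x.1 ∈ j.inM.source := j.inM_source.symm ▸ hx
    exact j.inM_apply x hxs ▸ j.inM.map_source hxs
  · refine norm_preGlue_inr hε (by_contra fun hy => hzN ?_)
    have hys : y.1 ∈ j.inN.source := j.inN_source.symm ▸ hy
    exact j.inN_apply y hys ▸ j.inN.map_source hys

theorem IsGluing.restrictToAnnulus (hρ : 1 < ρ)
    (h : IsGluing j.inM j.inN j.glue (scaledChart φ hε) (invertedChart ψ hε)) :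
    IsGluing j.inM j.inN (restrictToAnnulus j.glue ρ) (scaledChart (restrictToBall φ (ρ * ε)) hε)
      (invertedChart (restrictToBall ψ (ρ * ε)) hε) where
  disjoint := h.disjoint
  cover z := by
    by_contra! hz
    have hzk := ((h.cover z).resolve_left hz.1).resolve_left hz.2.1
    refine hz.2.2 (mem_restrictToAnnulus_source.2 ⟨hzk, ?_⟩)
    rw [norm_glue_eq_one hε hzk hz.1 hz.2.1]
    exact ⟨inv_lt_one_of_one_lt₀ hρ, hρ⟩
  readsAs_left := h.readsAs_left.restrictToAnnulus_scaledChart hε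
  readsAs_right := h.readsAs_right.restrictToAnnulus_invertedChart hε (by positivity)

end Neck

/-! ### Conformal structures on the connected sum -/

section Modification

variable {n : ℕ} {M : Type*} [TopologicalSpace M] [ChartedSpace (E n) M]

theorem IsMobiusAtlas.mobiusAt_comp {A : Set (OpenPartialHomeomorph M (E n))}
    (hA : IsMobiusAtlas A) {F : M ≃ₜ M} {e e' : OpenPartialHomeomorph M (E n)} (he : e ∈ A)
    (he' : e' ∈ A) {x : M} (hx : F x ∈ e.source) (hx' : F x ∈ e'.source) :
    MobiusAt (fun z => e (F z)) (fun z => e' (F z)) x :=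
  (mobiusCompatible_iff.1 (hA.compatible e he e' he') _ hx hx').comp F.continuous.continuousAt

variable [IsManifold 𝓘(ℝ, E n) ∞ M]

theorem IsMobiusAtlas.image_homeomorph {A : Set (OpenPartialHomeomorph M (E n))}
    (hA : IsMobiusAtlas A) {F : M ≃ₜ M} (hF : IsPartialDiffeo (E n) F.toOpenPartialHomeomorph) :
    IsMobiusAtlas ((fun e => F.toOpenPartialHomeomorph ≫ₕ e) '' A) where
  subset := Set.image_subset_iff.2 fun e he => mem_maximalAtlas_iff_isPartialDiffeo.2 <|
    hF.trans (mem_maximalAtlas_iff_isPartialDiffeo.1 (hA.subset he))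
  cover x := by
    obtain ⟨e, he, hx⟩ := hA.cover (F x)
    exact ⟨_, ⟨e, he, rfl⟩, Set.mem_univ x, hx⟩
  compatible := by
    simp only [Set.forall_mem_image, mobiusCompatible_iff]
    exact fun e he e' he' x hx hx' => hA.mobiusAt_comp he he' hx.2 hx'.2

theorem metricForm_pullbackMetric_of_eventuallyEq_id {g : RMetric n M} {F : M ≃ₜ M}
    {hF : IsPartialDiffeo (E n) F.toOpenPartialHomeomorph} {x : M} (h : F =ᶠ[𝓝 x] id) :
    metricForm (pullbackMetric g F hF) x = metricForm g x := by
  ext v w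
  rw [metricForm_pullbackMetric, pullbackForm_apply, tderiv_congr h]
  exact congr(metricForm g $(h.eq_of_nhds) $(DFunLike.congr_fun (tderiv_id x) v)
    $(DFunLike.congr_fun (tderiv_id x) w))

/-- The metric `g'` and the atlas `A'` of charts conformal for `g'` agree with the metric `g` and,
up to Möbius transformations, with the atlas `A` outside the domain of `φ`, while the smaller chart
`φ'` is conformal for `g'` and, if `A` is a Möbius atlas, Möbius relative to the Möbius
atlas `A'`. -/
structure IsConformalModification (g g' : RMetric n M) (A A' : Set (OpenPartialHomeomorph M (E n)))
    (φ φ' : OpenPartialHomeomorph M (E n)) : Prop where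
  metricForm_eq : ∀ x ∉ φ.source, metricForm g' x = metricForm g x
  cover : ∀ x, ∃ e ∈ A', x ∈ e.source
  isConformalChart : ∀ e ∈ A', IsConformalChart g' e
  isConformalChart_chart : IsConformalChart g' φ'
  isMobiusAtlas : IsMobiusAtlas A → IsMobiusAtlas A'
  mobiusCompatible_chart : IsMobiusAtlas A → ∀ e ∈ A', MobiusCompatible e φ'
  mobiusCompatible_of_disjoint : IsMobiusAtlas A → ∀ e ∈ A, Disjoint e.source φ.source →
    ∀ e' ∈ A', MobiusCompatible e' e

theorem exists_isConformalModification [T2Space M] {g : RMetric n M}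
    {A : Set (OpenPartialHomeomorph M (E n))} (hA : ∀ e ∈ A, IsConformalChart g e)
    (hcover : ∀ x, ∃ e ∈ A, x ∈ e.source) {a r : ℝ} (ha : 0 < a) (har : a < r)
    {φ : OpenPartialHomeomorph M (E n)} (hφ : IsPartialDiffeo (E n) φ)
    (hφr : φ.target = Metric.ball 0 r) (hgφ : ConformalAt (metricForm g) φ (φ.symm 0)) :
    ∃ g' A', IsConformalModification g g' A A' φ (restrictToBall φ a) := by
  obtain ⟨e₀, he₀, h0⟩ := hcover (φ.symm 0)
  obtain ⟨F, hF, hFid, hFφ⟩ :=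
    exists_conformal_deformation ha har hφ hφr hgφ (hA e₀ he₀) h0
  refine ⟨pullbackMetric g F hF, (fun e => F.toOpenPartialHomeomorph ≫ₕ e) '' A,
    { metricForm_eq := fun x hx => metricForm_pullbackMetric_of_eventuallyEq_id (hFid x hx)
      cover := fun x => ?_
      isConformalChart := Set.forall_mem_image.2 fun e he =>
        isConformalChart_pullbackMetric hF (hA e he)
      isConformalChart_chart := isConformalChart_iff.2 ⟨hφ.transOfSet _, fun x hx => ?_⟩
      isMobiusAtlas := fun h => h.image_homeomorph hF
      mobiusCompatible_chart := fun h => Set.forall_mem_image.2 fun e he =>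
        mobiusCompatible_iff.2 fun x hx hxφ => ?_
      mobiusCompatible_of_disjoint := fun h e he heφ => Set.forall_mem_image.2 fun e' he' =>
        mobiusCompatible_iff.2 fun x hx hxe => ?_ }⟩
  · obtain ⟨e, he, hx⟩ := hcover (F x)
    exact ⟨_, ⟨e, he, rfl⟩, Set.mem_univ x, hx⟩
  · obtain ⟨hxφ, hxa⟩ := mem_restrictToBall_source.1 hx
    exact (hFφ x hxφ hxa).2.2
  · obtain ⟨hxφ, hxa⟩ := mem_restrictToBall_source.1 hxφ
    exact (h.mobiusAt_comp he he₀ hx.2 (hFφ x hxφ hxa).1).trans (hFφ x hxφ hxa).2.1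
  · have hFx := hFid x (heφ.notMem_of_mem_left hxe)
    have hxF : F x ∈ e.source := by rwa [hFx.eq_of_nhds]
    exact (h.mobiusAt_comp he' he hx.2 hxF).congr .rfl (hFx.fun_comp e).symm

end Modification

section Extension

variable {n : ℕ} {M N : Type*} [TopologicalSpace M] [TopologicalSpace N]
  [ChartedSpace (E n) M] [ChartedSpace (E n) N] [IsManifold 𝓘(ℝ, E n) ∞ M]
  [IsManifold 𝓘(ℝ, E n) ∞ N] {φ : OpenPartialHomeomorph M (E n)}
  {ψ : OpenPartialHomeomorph N (E n)} {ε : ℝ} [ChartedSpace (E n) (ConnSum φ ψ ε)]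
  [IsManifold 𝓘(ℝ, E n) ∞ (ConnSum φ ψ ε)] {j : GluingMaps φ ψ ε} {gM gM' : RMetric n M}
  {gN gN' : RMetric n N} {g : RMetric n (ConnSum φ ψ ε)}

theorem AgreesOutside.congr (h : AgreesOutside gM gN j g)
    (hM : ∀ x ∉ φ.source, metricForm gM x = metricForm gM' x)
    (hN : ∀ y ∉ ψ.source, metricForm gN y = metricForm gN' y) : AgreesOutside gM' gN' j g := by
  rw [agreesOutside_iff] at h ⊢
  exact ⟨fun x hx => (h.1 x hx).trans (hM x hx), fun y hy => (h.2 y hy).trans (hN y hy)⟩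

/-- The metric `g` on the connected sum and the atlas `C` of charts conformal for `g` agree with
the given metrics and, up to Möbius transformations, with the given atlases `A`, `B` outside the
domains of the charts used in the gluing; if `A` and `B` are Möbius atlases, so is `C`. -/
structure IsConformalExtension (gM : RMetric n M) (gN : RMetric n N) (j : GluingMaps φ ψ ε)
    (A : Set (OpenPartialHomeomorph M (E n))) (B : Set (OpenPartialHomeomorph N (E n)))
    (g : RMetric n (ConnSum φ ψ ε)) (C : Set (OpenPartialHomeomorph (ConnSum φ ψ ε) (E n))) :
    Prop where
  cover : ∀ z, ∃ c ∈ C, z ∈ c.source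
  isConformalChart : ∀ c ∈ C, IsConformalChart g c
  agreesOutside : AgreesOutside gM gN j g
  isMobiusAtlas : IsMobiusAtlas A → IsMobiusAtlas B → IsMobiusAtlas C
  mobiusCompatible_left : IsMobiusAtlas A → ∀ e ∈ A, Disjoint e.source φ.source →
    ∀ c ∈ C, MobiusCompatible c (j.inM.symm ≫ₕ e)
  mobiusCompatible_right : IsMobiusAtlas B → ∀ e ∈ B, Disjoint e.source ψ.source →
    ∀ c ∈ C, MobiusCompatible c (j.inN.symm ≫ₕ e)

theorem MobiusCompatible.scaledChart {X : Type*} [TopologicalSpace X]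
    {e f : OpenPartialHomeomorph X (E n)} (h : MobiusCompatible e f) (hε : 0 < ε) :
    MobiusCompatible e (scaledChart f hε) :=
  h.trans_mobiusAt subset_rfl fun x _ => mobiusAt_scaledChart hε x

theorem MobiusCompatible.invertedChart {X : Type*} [TopologicalSpace X]
    {e f : OpenPartialHomeomorph X (E n)} (h : MobiusCompatible e f) (hε : 0 < ε) :
    MobiusCompatible e (invertedChart f hε) :=
  h.trans_mobiusAt (fun _ hx => hx.1) fun _ => mobiusAt_invertedChart hε

variable {A A' : Set (OpenPartialHomeomorph M (E n))} {B B' : Set (OpenPartialHomeomorph N (E n))}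
  [T2Space (ConnSum φ ψ ε)] [SecondCountableTopology (ConnSum φ ψ ε)] (hε : 0 < ε)
  (hj : IsGluing j.inM j.inN j.glue (scaledChart φ hε) (invertedChart ψ hε))

include hj in
theorem IsConformalModification.exists_isConformalExtension {ρ : ℝ} (hρ : 1 < ρ)
    (hM : IsConformalModification gM gM' A A' φ (restrictToBall φ (ρ * ε)))
    (hN : IsConformalModification gN gN' B B' ψ (restrictToBall ψ (ρ * ε))) :
    ∃ g C, IsConformalExtension gM gN j A B g C := by
  have hjρ := hj.restrictToAnnulus hε hρ
  have hk : IsPartialDiffeo (E n) (restrictToAnnulus j.glue ρ) :=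
    (isPartialDiffeo_glue j).transOfSet _
  obtain ⟨χ₁, χ₀, χ₂, hχ, hχk⟩ := hjρ.exists_isCutoff fun z hz => hz.1
  obtain ⟨g, hg⟩ := hχ.exists_isGluedMetric gM' gN'
  have hagrees := hg.agreesOutside hχ hj subset_rfl fun y hy => hy.1
  refine ⟨g, combinedAtlas j.inM j.inN (restrictToAnnulus j.glue ρ) A' B',
    { cover := hjρ.exists_mem_combinedAtlas hM.cover hN.cover
      isConformalChart := hg.isConformalChart hχ hjρ hk rfl hχk
        (isConformalChart_scaledChart hε hM.isConformalChart_chart)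
        (isConformalChart_invertedChart hε hN.isConformalChart_chart)
        hM.isConformalChart hN.isConformalChart
      agreesOutside := hagrees.congr hM.metricForm_eq hN.metricForm_eq
      isMobiusAtlas := fun hA hB => hjρ.isMobiusAtlas (isPartialDiffeo_inM j)
        (isPartialDiffeo_inN j) hk (hM.isMobiusAtlas hA) (hN.isMobiusAtlas hB)
        (fun e he => (hM.mobiusCompatible_chart hA e he).scaledChart hε)
        fun e he => (hN.mobiusCompatible_chart hB e he).invertedChart hε
      mobiusCompatible_left := fun hA e he hdisj => hjρ.mobiusCompatible_left
        (hM.mobiusCompatible_of_disjoint hA e he hdisj)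
        (hdisj.mono_right fun x hx => (mem_restrictToBall_source.1 hx).1)
      mobiusCompatible_right := fun hB e he hdisj => hjρ.mobiusCompatible_right
        (hN.mobiusCompatible_of_disjoint hB e he hdisj)
        (hdisj.mono_right fun y hy => (mem_restrictToBall_source.1 hy.1).1) }⟩

include hj in
theorem exists_isConformalExtension [T2Space M] [T2Space N]
    (hA : ∀ e ∈ A, IsConformalChart gM e) (hAcover : ∀ x, ∃ e ∈ A, x ∈ e.source)
    (hB : ∀ e ∈ B, IsConformalChart gN e) (hBcover : ∀ y, ∃ e ∈ B, y ∈ e.source)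
    (hφ : IsPartialDiffeo (E n) φ) (hφt : φ.target = Metric.ball 0 (2 * ε))
    (hφc : ConformalAt (metricForm gM) φ (φ.symm 0))
    (hψ : IsPartialDiffeo (E n) ψ) (hψt : ψ.target = Metric.ball 0 (2 * ε))
    (hψc : ConformalAt (metricForm gN) ψ (ψ.symm 0)) :
    ∃ g C, IsConformalExtension gM gN j A B g C := by
  have hpos : 0 < 3 / 2 * ε := by positivity
  have hlt : 3 / 2 * ε < 2 * ε := by linarith
  obtain ⟨gM', A', hM⟩ := exists_isConformalModification hA hAcover hpos hlt hφ hφt hφc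
  obtain ⟨gN', B', hN⟩ := exists_isConformalModification hB hBcover hpos hlt hψ hψt hψc
  exact hM.exists_isConformalExtension hε hj (by norm_num) hN

end Extension

section GluedCharts

variable {n : ℕ} {M N : Type*} [TopologicalSpace M] [TopologicalSpace N]
  [ChartedSpace (E n) M] [ChartedSpace (E n) N] [IsManifold 𝓘(ℝ, E n) ∞ M]
  [IsManifold 𝓘(ℝ, E n) ∞ N] {φ : OpenPartialHomeomorph M (E n)}
  {ψ : OpenPartialHomeomorph N (E n)} {ε : ℝ} [ChartedSpace (E n) (ConnSum φ ψ ε)]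
  [IsManifold 𝓘(ℝ, E n) ∞ (ConnSum φ ψ ε)] {j : GluingMaps φ ψ ε}
  {A : Set (OpenPartialHomeomorph M (E n))} {B : Set (OpenPartialHomeomorph N (E n))} (hε : 0 < ε)
  (hj : IsGluing j.inM j.inN j.glue (scaledChart φ hε) (invertedChart ψ hε))

include hj in
theorem isOrientedAtlas_gluedAtlas (hA : IsOrientedAtlas A) (hB : IsOrientedAtlas B)
    (hφ : IsPartialDiffeo (E n) φ) (hψ : IsPartialDiffeo (E n) ψ) (hAφ : PreservesOrientation A φ)
    (hBψ : ReversesOrientation B ψ) : IsOrientedAtlas (gluedAtlas j A B) :=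
  hj.isOrientedAtlas (isPartialDiffeo_inM j) (isPartialDiffeo_inN j) (isPartialDiffeo_glue j) hA hB
    (isPartialDiffeo_scaledChart hε hφ) (isPartialDiffeo_invertedChart hε hψ)
    (fun _ he _ hx hxφ => (hAφ.sameOrientationAt hA hφ he hx hxφ).trans
      (sameOrientationAt_scaledChart hε hφ hxφ))
    fun _ he _ hy hyψ => (hBψ.oppositeOrientationAt hB hψ he hy hyψ.1).trans
      (oppositeOrientationAt_invertedChart hε hψ hyψ)

include hj in
theorem isMobiusAtlas_gluedAtlas (hA : IsMobiusAtlas A) (hB : IsMobiusAtlas B)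
    (hAφ : ∀ e ∈ A, MobiusCompatible e φ) (hBψ : ∀ e ∈ B, MobiusCompatible e ψ) :
    IsMobiusAtlas (gluedAtlas j A B) :=
  hj.isMobiusAtlas (isPartialDiffeo_inM j) (isPartialDiffeo_inN j) (isPartialDiffeo_glue j) hA hB
    (fun e he => (hAφ e he).scaledChart hε) fun e he => (hBψ e he).invertedChart hε

include hj in
theorem IsGluedMetric.isLocallyConformallyFlat {gM : RMetric n M} {gN : RMetric n N}
    {g : RMetric n (ConnSum φ ψ ε)} {χ₁ χ₀ χ₂ : ConnSum φ ψ ε → ℝ}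
    (hg : IsGluedMetric gM gN j χ₁ χ₀ χ₂ g) (hχ : IsCutoff j χ₁ χ₀ χ₂)
    (hM : IsLocallyConformallyFlat gM) (hN : IsLocallyConformallyFlat gN)
    (hφ : IsConformalChart gM φ) (hψ : IsConformalChart gN ψ) : IsLocallyConformallyFlat g := by
  have hconf := hg.isConformalChart hχ hj (isPartialDiffeo_glue j) rfl hχ.support₀
    (isConformalChart_scaledChart hε hφ) (isConformalChart_invertedChart hε hψ)
    (A := {e | IsConformalChart gM e}) (B := {e | IsConformalChart gN e})
    (fun _ => id) fun _ => id
  intro z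
  obtain ⟨e, he, hz⟩ := hj.exists_mem_combinedAtlas hM hN z
  exact ⟨e, hconf e he, hz⟩

end GluedCharts

end ConnectedSum

open ConnectedSum in
theorem mainTheorem5_general {n : ℕ} (hn : 0 < n)
    {M : Type*} [TopologicalSpace M] [T2Space M] [SecondCountableTopology M]
    [ChartedSpace (E n) M] [IsManifold 𝓘(ℝ, E n) ∞ M]
    {N : Type*} [TopologicalSpace N] [T2Space N] [SecondCountableTopology N]
    [ChartedSpace (E n) N] [IsManifold 𝓘(ℝ, E n) ∞ N]
    (gM : RMetric n M) (gN : RMetric n N) {ε : ℝ} (hε : 0 < ε)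
    {φ : OpenPartialHomeomorph M (E n)} (hφ : φ ∈ smoothCharts n M)
    (hφt : φ.target = Metric.ball 0 (2 * ε)) (hφc : ConformalAt (metricForm gM) φ (φ.symm 0))
    {ψ : OpenPartialHomeomorph N (E n)} (hψ : ψ ∈ smoothCharts n N)
    (hψt : ψ.target = Metric.ball 0 (2 * ε)) (hψc : ConformalAt (metricForm gN) ψ (ψ.symm 0)) :
    ∃ (_ : ChartedSpace (E n) (ConnSum φ ψ ε))
      (_ : IsManifold 𝓘(ℝ, E n) ∞ (ConnSum φ ψ ε)) (j : GluingMaps φ ψ ε),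
      T2Space (ConnSum φ ψ ε) ∧ SecondCountableTopology (ConnSum φ ψ ε) ∧
      (CompactSpace M → CompactSpace N → CompactSpace (ConnSum φ ψ ε)) ∧
      (∀ (oM : Set (OpenPartialHomeomorph M (E n))) (oN : Set (OpenPartialHomeomorph N (E n))),
        IsOrientedAtlas oM → IsOrientedAtlas oN → PreservesOrientation oM φ →
          ReversesOrientation oN ψ → IsOrientedAtlas (gluedAtlas j oM oN)) ∧
      (∃ χ₁ χ₀ χ₂ : ConnSum φ ψ ε → ℝ, IsCutoff j χ₁ χ₀ χ₂) ∧
      (∀ χ₁ χ₀ χ₂ : ConnSum φ ψ ε → ℝ, IsCutoff j χ₁ χ₀ χ₂ →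
        ∃ g : RMetric n (ConnSum φ ψ ε),
          IsGluedMetric gM gN j χ₁ χ₀ χ₂ g ∧ AgreesOutside gM gN j g ∧
          (IsLocallyConformallyFlat gM → IsLocallyConformallyFlat gN →
            IsConformalChart gM φ → IsConformalChart gN ψ → IsLocallyConformallyFlat g)) ∧
      (IsLocallyConformallyFlat gM → IsLocallyConformallyFlat gN →
        ∃ g : RMetric n (ConnSum φ ψ ε),
          IsLocallyConformallyFlat g ∧ AgreesOutside gM gN j g) ∧
      (∀ (A : Set (OpenPartialHomeomorph M (E n))) (B : Set (OpenPartialHomeomorph N (E n))),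
        IsMobiusAtlas A → (∀ e ∈ A, IsConformalChart gM e) →
        IsMobiusAtlas B → (∀ e ∈ B, IsConformalChart gN e) →
          (∃ (C : Set (OpenPartialHomeomorph (ConnSum φ ψ ε) (E n)))
            (g : RMetric n (ConnSum φ ψ ε)),
            IsMobiusAtlas C ∧ (∀ e ∈ C, IsConformalChart g e) ∧ AgreesOutside gM gN j g ∧
            (∀ e ∈ A, Disjoint e.source φ.source →
              ∀ c ∈ C, MobiusCompatible c (j.inM.symm ≫ₕ e)) ∧
            (∀ e ∈ B, Disjoint e.source ψ.source →
              ∀ c ∈ C, MobiusCompatible c (j.inN.symm ≫ₕ e))) ∧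
          ((∀ e ∈ A, MobiusCompatible e φ) → (∀ e ∈ B, MobiusCompatible e ψ) →
            IsMobiusAtlas (gluedAtlas j A B))) := by
  have hφd := mem_maximalAtlas_iff_isPartialDiffeo.1 hφ
  have hψd := mem_maximalAtlas_iff_isPartialDiffeo.1 hψ
  have := nonempty_connSum (ψ := ψ) hn hε hφt
  have hT2 := t2Space_connSum hε hφt hψt
  have hSC := secondCountableTopology_connSum hε hφt hψt
  obtain ⟨hC, hI, j, hj⟩ := exists_gluingMaps hε hn hφt hψt hφ hψ
  refine ⟨hC, hI, j, hT2, hSC, fun _ _ => compactSpace_connSum,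
    fun oM oN hoM hoN => isOrientedAtlas_gluedAtlas hε hj hoM hoN hφd hψd, ?_,
    fun χ₁ χ₀ χ₂ hχ => ?_, fun hM hN => ?_, fun A B hA hAc hB hBc =>
      ⟨?_, isMobiusAtlas_gluedAtlas hε hj hA hB⟩⟩
  · obtain ⟨χ₁, χ₀, χ₂, hχ, -⟩ := hj.exists_isCutoff subset_rfl
    exact ⟨χ₁, χ₀, χ₂, hχ⟩
  · obtain ⟨g, hg⟩ := hχ.exists_isGluedMetric gM gN
    exact ⟨g, hg, hg.agreesOutside hχ hj subset_rfl fun y hy => hy.1,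
      hg.isLocallyConformallyFlat hε hj hχ⟩
  · obtain ⟨g, C, h⟩ := exists_isConformalExtension hε hj (A := {e | IsConformalChart gM e})
      (B := {e | IsConformalChart gN e}) (fun _ => id) hM (fun _ => id) hN hφd hφt hφc hψd hψt hψc
    exact ⟨g, fun z => (h.cover z).imp fun c hc => ⟨h.isConformalChart c hc.1, hc.2⟩,
      h.agreesOutside⟩
  · obtain ⟨g, C, h⟩ := exists_isConformalExtension hε hj hAc hA.cover hBc hB.cover
      hφd hφt hφc hψd hψt hψc
    exact ⟨C, g, h.isMobiusAtlas hA hB, h.isConformalChart, h.agreesOutside,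
      h.mobiusCompatible_left hA, h.mobiusCompatible_right hB⟩

open ConnectedSum in
theorem mainTheorem5 {n : ℕ} (hn : 0 < n)
    {M : Type*} [TopologicalSpace M] [T2Space M] [SecondCountableTopology M]
    [ChartedSpace (E n) M] [IsManifold 𝓘(ℝ, E n) ∞ M]
    {N : Type*} [TopologicalSpace N] [T2Space N] [SecondCountableTopology N]
    [ChartedSpace (E n) N] [IsManifold 𝓘(ℝ, E n) ∞ N]
    (gM : RMetric n M) (gN : RMetric n N)
    (oM : Set (OpenPartialHomeomorph M (E n))) (hoM : IsOrientedAtlas oM)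
    (oN : Set (OpenPartialHomeomorph N (E n))) (hoN : IsOrientedAtlas oN)
    (p : M) (q : N) (ε : ℝ) (hε : 0 < ε)
    (φ : OpenPartialHomeomorph M (E n)) (hφ : IsExpChart gM p (2 * ε) φ)
    (hφo : PreservesOrientation oM φ)
    (ψ : OpenPartialHomeomorph N (E n)) (hψ : IsExpChart gN q (2 * ε) ψ)
    (hψo : ReversesOrientation oN ψ) :
    -- `M ♯ N` is a smooth manifold, its charts being those of `M`, those of `N` and `Φ`
    ∃ (_ : ChartedSpace (E n) (ConnSum φ ψ ε))
      (_ : IsManifold 𝓘(ℝ, E n) ∞ (ConnSum φ ψ ε)) (j : GluingMaps φ ψ ε),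
      T2Space (ConnSum φ ψ ε) ∧ SecondCountableTopology (ConnSum φ ψ ε) ∧
      (CompactSpace M → CompactSpace N → CompactSpace (ConnSum φ ψ ε)) ∧
      -- the charts of the orientations of `M` and `N` and the gluing chart orient `M ♯ N`
      IsOrientedAtlas (gluedAtlas j oM oN) ∧
      -- cutoff functions exist, and any of them glue the metrics
      (∃ χ₁ χ₀ χ₂ : ConnSum φ ψ ε → ℝ, IsCutoff j χ₁ χ₀ χ₂) ∧
      (∀ χ₁ χ₀ χ₂ : ConnSum φ ψ ε → ℝ, IsCutoff j χ₁ χ₀ χ₂ →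
        ∃ g : RMetric n (ConnSum φ ψ ε),
          IsGluedMetric gM gN j χ₁ χ₀ χ₂ g ∧ AgreesOutside gM gN j g ∧
          -- the glued metric is itself locally conformally flat if the charts are conformal
          (IsLocallyConformallyFlat gM → IsLocallyConformallyFlat gN →
            IsConformalChart gM φ → IsConformalChart gN ψ → IsLocallyConformallyFlat g)) ∧
      -- local conformal flatness of `M ♯ N`
      (IsLocallyConformallyFlat gM → IsLocallyConformallyFlat gN →
        ∃ g : RMetric n (ConnSum φ ψ ε),
          IsLocallyConformallyFlat g ∧ AgreesOutside gM gN j g) ∧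
      -- the same in terms of atlases whose changes of charts are Möbius transformations
      (∀ (A : Set (OpenPartialHomeomorph M (E n))) (B : Set (OpenPartialHomeomorph N (E n))),
        IsMobiusAtlas A → (∀ e ∈ A, IsConformalChart gM e) →
        IsMobiusAtlas B → (∀ e ∈ B, IsConformalChart gN e) →
          (∃ (C : Set (OpenPartialHomeomorph (ConnSum φ ψ ε) (E n)))
            (g : RMetric n (ConnSum φ ψ ε)),
            IsMobiusAtlas C ∧ (∀ e ∈ C, IsConformalChart g e) ∧ AgreesOutside gM gN j g ∧
            (∀ e ∈ A, Disjoint e.source φ.source →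
              ∀ c ∈ C, MobiusCompatible c (j.inM.symm ≫ₕ e)) ∧
            (∀ e ∈ B, Disjoint e.source ψ.source →
              ∀ c ∈ C, MobiusCompatible c (j.inN.symm ≫ₕ e))) ∧
          -- Möbius gluing charts complete the two atlases to a Möbius atlas of `M ♯ N`
          ((∀ e ∈ A, MobiusCompatible e φ) → (∀ e ∈ B, MobiusCompatible e ψ) →
            IsMobiusAtlas (gluedAtlas j A B))) := by
  obtain ⟨hC, hI, j, hT2, hSC, hcompact, horiented, hmetrics⟩ :=
    mainTheorem5_general hn gM gN hε hφ.mem_smoothCharts hφ.target_eq hφ.conformalAt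
      hψ.mem_smoothCharts hψ.target_eq hψ.conformalAt
  exact ⟨hC, hI, j, hT2, hSC, hcompact, horiented oM oN hoM hoN hφo hψo, hmetrics⟩
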